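/- **Theorem.** There are a deterministic algorithm and constants $C, c, k$ with the following property. Let $N, s$ be natural numbers with $\gcd(N,s)=1$ and $s \ge N^{\alpha}$ for some real $0<\alpha<1/2$; let $r$ be a positive integer with $r \le \log_2 N$; let $d$ be a positive integer and $m$ a non-negative integer with $m \le d/r$; and let $P, H$ be non-negative integers with $H < P \le N^{1/r}$. Put $G = \lceil H/s\rceil + 1$ and assume $$G^{(d-1)/2} < \frac{1}{d^{1/2}\,2^{(d-1)/4}}\cdot\frac{(P-H)^{rm}}{N^{rm(m+1)/(2d)}}.$$ Then the algorithm, given $N, s, r, d, m, P, H$ in binary, outputs a list consisting of exactly those integers $p$ in the interval $[P-H,\,P+H]$ that satisfy $p^r \mid N$ and $p \equiv 1 \pmod s$, and it halts after at most $C\, d^{c}\, (\log_2 N)^{k}$ bit operations. -/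

import Mathlib

/-! A deterministic first-order programming language over binary integers and pairs, together with
its evaluation relation and its running time, counted in bit operations. -/

namespace BitCost

/-- Values: integers (stored in binary) and pairs (two pointers to immutable values). -/
inductive Val : Type
  | int (z : ℤ) : Val
  | pair (a b : Val) : Val

/-- Lists of integers as values: the empty list is the integer `0`, a nonempty list is the pair of
its head and its tail. -/
def Val.ofList : List ℤ → Val
  | [] => .int 0
  | z :: l => .pair (.int z) (Val.ofList l)

/-- The bit length of an integer: the binary digits of `|z|` and a sign bit. -/
def bitLen (z : ℤ) : ℕ := Nat.size z.natAbs + 1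

/-- The arithmetic instructions. -/
inductive Op : Type
  | add | sub | mul | div | mod | lt | eq

/-- The result of an arithmetic instruction. Division is Euclidean division (with `x / 0 = 0` and
`x % 0 = x`), comparisons return `1` (true) or `0` (false). -/
def Op.apply : Op → ℤ → ℤ → ℤ
  | .add, x, y => x + y
  | .sub, x, y => x - y
  | .mul, x, y => x * y
  | .div, x, y => x / y
  | .mod, x, y => x % y
  | .lt, x, y => if x < y then 1 else 0
  | .eq, x, y => if x = y then 1 else 0

/-- The number of bit operations charged for an arithmetic instruction: linear for addition and
subtraction, schoolbook cost for multiplication and division. A comparison scans the digits of both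
numbers in parallel, beginning with the least significant ones, until the shorter number ends. -/
def Op.cost : Op → ℤ → ℤ → ℕ
  | .add, x, y => bitLen x + bitLen y
  | .sub, x, y => bitLen x + bitLen y
  | .mul, x, y => bitLen x * bitLen y
  | .div, x, y => bitLen x * bitLen y
  | .mod, x, y => bitLen x * bitLen y
  | .lt, x, y => min (bitLen x) (bitLen y)
  | .eq, x, y => min (bitLen x) (bitLen y)

/-- Programs. A program is a finite expression, evaluated in an environment, which is the list of
the values of its variables (`var 0` is the variable bound last). -/
inductive Prog : Type
  /-- the value of the `i`-th variable -/
  | var (i : ℕ) : Prog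
  /-- an integer constant -/
  | const (z : ℤ) : Prog
  /-- an arithmetic instruction -/
  | op (o : Op) (e₁ e₂ : Prog) : Prog
  /-- the pair of two values -/
  | pair (e₁ e₂ : Prog) : Prog
  /-- first component of a pair -/
  | fst (e : Prog) : Prog
  /-- second component of a pair -/
  | snd (e : Prog) : Prog
  /-- `1` if the value is a pair, `0` if it is an integer -/
  | isPair (e : Prog) : Prog
  /-- evaluate `e₁` if the integer `c` is nonzero, and `e₂` otherwise -/
  | cond (c e₁ e₂ : Prog) : Prog
  /-- bind the value of `e` to a new variable `var 0` and evaluate `b` -/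
  | bind (e b : Prog) : Prog
  /-- call the subroutine `f` with the value of `e` as its only variable -/
  | call (f e : Prog) : Prog
  /-- while the integer `c` is nonzero, replace the variable `var 0` by the value of `b`;
  return the final value of this variable -/
  | loop (c b : Prog) : Prog

/-- `e.Eval ρ v t`: in the environment `ρ`, the program `e` halts with the value `v` after exactly
`t` bit operations. Each evaluated node costs one operation, and an arithmetic instruction costs
`Op.cost` in addition. A type error (such as adding a pair) or an infinite loop gives no value. -/
inductive Prog.Eval : Prog → List Val → Val → ℕ → Prop
  | var {ρ : List Val} {i : ℕ} {v : Val} (h : ρ[i]? = some v) : Prog.Eval (.var i) ρ v 1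
  | const {ρ : List Val} {z : ℤ} : Prog.Eval (.const z) ρ (.int z) 1
  | op {ρ : List Val} {o : Op} {e₁ e₂ : Prog} {x y : ℤ} {t₁ t₂ : ℕ}
      (h₁ : Prog.Eval e₁ ρ (.int x) t₁) (h₂ : Prog.Eval e₂ ρ (.int y) t₂) :
      Prog.Eval (.op o e₁ e₂) ρ (.int (o.apply x y)) (t₁ + t₂ + o.cost x y + 1)
  | pair {ρ : List Val} {e₁ e₂ : Prog} {v₁ v₂ : Val} {t₁ t₂ : ℕ}
      (h₁ : Prog.Eval e₁ ρ v₁ t₁) (h₂ : Prog.Eval e₂ ρ v₂ t₂) :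
      Prog.Eval (.pair e₁ e₂) ρ (.pair v₁ v₂) (t₁ + t₂ + 1)
  | fst {ρ : List Val} {e : Prog} {v₁ v₂ : Val} {t : ℕ}
      (h : Prog.Eval e ρ (.pair v₁ v₂) t) : Prog.Eval (.fst e) ρ v₁ (t + 1)
  | snd {ρ : List Val} {e : Prog} {v₁ v₂ : Val} {t : ℕ}
      (h : Prog.Eval e ρ (.pair v₁ v₂) t) : Prog.Eval (.snd e) ρ v₂ (t + 1)
  | isPair_pair {ρ : List Val} {e : Prog} {v₁ v₂ : Val} {t : ℕ}
      (h : Prog.Eval e ρ (.pair v₁ v₂) t) : Prog.Eval (.isPair e) ρ (.int 1) (t + 1)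
  | isPair_int {ρ : List Val} {e : Prog} {z : ℤ} {t : ℕ}
      (h : Prog.Eval e ρ (.int z) t) : Prog.Eval (.isPair e) ρ (.int 0) (t + 1)
  | cond_true {ρ : List Val} {c e₁ e₂ : Prog} {z : ℤ} {v : Val} {t₁ t₂ : ℕ}
      (hc : Prog.Eval c ρ (.int z) t₁) (hz : z ≠ 0) (h : Prog.Eval e₁ ρ v t₂) :
      Prog.Eval (.cond c e₁ e₂) ρ v (t₁ + t₂ + 1)
  | cond_false {ρ : List Val} {c e₁ e₂ : Prog} {v : Val} {t₁ t₂ : ℕ}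
      (hc : Prog.Eval c ρ (.int 0) t₁) (h : Prog.Eval e₂ ρ v t₂) :
      Prog.Eval (.cond c e₁ e₂) ρ v (t₁ + t₂ + 1)
  | bind {ρ : List Val} {e b : Prog} {v w : Val} {t₁ t₂ : ℕ}
      (he : Prog.Eval e ρ v t₁) (hb : Prog.Eval b (v :: ρ) w t₂) :
      Prog.Eval (.bind e b) ρ w (t₁ + t₂ + 1)
  | call {ρ : List Val} {f e : Prog} {v w : Val} {t₁ t₂ : ℕ}
      (he : Prog.Eval e ρ v t₁) (hf : Prog.Eval f [v] w t₂) :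
      Prog.Eval (.call f e) ρ w (t₁ + t₂ + 1)
  | loop_done {ρ : List Val} {c b : Prog} {v : Val} {t : ℕ}
      (hc : Prog.Eval c (v :: ρ) (.int 0) t) :
      Prog.Eval (.loop c b) (v :: ρ) v (t + 1)
  | loop_step {ρ : List Val} {c b : Prog} {z : ℤ} {v v' w : Val} {t₁ t₂ t₃ : ℕ}
      (hc : Prog.Eval c (v :: ρ) (.int z) t₁) (hz : z ≠ 0) (hb : Prog.Eval b (v :: ρ) v' t₂)
      (hl : Prog.Eval (.loop c b) (v' :: ρ) w t₃) :
      Prog.Eval (.loop c b) (v :: ρ) w (t₁ + t₂ + t₃ + 1)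

/-- Programs are deterministic: the result and the running time are determined by the input. -/
theorem Prog.Eval.unique {e : Prog} {ρ : List Val} {v : Val} {t : ℕ} (h : e.Eval ρ v t) :
    ∀ {v' : Val} {t' : ℕ}, e.Eval ρ v' t' → v = v' ∧ t = t' := by
  induction h with
  | var h => intro v' t' h'; cases h' with | var h2 => simp_all
  | const => intro v' t' h'; cases h'; simp
  | op _ _ i₁ i₂ =>
    intro v' t' h'
    cases h' with | op a b => have := i₁ a; have := i₂ b; simp_all
  | pair _ _ i₁ i₂ =>
    intro v' t' h'
    cases h' with | pair a b => have := i₁ a; have := i₂ b; simp_all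
  | fst _ i => intro v' t' h'; cases h' with | fst a => have := i a; simp_all
  | snd _ i => intro v' t' h'; cases h' with | snd a => have := i a; simp_all
  | isPair_pair _ i =>
    intro v' t' h'
    cases h' with
    | isPair_pair a => have := i a; simp_all
    | isPair_int a => have := i a; simp_all
  | isPair_int _ i =>
    intro v' t' h'
    cases h' with
    | isPair_pair a => have := i a; simp_all
    | isPair_int a => have := i a; simp_all
  | cond_true _ hz _ i₁ i₂ =>
    intro v' t' h'
    cases h' with
    | cond_true a _ b => have := i₁ a; have := i₂ b; simp_all
    | cond_false a b => have := i₁ a; simp_all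
  | cond_false _ _ i₁ i₂ =>
    intro v' t' h'
    cases h' with
    | cond_true a _ b => have := i₁ a; simp_all
    | cond_false a b => have := i₁ a; have := i₂ b; simp_all
  | bind _ _ i₁ i₂ =>
    intro v' t' h'
    cases h' with
    | bind a b => obtain ⟨rfl, rfl⟩ := i₁ a; have := i₂ b; simp_all
  | call _ _ i₁ i₂ =>
    intro v' t' h'
    cases h' with
    | call a b => obtain ⟨rfl, rfl⟩ := i₁ a; have := i₂ b; simp_all
  | loop_done _ i =>
    intro v' t' h'
    cases h' with
    | loop_done a => have := i a; simp_all
    | loop_step a _ _ _ => have := i a; simp_all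
  | loop_step _ hz _ _ i₁ i₂ i₃ =>
    intro v' t' h'
    cases h' with
    | loop_done a => have := i₁ a; simp_all
    | loop_step a _ b c =>
      obtain ⟨_, rfl⟩ := i₁ a
      obtain ⟨rfl, rfl⟩ := i₂ b
      obtain ⟨rfl, rfl⟩ := i₃ c
      simp

end BitCost

/-! Write a sought divisor as `p = 1 + s * x`, let `x₀` be the quotient of `P - 1` by `s` and put `y
= x - x₀`. The interval condition forces `|y| ≤ G`. Let `a` be the residue modulo `N` of `x₀ + s⁻¹`.
Modulo `N`, and hence modulo `p`, we have `s * (y + a) = 1 + s * x = p`. Since `p` and `s` are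
coprime, `p` divides `y + a`. Therefore each polynomial `N ^ (m - k / r) * (X + a) ^ k` with `k < d`
has at `y` a value divisible by `p ^ (r * m)` (`basisMat_mem`), and so has every integer
combination.

Scale the coefficient of `X ^ t` by `G ^ t`. The coefficient vectors become the rows of a lower
triangular matrix of determinant `N ^ (r m (m + 1) / 2) * G ^ (d (d - 1) / 2)`. LLL yields a nonzero
vector in the lattice of length at most `2 ^ ((d - 1) / 4)` times the `d`-th root of this
determinant (`lll_short`). By Cauchy–Schwarz the corresponding polynomial `g` satisfies `|g(y)| ≤ √d
* length`, which by the hypothesis is less than `(P - H) ^ (r m) ≤ p ^ (r m)`. Divisibility then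
forces `g(y) = 0` (`smallPoly_spec`). The polynomial `g` does not depend on `p`, so all solutions
come from the integer roots of a single nonzero polynomial of degree less than `d`, and a final test
removes the false candidates.

The integer roots are isolated exactly. A root followed by a non-root is a sign change of `-g ^ 2`.
Between two neighbouring sign changes of the `(k + 1)`-st forward difference, the `k`-th difference
is monotone, so it changes sign at most once there and bisection finds the place
(`mem_signChanges`). The descent starts at the `2d`-th difference, which vanishes identically.

For the running time, the functions computable in polynomial time (`PT`) are shown to be closed
under composition, loops with bounded states and list operations, and each ingredient is assembled
from these. LLL is run on integral Gram–Schmidt data: the coefficients remain integers because they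
are determinants of Gram matrices (`exists_int_of_gram`), and they remain small because every round
ends with a size reduction. The parameters `r`, `d`, `m` are measured in unary and `N`, `s`, `P`,
`H` in binary, so for `s ≤ N` the input size is `O(d log N)`. If `s > N`, then only `p = 1` is
possible and is treated separately. -/

namespace BitCost
-- Encodings, sizes and the class of polynomial-time functions.
open Polynomial

/-- Types whose elements are represented by values, with a notion of size. -/
class Enc (α : Type*) where
  enc : α → Val
  sz : α → ℕ

open Enc

/-- Natural numbers whose size is counted in unary. -/
structure Una where
  n : ℕ

instance : Enc ℤ := ⟨Val.int, bitLen⟩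
instance : Enc ℕ := ⟨fun n => Val.int n, fun n => bitLen n⟩
instance : Enc Bool := ⟨fun b => Val.int (if b then 1 else 0), fun _ => 2⟩
instance : Enc Una := ⟨fun n => Val.int n.n, fun n => n.n + 1⟩

instance {α β : Type*} [Enc α] [Enc β] : Enc (α × β) :=
  ⟨fun x => Val.pair (enc x.1) (enc x.2), fun x => sz x.1 + sz x.2 + 1⟩

instance {α : Type*} [Enc α] (P : α → Prop) : Enc {a // P a} := ⟨fun a => enc a.1, fun a => sz a.1⟩

/-- Lists are encoded as in `Val.ofList`. -/
def encList {α : Type*} [Enc α] : List α → Val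
  | [] => .int 0
  | a :: l => .pair (enc a) (encList l)

/-- The size of a list. -/
def szList {α : Type*} [Enc α] : List α → ℕ
  | [] => 1
  | a :: l => sz a + szList l + 1

instance {α : Type*} [Enc α] : Enc (List α) := ⟨encList, szList⟩

theorem enc_list_int (l : List ℤ) : enc l = Val.ofList l := by
  induction l with
  | nil => rfl
  | cons a l ih =>
    change Val.pair (enc a) (enc l) = _
    rw [ih]; rfl

section sizes
variable {α β : Type*} [Enc α] [Enc β]

@[simp] theorem sz_prod (x : α × β) : sz x = sz x.1 + sz x.2 + 1 := rfl
@[simp] theorem sz_nil : sz ([] : List α) = 1 := rfl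
@[simp] theorem sz_cons (a : α) (l : List α) : sz (a :: l) = sz a + sz l + 1 := rfl
@[simp] theorem sz_subtype {P : α → Prop} (a : {a // P a}) : sz a = sz a.1 := rfl
@[simp] theorem sz_una (n : Una) : sz n = n.n + 1 := rfl
@[simp] theorem sz_bool (b : Bool) : sz b = 2 := rfl
@[simp] theorem enc_bool (b : Bool) : enc b = Val.int (if b then 1 else 0) := rfl
@[simp] theorem enc_int (z : ℤ) : enc z = Val.int z := rfl
@[simp] theorem enc_nat (n : ℕ) : enc n = Val.int n := rfl
theorem sz_int (z : ℤ) : sz z = bitLen z := rfl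
theorem sz_nat (n : ℕ) : sz n = bitLen n := rfl

theorem length_lt_sz (l : List α) : l.length < sz l := by
  induction l with
  | nil => simp
  | cons a l ih => simp; omega

theorem sz_append (l l' : List α) : sz (l ++ l') + 1 = sz l + sz l' := by
  induction l with
  | nil => simp [add_comm]
  | cons a l ih => simp; omega

theorem sz_le_of_mem {l : List α} {a : α} (h : a ∈ l) : sz a < sz l := by
  induction l with
  | nil => simp at h
  | cons b l ih =>
    rcases List.mem_cons.1 h with rfl | h
    · simp
    · have := ih h; simp; omega

theorem sz_list_le {l : List α} {k B : ℕ} (hk : l.length ≤ k) (hB : ∀ a ∈ l, sz a ≤ B) :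
    sz l ≤ k * (B + 1) + 1 := by
  induction l generalizing k with
  | nil => simp
  | cons a l ih =>
    obtain ⟨k, rfl⟩ : ∃ j, k = j + 1 := ⟨k - 1, by simp at hk; omega⟩
    have h1 := ih (k := k) (by simpa using hk) (fun x hx => hB x (by simp [hx]))
    have h2 := hB a (by simp)
    simp only [sz_cons]
    nlinarith

theorem bitLen_le_iff {z : ℤ} {k : ℕ} : bitLen z ≤ k + 1 ↔ z.natAbs < 2 ^ k := by
  unfold bitLen; rw [Nat.add_le_add_iff_right, Nat.size_le]

theorem natAbs_lt_two_pow_sz (z : ℤ) : z.natAbs < 2 ^ sz z := by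
  rw [sz_int]
  exact lt_of_lt_of_le (bitLen_le_iff (k := Nat.size z.natAbs) |>.1 (by unfold bitLen; omega))
    (Nat.pow_le_pow_right (by norm_num) (by unfold bitLen; omega))

theorem abs_lt_two_pow_sz (z : ℤ) : |z| < 2 ^ sz z := by
  have := natAbs_lt_two_pow_sz z
  rw [Int.abs_eq_natAbs]; exact_mod_cast this

theorem nat_lt_two_pow_sz (n : ℕ) : n < 2 ^ sz n := by
  exact natAbs_lt_two_pow_sz (n : ℤ)

theorem sz_int_le {z : ℤ} {k : ℕ} (h : |z| ≤ 2 ^ k) : sz z ≤ k + 2 := by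
  rw [sz_int, show k + 2 = (k + 1) + 1 from rfl, bitLen_le_iff]
  rw [Int.abs_eq_natAbs] at h
  have : z.natAbs ≤ 2 ^ k := by exact_mod_cast h
  have := Nat.pow_pos (n := k) (show 0 < 2 by norm_num)
  rw [pow_succ]; omega

theorem sz_int_mono {x y : ℤ} (h : |x| ≤ |y|) : sz x ≤ sz y := by
  rw [sz_int, sz_int]; unfold bitLen
  have : x.natAbs ≤ y.natAbs := by
    rw [Int.abs_eq_natAbs, Int.abs_eq_natAbs] at h; exact_mod_cast h
  have := Nat.size_le_size this
  omega

theorem sz_nat_le_self (n : ℕ) : sz n ≤ n + 1 := by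
  rw [sz_nat]; unfold bitLen
  have : Nat.size n ≤ n := by rw [Nat.size_le]; exact Nat.lt_two_pow_self
  simpa using this

/-- The sign bit makes every size at least one, so sizes are subadditive without an extra carry
term. Sums over a list therefore grow by at most the size of the list. -/
theorem sz_add_le (x y : ℤ) : sz (x + y) ≤ sz x + sz y := by
  rw [sz_int, sz_int, sz_int, show bitLen y = Nat.size y.natAbs + 1 from rfl, ← add_assoc,
    bitLen_le_iff]
  have h1 : x.natAbs < 2 ^ bitLen x := natAbs_lt_two_pow_sz x
  have h2 : y.natAbs < 2 ^ y.natAbs.size := Nat.lt_size_self _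
  have h3 := Int.natAbs_add_le x y
  have h0 : bitLen x = x.natAbs.size + 1 := rfl
  have h1 : x.natAbs < 2 ^ x.natAbs.size := Nat.lt_size_self _
  rw [h0, add_right_comm, pow_succ, pow_add]
  have h4 : 0 < 2 ^ x.natAbs.size := by positivity
  have h5 : 0 < 2 ^ y.natAbs.size := by positivity
  nlinarith

theorem sz_neg (x : ℤ) : sz (-x) = sz x := by simp [sz_int, bitLen]

theorem sz_sub_le (x y : ℤ) : sz (x - y) ≤ sz x + sz y := by
  rw [sub_eq_add_neg]; simpa only [sz_neg] using sz_add_le x (-y)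

theorem sz_mul_le (x y : ℤ) : sz (x * y) ≤ sz x + sz y := by
  rw [sz_int, sz_int, sz_int, show bitLen y = Nat.size y.natAbs + 1 from rfl, ← add_assoc,
    bitLen_le_iff, Int.natAbs_mul]
  have h2 : y.natAbs < 2 ^ y.natAbs.size := Nat.lt_size_self _
  have h1 : x.natAbs < 2 ^ bitLen x := natAbs_lt_two_pow_sz x
  rw [pow_add]
  exact Nat.mul_lt_mul'' h1 h2

theorem sz_div_le (x y : ℤ) : sz (x / y) ≤ sz x + 1 := by
  have h : |x / y| ≤ |x| := by
    have := Int.natAbs_ediv_le_natAbs x y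
    rw [Int.abs_eq_natAbs, Int.abs_eq_natAbs]; exact_mod_cast this
  exact (sz_int_mono h).trans (Nat.le_succ _)

theorem sz_mod_le (x y : ℤ) : sz (x % y) ≤ sz x + sz y := by
  rcases eq_or_ne y 0 with rfl | hy
  · simp
  · refine (sz_int_mono (y := y) ?_).trans (Nat.le_add_left _ _)
    rw [abs_of_nonneg (Int.emod_nonneg _ hy)]
    exact (Int.emod_lt_abs _ hy).le

end sizes

/-- `w` is bounded by a polynomial in the size of its argument. -/
def PB {α : Type*} [Enc α] (w : α → ℕ) : Prop := ∃ b : ℕ[X], ∀ a, w a ≤ b.eval (sz a)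

theorem eval_mono (b : ℕ[X]) {m n : ℕ} (h : m ≤ n) : b.eval m ≤ b.eval n := by
  rw [eval_eq_sum, eval_eq_sum]
  exact Finset.sum_le_sum fun i _ => Nat.mul_le_mul_left _ (Nat.pow_le_pow_left h _)

namespace PB
variable {α β : Type*} [Enc α] [Enc β] {v w : α → ℕ}

theorem mono (hw : PB w) (h : ∀ a, v a ≤ w a) : PB v := by
  obtain ⟨b, hb⟩ := hw; exact ⟨b, fun a => (h a).trans (hb a)⟩

theorem const (c : ℕ) : PB fun _ : α => c := ⟨C c, by simp⟩

theorem size : PB fun a : α => sz a := ⟨X, by simp⟩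

theorem add (hv : PB v) (hw : PB w) : PB fun a => v a + w a := by
  obtain ⟨b, hb⟩ := hv; obtain ⟨c, hc⟩ := hw
  exact ⟨b + c, fun a => by rw [eval_add]; exact add_le_add (hb a) (hc a)⟩

theorem mul (hv : PB v) (hw : PB w) : PB fun a => v a * w a := by
  obtain ⟨b, hb⟩ := hv; obtain ⟨c, hc⟩ := hw
  exact ⟨b * c, fun a => by rw [eval_mul]; exact Nat.mul_le_mul (hb a) (hc a)⟩

theorem eval (b : ℕ[X]) (hw : PB w) : PB fun a => b.eval (w a) := by
  obtain ⟨c, hc⟩ := hw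
  exact ⟨b.comp c, fun a => by rw [eval_comp]; exact eval_mono b (hc a)⟩

theorem comp {v : β → ℕ} {f : α → β} (hv : PB v) (hf : PB fun a => sz (f a)) :
    PB fun a => v (f a) := by
  obtain ⟨b, hb⟩ := hv
  exact (hf.eval b).mono fun a => hb _

end PB

/-- `f` is computed by a program in polynomial time, and the size of its values is polynomially
bounded. -/
@[fun_prop]
def PT {α β : Type*} [Enc α] [Enc β] (f : α → β) : Prop :=
  ∃ (p : Prog) (T : α → ℕ), (∀ a, ∃ t ≤ T a, p.Eval [enc a] (enc (f a)) t) ∧ PB T ∧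
    PB fun a => sz (f a)

namespace PT
variable {α β γ δ : Type*} [Enc α] [Enc β] [Enc γ] [Enc δ]

theorem pb {f : α → β} (hf : PT f) : PB fun a => sz (f a) := by
  obtain ⟨_, _, _, _, h⟩ := hf; exact h

@[fun_prop]
theorem id : PT fun a : α => a :=
  ⟨.var 0, fun _ => 1, fun _ => ⟨1, le_rfl, .var rfl⟩, PB.const 1, PB.size⟩

theorem exists_prog (v : Val) : ∃ (p : Prog) (t : ℕ), ∀ ρ, p.Eval ρ v t := by
  induction v with
  | int z => exact ⟨.const z, 1, fun ρ => .const⟩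
  | pair a b iha ihb =>
    obtain ⟨p, t, hp⟩ := iha; obtain ⟨q, s, hq⟩ := ihb
    exact ⟨.pair p q, t + s + 1, fun ρ => .pair (hp ρ) (hq ρ)⟩

@[fun_prop]
theorem const (b : β) : PT fun _ : α => b := by
  obtain ⟨p, t, hp⟩ := exists_prog (enc b)
  exact ⟨p, fun _ => t, fun _ => ⟨t, le_rfl, hp _⟩, PB.const _, PB.const _⟩

-- This is why `PT` carries a bound on the size of the values: the time of `g` is measured in the
-- size of `f a`, which must itself be polynomial in the size of `a`.
@[fun_prop]
theorem comp {g : β → γ} {f : α → β} (hg : PT g) (hf : PT f) : PT fun a => g (f a) := by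
  obtain ⟨p, T, hp, hT, hs⟩ := hf
  obtain ⟨q, U, hq, hU, hu⟩ := hg
  refine ⟨.call q p, fun a => T a + U (f a) + 1, fun a => ?_,
    (hT.add (hU.comp hs)).add (PB.const 1), hu.comp hs⟩
  obtain ⟨t, ht, h⟩ := hp a
  obtain ⟨u, hu, h'⟩ := hq (f a)
  exact ⟨t + u + 1, by dsimp only; omega, .call h h'⟩

@[fun_prop]
theorem prodMk {f : α → β} {g : α → γ} (hf : PT f) (hg : PT g) : PT fun a => (f a, g a) := by
  obtain ⟨p, T, hp, hT, hs⟩ := hf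
  obtain ⟨q, U, hq, hU, hu⟩ := hg
  refine ⟨.pair p q, fun a => T a + U a + 1, fun a => ?_,
    (hT.add hU).add (PB.const 1), (hs.add hu).add (PB.const 1)⟩
  obtain ⟨t, ht, h⟩ := hp a
  obtain ⟨u, hu, h'⟩ := hq a
  exact ⟨t + u + 1, by dsimp only; omega, .pair h h'⟩

@[fun_prop]
theorem fst {f : α → β × γ} (hf : PT f) : PT fun a => (f a).1 := by
  obtain ⟨p, T, hp, hT, hs⟩ := hf
  refine ⟨.fst p, fun a => T a + 1, fun a => ?_, hT.add (PB.const 1), hs.mono fun a => ?_⟩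
  · obtain ⟨t, ht, h⟩ := hp a
    exact ⟨t + 1, by dsimp only; omega, .fst h⟩
  · simp; omega

@[fun_prop]
theorem snd {f : α → β × γ} (hf : PT f) : PT fun a => (f a).2 := by
  obtain ⟨p, T, hp, hT, hs⟩ := hf
  refine ⟨.snd p, fun a => T a + 1, fun a => ?_, hT.add (PB.const 1), hs.mono fun a => ?_⟩
  · obtain ⟨t, ht, h⟩ := hp a
    exact ⟨t + 1, by dsimp only; omega, .snd h⟩
  · simp; omega

/-- Transfer between types with the same encoding. -/
theorem of_enc_eq {f : α → β} {g : α → γ} (hf : PT f) (h : ∀ a, enc (g a) = enc (f a))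
    (hs : PB fun a => sz (g a)) : PT g := by
  obtain ⟨p, T, hp, hT, _⟩ := hf
  exact ⟨p, T, fun a => by rw [h a]; exact hp a, hT, hs⟩

@[fun_prop]
theorem subtype_val {P : β → Prop} {f : α → {b // P b}} (hf : PT f) : PT fun a => (f a).1 :=
  hf.of_enc_eq (fun _ => rfl) hf.pb

@[fun_prop]
theorem nat_cast {f : α → ℕ} (hf : PT f) : PT fun a => ((f a : ℕ) : ℤ) :=
  hf.of_enc_eq (fun _ => rfl) hf.pb

-- Both types share one encoding, so nothing is computed. Only this direction is free: read in the
-- other direction, the size could grow exponentially.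
@[fun_prop]
theorem una_val {f : α → Una} (hf : PT f) : PT fun a => (f a).n :=
  hf.of_enc_eq (fun _ => rfl) (hf.pb.mono fun _ => sz_nat_le_self _)

theorem arith (o : Op) {f g : α → ℤ} (hf : PT f) (hg : PT g)
    (h : ∀ x y, sz (o.apply x y) ≤ sz x + sz y + 2) : PT fun a => o.apply (f a) (g a) := by
  obtain ⟨p, T, hp, hT, hs⟩ := hf
  obtain ⟨q, U, hq, hU, hu⟩ := hg
  refine ⟨.op o p q, fun a => T a + U a + (sz (f a) + sz (g a) + sz (f a) * sz (g a)) + 1,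
    fun a => ?_, ((hT.add hU).add ((hs.add hu).add (hs.mul hu))).add (PB.const 1),
    ((hs.add hu).add (PB.const 2)).mono fun a => h _ _⟩
  obtain ⟨t, ht, h⟩ := hp a
  obtain ⟨u, hu, h'⟩ := hq a
  refine ⟨_, ?_, .op h h'⟩
  have : o.cost (f a) (g a) ≤ sz (f a) + sz (g a) + sz (f a) * sz (g a) := by
    simp only [sz_int]
    cases o <;> simp only [Op.cost] <;> try omega
  dsimp only; omega

section arith
variable {f g : α → ℤ} (hf : PT f) (hg : PT g)
include hf hg

@[fun_prop]
theorem add : PT fun a => f a + g a :=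
  arith .add hf hg fun x y => (sz_add_le x y).trans (by omega)

@[fun_prop]
theorem sub : PT fun a => f a - g a :=
  arith .sub hf hg fun x y => (sz_sub_le x y).trans (by omega)

@[fun_prop]
theorem mul : PT fun a => f a * g a :=
  arith .mul hf hg fun x y => (sz_mul_le x y).trans (by omega)

@[fun_prop]
theorem div : PT fun a => f a / g a :=
  arith .div hf hg fun x y => (sz_div_le x y).trans (by omega)

@[fun_prop]
theorem mod : PT fun a => f a % g a :=
  arith .mod hf hg fun x y => (sz_mod_le x y).trans (by omega)

@[fun_prop]
theorem lt : PT fun a => decide (f a < g a) :=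
  (arith .lt hf hg fun x y => by
    have : sz (0 : ℤ) ≤ 2 ∧ sz (1 : ℤ) ≤ 2 := by decide
    simp only [Op.apply]; split <;> omega).of_enc_eq
    (fun a => by simp [Op.apply]) (PB.const 2)

@[fun_prop]
theorem eq : PT fun a => decide (f a = g a) :=
  (arith .eq hf hg fun x y => by
    have : sz (0 : ℤ) ≤ 2 ∧ sz (1 : ℤ) ≤ 2 := by decide
    simp only [Op.apply]; split <;> omega).of_enc_eq
    (fun a => by simp [Op.apply]) (PB.const 2)

end arith

theorem cond_bool {c : α → Bool} {f g : α → β} (hc : PT c) (hf : PT f) (hg : PT g) :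
    PT fun a => if c a = true then f a else g a := by
  obtain ⟨r, S, hr, hS, _⟩ := hc
  obtain ⟨p, T, hp, hT, hs⟩ := hf
  obtain ⟨q, U, hq, hU, hu⟩ := hg
  refine ⟨.cond r p q, fun a => S a + (T a + U a) + 1, fun a => ?_,
    (hS.add (hT.add hU)).add (PB.const 1), (hs.add hu).mono fun a => by dsimp only; split <;> omega⟩
  obtain ⟨s, hs, h0⟩ := hr a
  obtain ⟨t, ht, h1⟩ := hp a
  obtain ⟨u, hu, h2⟩ := hq a
  cases hc : c a
  · refine ⟨s + u + 1, by dsimp only; omega, ?_⟩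
    rw [hc] at h0
    simpa [hc] using Prog.Eval.cond_false (e₁ := p) h0 h2
  · refine ⟨s + t + 1, by dsimp only; omega, ?_⟩
    rw [hc] at h0
    simpa [hc] using Prog.Eval.cond_true (e₂ := q) h0 (by norm_num) h1

@[fun_prop]
theorem ite {P : α → Prop} [DecidablePred P] {f g : α → β} (hc : PT fun a => decide (P a))
    (hf : PT f) (hg : PT g) : PT fun a => if P a then f a else g a := by
  simpa using cond_bool hc hf hg

@[fun_prop]
theorem not {P : α → Prop} [DecidablePred P] (h : PT fun a => decide (P a)) :
    PT fun a => decide (¬ P a) := by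
  have := cond_bool h (const (α := α) false) (const true)
  refine cast (congrArg _ (funext fun a => ?_)) this
  by_cases hp : P a <;> simp [hp]

@[fun_prop]
theorem and {P Q : α → Prop} [DecidablePred P] [DecidablePred Q] (h : PT fun a => decide (P a))
    (h' : PT fun a => decide (Q a)) : PT fun a => decide (P a ∧ Q a) := by
  have := cond_bool h h' (const false)
  refine cast (congrArg _ (funext fun a => ?_)) this
  by_cases hp : P a <;> simp [hp]

@[fun_prop]
theorem le {f g : α → ℤ} (hf : PT f) (hg : PT g) : PT fun a => decide (f a ≤ g a) := by
  simpa using (lt hg hf).not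

@[fun_prop]
theorem neg {f : α → ℤ} (hf : PT f) : PT fun a => - f a := by
  simpa using (const (0 : ℤ)).sub hf

@[fun_prop]
theorem toNat {f : α → ℤ} (hf : PT f) : PT fun a => (f a).toNat := by
  refine of_enc_eq (f := fun a => if f a < 0 then 0 else f a) (by fun_prop) (fun a => ?_)
    (hf.pb.mono fun a => ?_)
  · simp only [enc_nat, enc_int]; split <;> congr 1 <;> omega
  · refine sz_int_mono (x := ((f a).toNat : ℤ)) ?_
    rw [Nat.abs_cast]
    rcases le_total 0 (f a) with h | h
    · rw [Int.toNat_of_nonneg h]; exact le_abs_self _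
    · rw [Int.toNat_of_nonpos h]; simp

section nat
variable {f g : α → ℕ} (hf : PT f) (hg : PT g)
include hf hg

@[fun_prop]
theorem nat_add : PT fun a => f a + g a := by
  have : PT fun a => ((f a : ℤ) + (g a : ℤ)).toNat := by fun_prop
  refine cast (congrArg _ (funext fun a => ?_)) this
  omega

@[fun_prop]
theorem nat_sub : PT fun a => f a - g a := by
  have : PT fun a => ((f a : ℤ) - (g a : ℤ)).toNat := by fun_prop
  refine cast (congrArg _ (funext fun a => ?_)) this
  omega

@[fun_prop]
theorem nat_mul : PT fun a => f a * g a := by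
  have : PT fun a => ((f a : ℤ) * (g a : ℤ)).toNat := by fun_prop
  refine cast (congrArg _ (funext fun a => ?_)) this
  norm_cast

@[fun_prop]
theorem nat_div : PT fun a => f a / g a := by
  have : PT fun a => ((f a : ℤ) / (g a : ℤ)).toNat := by fun_prop
  refine cast (congrArg _ (funext fun a => ?_)) this
  norm_cast

@[fun_prop]
theorem nat_lt : PT fun a => decide (f a < g a) := by
  have : PT fun a => decide ((f a : ℤ) < (g a : ℤ)) := by fun_prop
  simpa using this

@[fun_prop]
theorem nat_le : PT fun a => decide (f a ≤ g a) := by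
  have : PT fun a => decide ((f a : ℤ) ≤ (g a : ℤ)) := by fun_prop
  simpa using this

@[fun_prop]
theorem nat_eq : PT fun a => decide (f a = g a) := by
  have : PT fun a => decide ((f a : ℤ) = (g a : ℤ)) := by fun_prop
  simpa using this

end nat

end PT
end BitCost

/-! ### Loops and list functions in polynomial time. -/

namespace BitCost
open Enc Polynomial

/-- The first iterate of `f` at which `c` fails (or the start, if there is none). -/
noncomputable def whileLoop {σ : Type*} (c : σ → Bool) (f : σ → σ) (s : σ) : σ :=
  open Classical in if h : ∃ n, c (f^[n] s) = false then f^[Nat.find h] s else s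

theorem whileLoop_spec {σ : Type*} {c : σ → Bool} {f : σ → σ} {s : σ}
    (h : ∃ n, c (f^[n] s) = false) :
    ∃ n, whileLoop c f s = f^[n] s ∧ c (f^[n] s) = false ∧ (∀ i < n, c (f^[i] s) = true) ∧
      ∀ m, c (f^[m] s) = false → n ≤ m := by
  classical
  refine ⟨Nat.find h, ?_, Nat.find_spec h, fun i hi => ?_, fun m hm => Nat.find_min' h hm⟩
  · unfold whileLoop
    rw [dif_pos h]
  · simpa using Nat.find_min h hi

/-- An invariant which is preserved while the condition holds is true at the end. -/
theorem whileLoop_induction {σ : Type*} {c : σ → Bool} {f : σ → σ} {s : σ} (I : σ → Prop)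
    (h : ∃ n, c (f^[n] s) = false) (h0 : I s) (hs : ∀ s, I s → c s = true → I (f s)) :
    I (whileLoop c f s) ∧ c (whileLoop c f s) = false := by
  obtain ⟨n, hn, hc, hi, _⟩ := whileLoop_spec h
  rw [hn]
  refine ⟨?_, hc⟩
  have : ∀ j ≤ n, I (f^[j] s) := by
    intro j
    induction j with
    | zero => exact fun _ => h0
    | succ j ih =>
      intro hj
      rw [Function.iterate_succ_apply']
      exact hs _ (ih (by omega)) (hi j (by omega))
  exact this n le_rfl

/-- If a potential at least halves in each step, then the loop ends after logarithmically many
steps. -/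
theorem exists_iterate_of_potential {σ : Type*} {c : σ → Bool} {f : σ → σ} {s : σ} (I : σ → Prop)
    (Φ : σ → ℕ) (h0 : I s) (hs : ∀ s, I s → c s = true → I (f s))
    (hpos : ∀ s, I s → c s = true → 0 < Φ s)
    (hΦ : ∀ s, I s → c s = true → 2 * Φ (f s) ≤ Φ s) {k : ℕ} (hk : Φ s < 2 ^ k) :
    ∃ n ≤ k, c (f^[n] s) = false ∧ ∀ i ≤ n, I (f^[i] s) := by
  induction k generalizing s with
  | zero =>
    refine ⟨0, le_rfl, ?_, ?_⟩
    · by_contra hc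
      have := hpos s h0 (by simpa using hc)
      simp at hk; omega
    · intro i hi
      obtain rfl : i = 0 := by omega
      exact h0
  | succ k ih =>
    cases hc : c s
    · refine ⟨0, by omega, hc, ?_⟩
      intro i hi
      obtain rfl : i = 0 := by omega
      exact h0
    · have h1 := hs s h0 hc
      have h2 := hΦ s h0 hc
      obtain ⟨n, hn, hc', hI⟩ := ih h1 (by rw [pow_succ] at hk; omega)
      refine ⟨n + 1, by omega, hc', fun i hi => ?_⟩
      cases i with
      | zero => exact h0
      | succ i => exact hI i (by omega)

theorem exists_eval_loop {σ : Type*} [Enc σ] {c : σ → Bool} {f : σ → σ} {p q : Prog} {B : ℕ}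
    {s : σ} {n : ℕ} (hp : ∀ i ≤ n, ∃ t ≤ B, p.Eval [enc (f^[i] s)] (enc (c (f^[i] s))) t)
    (hq : ∀ i ≤ n, ∃ t ≤ B, q.Eval [enc (f^[i] s)] (enc (f (f^[i] s))) t)
    (hc : c (f^[n] s) = false) (hi : ∀ i < n, c (f^[i] s) = true) :
    ∃ t ≤ (n + 1) * (2 * B + 1), (Prog.loop p q).Eval [enc s] (enc (f^[n] s)) t := by
  induction n generalizing s with
  | zero =>
    obtain ⟨t, ht, h⟩ := hp 0 le_rfl
    rw [hc] at h
    exact ⟨t + 1, by omega, .loop_done h⟩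
  | succ n ih =>
    obtain ⟨u, hu, h⟩ := ih (s := f s) (fun i hi => hp (i + 1) (by omega))
      (fun i hi => hq (i + 1) (by omega)) hc (fun j hj => hi (j + 1) (by omega))
    obtain ⟨t, ht, h1⟩ := hp 0 (by omega)
    obtain ⟨v, hv, h2⟩ := hq 0 (by omega)
    rw [hi 0 (by omega)] at h1
    refine ⟨t + v + u + 1, ?_, .loop_step h1 (by norm_num) h2 h⟩
    calc t + v + u + 1 ≤ (n + 1) * (2 * B + 1) + (2 * B + 1) := by omega
      _ = _ := by ring

namespace PT
variable {α β γ δ σ : Type*} [Enc α] [Enc β] [Enc γ] [Enc δ] [Enc σ]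

/-- The size of all intermediate states has to be bounded separately, because iterating a
polynomial-time step can make sizes grow exponentially even when there are few rounds. The index `m`
need not be the first at which the condition fails, since the loop stops no later than that. -/
theorem whileLoop {c : σ → Bool} {f : σ → σ} {init : α → σ} (hc : PT c) (hf : PT f)
    (hi : PT init) {n w : α → ℕ} (hn : PB n) (hw : PB w)
    (h : ∀ a, ∃ m ≤ n a, c (f^[m] (init a)) = false ∧ ∀ i ≤ m, sz (f^[i] (init a)) ≤ w a) :
    PT fun a => whileLoop c f (init a) := by
  obtain ⟨pi, Ti, hi, hTi, -⟩ := hi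
  obtain ⟨p, T, hp, ⟨bT, hT⟩, -⟩ := hc
  obtain ⟨q, U, hq, ⟨bU, hU⟩, -⟩ := hf
  refine ⟨.call (.loop p q) pi, fun a => Ti a +
    (n a + 1) * (2 * (bT.eval (w a) + bU.eval (w a)) + 1) + 1, fun a => ?_,
    (hTi.add ((hn.add (PB.const 1)).mul (((PB.const 2).mul
      ((hw.eval bT).add (hw.eval bU))).add (PB.const 1)))).add (PB.const 1), hw.mono fun a => ?_⟩
  · obtain ⟨m, hm, hcm, hs⟩ := h a
    obtain ⟨k, hk, hck, hik, hmin⟩ := whileLoop_spec ⟨m, hcm⟩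
    have hkm := hmin m hcm
    obtain ⟨t, ht, h1⟩ := hi a
    obtain ⟨u, hu, h2⟩ := exists_eval_loop (B := bT.eval (w a) + bU.eval (w a)) (p := p) (q := q)
      (fun i hi => by
        obtain ⟨t, ht, h⟩ := hp (f^[i] (init a))
        exact ⟨t, (ht.trans ((hT _).trans (eval_mono _ (hs i (by omega))))).trans
          (Nat.le_add_right _ _), h⟩)
      (fun i hi => by
        obtain ⟨t, ht, h⟩ := hq (f^[i] (init a))
        exact ⟨t, (ht.trans ((hU _).trans (eval_mono _ (hs i (by omega))))).trans
          (Nat.le_add_left _ _), h⟩) hck hik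
    beta_reduce
    rw [hk]
    refine ⟨t + u + 1, ?_, .call h1 h2⟩
    have : (k + 1) * (2 * (bT.eval (w a) + bU.eval (w a)) + 1) ≤
      (n a + 1) * (2 * (bT.eval (w a) + bU.eval (w a)) + 1) :=
      Nat.mul_le_mul_right _ (by omega)
    omega
  · obtain ⟨m, hm, hcm, hs⟩ := h a
    obtain ⟨k, hk, -, -, hmin⟩ := whileLoop_spec ⟨m, hcm⟩
    beta_reduce
    rw [hk]
    exact hs k (hmin m hcm)

@[fun_prop]
theorem cons {f : α → β} {l : α → List β} (hf : PT f) (hl : PT l) : PT fun a => f a :: l a :=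
  (hf.prodMk hl).of_enc_eq (fun _ => rfl) (((hf.pb.add hl.pb).add (PB.const 1)).mono fun _ => le_rfl)

@[fun_prop]
theorem isEmpty {l : α → List β} (hl : PT l) : PT fun a => (l a).isEmpty := by
  have : PT fun a => !(l a).isEmpty := by
    obtain ⟨p, T, hp, hT, hs⟩ := hl
    refine ⟨.isPair p, fun a => T a + 1, fun a => ?_, hT.add (PB.const 1), PB.const 2⟩
    obtain ⟨t, ht, h⟩ := hp a
    refine ⟨t + 1, by dsimp only; omega, ?_⟩
    beta_reduce
    cases hla : l a with
    | nil => rw [hla] at h; exact .isPair_int h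
    | cons b l' => rw [hla] at h; exact .isPair_pair h
  refine cast (congrArg _ (funext fun a => ?_)) (cond_bool this (const false) (const true))
  cases (l a).isEmpty <;> rfl

@[fun_prop]
theorem headD {f : α → β} {l : α → List β} (hl : PT l) (hf : PT f) :
    PT fun a => (l a).headD (f a) := by
  obtain ⟨p, T, hp, hT, hs⟩ := hl
  obtain ⟨q, U, hq, hU, hu⟩ := hf
  refine ⟨.cond (.isPair p) (.fst p) q, fun a => 2 * T a + U a + 3, fun a => ?_,
    (((PB.const 2).mul hT).add hU).add (PB.const 3), (hs.add hu).mono fun a => ?_⟩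
  · obtain ⟨t, ht, h⟩ := hp a
    obtain ⟨u, hu, h'⟩ := hq a
    beta_reduce
    cases hla : l a with
    | nil =>
      rw [hla] at h
      exact ⟨t + 1 + u + 1, by omega, .cond_false (.isPair_int h) h'⟩
    | cons b l' =>
      rw [hla] at h
      exact ⟨t + 1 + (t + 1) + 1, by omega, .cond_true (.isPair_pair h) (by norm_num) (.fst h)⟩
  · beta_reduce
    cases l a <;> simp <;> omega

@[fun_prop]
theorem tail {l : α → List β} (hl : PT l) : PT fun a => (l a).tail := by
  obtain ⟨p, T, hp, hT, hs⟩ := hl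
  refine ⟨.cond (.isPair p) (.snd p) (.const 0), fun a => 2 * T a + 4, fun a => ?_,
    (((PB.const 2).mul hT)).add (PB.const 4), hs.mono fun a => ?_⟩
  · obtain ⟨t, ht, h⟩ := hp a
    beta_reduce
    cases hla : l a with
    | nil =>
      rw [hla] at h
      exact ⟨t + 1 + 1 + 1, by omega, .cond_false (.isPair_int h) .const⟩
    | cons b l' =>
      rw [hla] at h
      exact ⟨t + 1 + (t + 1) + 1, by omega, .cond_true (.isPair_pair h) (by norm_num) (.snd h)⟩
  · beta_reduce
    cases l a <;> simp <;> omega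

theorem foldl_step_iterate {Γ α β : Type*} (g : Γ) (step : Γ → β → α → β) (a₀ : α) (l : List α)
    (b : β) (i : ℕ) (hi : i ≤ l.length) :
    (fun s : Γ × List α × β => (s.1, s.2.1.tail, step s.1 s.2.2 (s.2.1.headD a₀)))^[i] (g, l, b) =
      (g, l.drop i, (l.take i).foldl (step g) b) := by
  induction i generalizing l b with
  | zero => simp
  | succ i ih =>
    cases l with
    | nil => simp at hi
    | cons a l =>
      rw [Function.iterate_succ_apply]
      simp only [List.tail_cons, List.headD_cons, List.drop_succ_cons, List.take_succ_cons,
        List.foldl_cons]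
      exact ih l _ (by simpa using hi)

theorem sz_drop_le (l : List α) (i : ℕ) : sz (l.drop i) ≤ sz l := by
  induction l generalizing i with
  | nil => simp
  | cons a l ih =>
    cases i with
    | zero => simp
    | succ i => have := ih i; simp only [List.drop_succ_cons, sz_cons]; omega

/-- The fold is a loop whose state consists of the parameter, the rest of the list and the
accumulator. The values on prefixes of the list are exactly the accumulators that occur. -/
theorem foldl {l : γ → List α} {init : γ → β} {step : γ → β → α → β} (hl : PT l)
    (hi : PT init) (hs : PT fun x : γ × β × α => step x.1 x.2.1 x.2.2) {w : γ → ℕ} (hw : PB w)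
    (hb : ∀ g l', l' <+: l g → sz (l'.foldl (step g) (init g)) ≤ w g) :
    PT fun g => (l g).foldl (step g) (init g) := by
  -- The loop body reads the head of the list with a default value, which exists only for a nonempty
  -- type. Over an empty type every list is empty.
  rcases isEmpty_or_nonempty α with hα | ⟨⟨a₀⟩⟩
  · refine cast (congrArg _ (funext fun g => ?_)) hi
    cases h : l g with
    | nil => rfl
    | cons a => exact hα.elim a
  have h1 : PT fun s : γ × List α × β => decide (¬ s.2.1.isEmpty = true) :=
    PT.not (P := fun s : γ × List α × β => s.2.1.isEmpty = true) (by simp only [Bool.decide_eq_true]; fun_prop)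
  have h2 : PT fun s : γ × List α × β => (s.1, s.2.1.tail, step s.1 s.2.2 (s.2.1.headD a₀)) :=
    PT.prodMk (by fun_prop) (PT.prodMk (by fun_prop) (hs.comp
      (f := fun s : γ × List α × β => (s.1, s.2.2, s.2.1.headD a₀)) (by fun_prop)))
  have key := PT.whileLoop (init := fun g => (g, l g, init g)) h1 h2
    (PT.id.prodMk (hl.prodMk hi)) hl.pb (((PB.size (α := γ)).add (hl.pb.add hw)).add (PB.const 2))
    (fun g => ⟨(l g).length, (length_lt_sz _).le, by
      rw [foldl_step_iterate _ _ _ _ _ _ le_rfl]; simp, fun i hi => by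
      rw [foldl_step_iterate _ _ _ _ _ _ hi]
      have := hb g _ (List.take_prefix i (l g))
      have := sz_drop_le (l g) i
      simp only [sz_prod]; omega⟩)
  refine cast (congrArg _ (funext fun g => ?_)) key.snd.snd
  obtain ⟨n, hn, hc, hlt, hmin⟩ := whileLoop_spec
    (c := fun s : γ × List α × β => decide (¬ s.2.1.isEmpty = true))
    (f := fun s : γ × List α × β => (s.1, s.2.1.tail, step s.1 s.2.2 (s.2.1.headD a₀)))
    (s := (g, l g, init g)) ⟨(l g).length, by
      rw [foldl_step_iterate _ _ _ _ _ _ le_rfl]; simp⟩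
  have hle := hmin (l g).length (by rw [foldl_step_iterate _ _ _ _ _ _ le_rfl]; simp)
  rw [hn]
  rw [foldl_step_iterate _ _ _ _ _ _ hle] at hc ⊢
  simp at hc
  rw [List.take_of_length_le hc]

/-- Folding a function which increases the size by a bounded amount. -/
theorem foldl_of_le {l : γ → List α} {init : γ → β} {step : γ → β → α → β} (hl : PT l)
    (hi : PT init) (hs : PT fun x : γ × β × α => step x.1 x.2.1 x.2.2) {w : γ → ℕ} (hw : PB w)
    (hb : ∀ g b, ∀ a ∈ l g, sz (step g b a) ≤ sz b + w g) :
    PT fun g => (l g).foldl (step g) (init g) := by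
  refine foldl hl hi hs (hi.pb.add (hl.pb.mul hw)) fun g l' hl' => ?_
  have : sz (l'.foldl (step g) (init g)) ≤ sz (init g) + l'.length * w g := by
    have hmem : ∀ a ∈ l', a ∈ l g := fun a ha => hl'.subset ha
    clear hl'
    induction l' using List.reverseRecOn with
    | nil => simp
    | append_singleton l' a ih =>
      rw [List.foldl_append]
      have h1 := ih fun a ha => hmem a (by simp [ha])
      have h2 := hb g (l'.foldl (step g) (init g)) a (hmem a (by simp))
      simp only [List.foldl_cons, List.foldl_nil, List.length_append, List.length_singleton]
      rw [add_mul]; omega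
  have h1 := hl'.length_le
  have h2 := length_lt_sz (l g)
  exact this.trans (Nat.add_le_add_left (Nat.mul_le_mul_right _ (by omega)) _)

@[fun_prop]
theorem reverse {l : γ → List α} (hl : PT l) : PT fun g => (l g).reverse := by
  refine cast (congrArg _ (funext fun g => ?_)) (foldl_of_le (β := List α) (init := fun _ => [])
    (step := fun _ b a => a :: b) hl (const []) (by fun_prop) (hl.pb.add (PB.const 1))
    fun g b a ha => ?_)
  · rw [List.foldl_flip_cons_eq_append']; simp
  · have := sz_le_of_mem ha
    simp; omega

@[fun_prop]
theorem map {l : γ → List α} {f : γ → α → β} (hl : PT l) (hf : PT fun x : γ × α => f x.1 x.2) :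
    PT fun g => (l g).map (f g) := by
  obtain ⟨b, hb⟩ := hf.pb
  have h2 : PT fun x : γ × List β × α => f x.1 x.2.2 :=
    hf.comp (f := fun x : γ × List β × α => (x.1, x.2.2)) (by fun_prop)
  have := foldl_of_le (β := List β) (init := fun _ => [])
    (step := fun g b a => f g a :: b) hl (const []) (by fun_prop)
    (w := fun g => b.eval (sz g + sz (l g) + 1) + 1)
    (((((PB.size (α := γ)).add hl.pb).add (PB.const 1)).eval b).add (PB.const 1))
    fun g bb a ha => by
      have h1 := sz_le_of_mem ha
      have h3 := (hb (g, a)).trans (eval_mono b (n := sz g + sz (l g) + 1) (by simp; omega))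
      simp at h3 ⊢; omega
  refine cast (congrArg _ (funext fun g => ?_)) this.reverse
  generalize l g = l
  suffices h : ∀ acc, (l.foldl (fun b a => f g a :: b) acc).reverse = acc.reverse ++ l.map (f g) by
    simp
  induction l with
  | nil => simp
  | cons a l ih => simp

@[fun_prop]
theorem append {l l' : γ → List α} (hl : PT l) (hl' : PT l') : PT fun g => l g ++ l' g := by
  refine cast (congrArg _ (funext fun g => ?_)) (foldl_of_le (β := List α) (init := l')
    (step := fun _ b a => a :: b) hl.reverse hl' (by fun_prop) (hl.pb.add (PB.const 1))
    fun g b a ha => ?_)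
  · rw [List.foldl_flip_cons_eq_append']; simp
  · have := sz_le_of_mem (List.mem_reverse.1 ha)
    simp; omega

@[fun_prop]
theorem flatten {l : γ → List (List α)} (hl : PT l) : PT fun g => (l g).flatten := by
  refine cast (congrArg _ (funext fun g => ?_)) (foldl_of_le (β := List α) (init := fun _ => [])
    (step := fun _ b a => b ++ a) hl (const []) (by fun_prop) hl.pb
    fun g b a ha => ?_)
  · generalize l g = l
    suffices h : ∀ acc, l.foldl (fun b a => b ++ a) acc = acc ++ l.flatten by simpa using h []
    induction l with
    | nil => simp
    | cons a l ih => intro acc; simp [ih]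
  · have := sz_le_of_mem ha
    have := sz_append b a
    omega

@[fun_prop]
theorem length {l : γ → List α} (hl : PT l) : PT fun g => (l g).length := by
  refine cast (congrArg _ (funext fun g => ?_)) (foldl_of_le (β := ℕ) (init := fun _ => 0)
    (step := fun _ b _ => b + 1) hl (const 0) (by fun_prop) (PB.const 2)
    fun g b a ha => ?_)
  · generalize l g = l
    suffices h : ∀ acc, l.foldl (fun b _ => b + 1) acc = acc + l.length by simp
    induction l with
    | nil => simp
    | cons a l ih => intro acc; simp [ih]; omega
  · exact sz_add_le (b : ℤ) 1

@[fun_prop]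
theorem filter {l : γ → List α} {P : γ → α → Bool} (hl : PT l)
    (hf : PT fun x : γ × α => P x.1 x.2) : PT fun g => (l g).filter (P g) := by
  have h : PT fun x : γ × α => if P x.1 x.2 = true then [x.2] else [] :=
    cond_bool hf (by fun_prop) (by fun_prop)
  refine cast (congrArg _ (funext fun g => ?_))
    (map (f := fun g a => if P g a = true then [a] else []) hl h).flatten
  induction l g with
  | nil => rfl
  | cons a l ih => by_cases hp : P g a = true <;> simp [hp, ih]

@[fun_prop]
theorem getD {l : γ → List α} {i : γ → ℕ} {d : γ → α} (hl : PT l) (hi : PT i) (hd : PT d) :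
    PT fun g => (l g).getD (i g) (d g) := by
  have := foldl (β := ℕ × α) (init := fun g => (0, d g))
    (step := fun g b a => (b.1 + 1, if b.1 = i g then a else b.2)) hl (by fun_prop)
    (PT.prodMk (by fun_prop) (PT.ite (PT.nat_eq (by fun_prop) (hi.comp PT.id.fst)) (by fun_prop) (by fun_prop)))
    (hd.pb.add ((hl.pb.mul (PB.const 2)).add (PB.const 2)))
    (fun g l' hl' => by
      have h1 : ∀ b : ℕ × α, (l'.foldl (fun b a => (b.1 + 1, if b.1 = i g then a else b.2)) b).1
          = b.1 + l'.length ∧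
          sz (l'.foldl (fun b a => (b.1 + 1, if b.1 = i g then a else b.2)) b).2 ≤ sz b.2 + sz (l g) := by
        have hmem : ∀ a ∈ l', a ∈ l g := fun a ha => hl'.subset ha
        intro b
        clear hl'
        induction l' using List.reverseRecOn with
        | nil => simp
        | append_singleton l' a ih =>
          have h1 := ih fun a ha => hmem a (by simp [ha])
          have h2 := sz_le_of_mem (hmem a (by simp))
          simp only [List.foldl_append, List.foldl_cons, List.foldl_nil, List.length_append,
            List.length_singleton]
          refine ⟨by omega, ?_⟩
          split <;> omega
      have h2 := h1 (0, d g)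
      have h3 := hl'.length_le
      have h4 := length_lt_sz (l g)
      have h5 := sz_nat_le_self (0 + l'.length)
      rw [sz_prod, h2.1]
      dsimp only at h2 ⊢
      omega)
  refine cast (congrArg _ (funext fun g => ?_)) this.snd
  generalize l g = l
  suffices h : ∀ (j : ℕ) (x : α), (l.foldl (fun b a => (b.1 + 1, if b.1 = i g then a else b.2)) (j, x)).2
    = if i g < j then x else l.getD (i g - j) x by simpa using h 0 (d g)
  induction l with
  | nil => simp
  | cons a l ih =>
    intro j x
    simp only [List.foldl_cons]
    rw [ih]
    rcases lt_trichotomy (i g) j with h | h | h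
    · rw [if_pos (by omega), if_pos h, if_neg (by omega)]
    · rw [if_pos (by omega), if_pos h.symm, if_neg (by omega)]
      simp [h]
    · rw [if_neg (by omega), if_neg (by omega), if_neg (by omega)]
      obtain ⟨k, hk⟩ : ∃ k, i g = j + 1 + k := ⟨i g - j - 1, by omega⟩
      rw [hk, show j + 1 + k - (j + 1) = k by omega, show j + 1 + k - j = k + 1 by omega]
      simp

-- The argument is of unary size because the output has that many elements. Counting down produces
-- the list in increasing order.
@[fun_prop]
theorem range {n : γ → Una} (hn : PT n) : PT fun g => List.range (n g).n := by
  have hit : ∀ (n i : ℕ), i ≤ n → (fun s : ℕ × List ℕ => (s.1 - 1, (s.1 - 1) :: s.2))^[i] (n, []) =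
      (n - i, List.range' (n - i) i) := by
    intro n i
    induction i with
    | zero => intro; rfl
    | succ i ih =>
      intro hi
      rw [Function.iterate_succ_apply', ih (by omega)]
      simp only [Prod.mk.injEq]
      refine ⟨by omega, ?_⟩
      rw [List.range'_succ, show n - (i + 1) + 1 = n - i by omega,
        show n - i - 1 = n - (i + 1) by omega]
  have := PT.whileLoop (c := fun s : ℕ × List ℕ => decide (0 < s.1))
    (f := fun s => (s.1 - 1, (s.1 - 1) :: s.2)) (init := fun g => ((n g).n, []))
    (by fun_prop) (by fun_prop) (by fun_prop) hn.pb
    ((hn.pb.add ((hn.pb.mul (hn.pb.add (PB.const 1))))).add (PB.const 2))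
    (fun g => ⟨(n g).n, by simp, by simp [hit], fun i hi => by
      rw [hit _ _ hi]
      simp only [sz_prod, sz_una]
      have h1 := sz_nat_le_self ((n g).n - i)
      have h2 : sz (List.range' ((n g).n - i) i) ≤ ((n g).n + 1) * (((n g).n + 1) + 1) + 1 := by
        refine sz_list_le (by simp; omega) fun a ha => ?_
        have := sz_nat_le_self a
        simp at ha; omega
      omega⟩)
  refine cast (congrArg _ (funext fun g => ?_)) this.snd
  obtain ⟨m, hm, hc, -, hmin⟩ := whileLoop_spec (c := fun s : ℕ × List ℕ => decide (0 < s.1))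
    (f := fun s => (s.1 - 1, (s.1 - 1) :: s.2)) (s := ((n g).n, [])) ⟨(n g).n, by simp [hit]⟩
  have hle := hmin (n g).n (by simp [hit])
  rw [hm]
  rw [hit _ _ hle] at hc ⊢
  simp at hc
  obtain rfl : m = (n g).n := by omega
  simp [List.range_eq_range']

end PT
end BitCost

/-! ### Integrality of Gram–Schmidt coefficients; matrices as lists of rows. -/

namespace BitCost

/-- The `c`-th Gram determinant, if `ℓ` holds the integral Gram-Schmidt coefficients. -/
def gramDet {R : Type*} [One R] (ℓ : ℕ → ℕ → R) (c : ℕ) : R := if c = 0 then 1 else ℓ (c - 1) (c - 1)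

@[simp] theorem gramDet_zero {R : Type*} [One R] (ℓ : ℕ → ℕ → R) : gramDet ℓ 0 = 1 := rfl
@[simp] theorem gramDet_succ {R : Type*} [One R] (ℓ : ℕ → ℕ → R) (c : ℕ) :
    gramDet ℓ (c + 1) = ℓ c c := rfl

open Finset in
/-- The integral Gram-Schmidt coefficients of integer vectors are integers. -/
theorem exists_int_of_gram {n : ℕ} {g : ℕ → ℕ → ℤ} {ℓ : ℕ → ℕ → ℚ}
    (tri : ∀ i j, i < j → j < n → ℓ i j = 0) (hD : ∀ i < n, ℓ i i ≠ 0)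
    (hg : ∀ i j, i < n → j < n →
      (g i j : ℚ) = ∑ c ∈ range n, ℓ i c * ℓ j c / (gramDet ℓ c * gramDet ℓ (c + 1)))
    {i j : ℕ} (hi : i < n) (hj : j < n) : ∃ z : ℤ, ℓ i j = z := by
  rcases lt_or_ge i j with h | hji
  · exact ⟨0, by simpa using tri i j h hj⟩
  -- `G` is the matrix of inner products of the vectors `0, …, j` with the vectors `0, …, j - 1, i`.
  -- The Gram identity factors it as lower triangular times diagonal times upper triangular, and
  -- after cancellation its determinant is exactly `ℓ i j`.
  let σ : ℕ → ℕ := fun b => if b = j then i else b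
  let A : Matrix (Fin (j + 1)) (Fin (j + 1)) ℚ := fun a c => ℓ a c
  let E : Matrix (Fin (j + 1)) (Fin (j + 1)) ℚ :=
    Matrix.diagonal fun c => 1 / (gramDet ℓ (c : ℕ) * gramDet ℓ ((c : ℕ) + 1))
  let B : Matrix (Fin (j + 1)) (Fin (j + 1)) ℚ := fun a c => ℓ (σ a) c
  let G : Matrix (Fin (j + 1)) (Fin (j + 1)) ℤ := fun a b => g a (σ b)
  have hne : ∀ c, c ≤ j + 1 → gramDet ℓ c ≠ 0 := by
    intro c hc
    cases c with
    | zero => simp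
    | succ c => exact hD c (by omega)
  have hmul : G.map (Int.cast : ℤ → ℚ) = A * E * B.transpose := by
    ext a b
    have ha := a.2
    have hb := b.2
    have hσ : σ b < n := by dsimp only [σ]; split <;> omega
    rw [Matrix.mul_apply, Matrix.map_apply, hg a (σ b) (by omega) hσ]
    have : range (j + 1) ⊆ range n := range_subset_range.2 (by omega)
    rw [← sum_subset this (fun c hc hc' => by
      rw [tri a c (by simp at hc'; omega) (by simpa using hc)]; simp)]
    rw [← Fin.sum_univ_eq_sum_range (fun c => ℓ a c * ℓ (σ b) c / (gramDet ℓ c * gramDet ℓ (c + 1)))]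
    refine Finset.sum_congr rfl fun c _ => ?_
    rw [Matrix.mul_diagonal]
    change _ = ℓ a c * (1 / _) * ℓ (σ b) c
    ring
  have hA : A.det = ∏ c ∈ range (j + 1), gramDet ℓ (c + 1) := by
    rw [Matrix.det_of_isLowerTriangular A (fun a c hac => tri a c hac (by have := c.2; omega))]
    exact Fin.prod_univ_eq_prod_range (fun c => gramDet ℓ (c + 1)) (j + 1)
  have hB : B.det = (∏ c ∈ range j, gramDet ℓ (c + 1)) * ℓ i j := by
    rw [Matrix.det_of_isLowerTriangular B]
    · have := Fin.prod_univ_eq_prod_range (fun c => ℓ (σ c) c) (j + 1)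
      refine this.trans ?_
      rw [prod_range_succ]
      congr 1
      · refine prod_congr rfl fun c hc => ?_
        have : c ≠ j := by have := mem_range.1 hc; omega
        simp [σ, this]
      · simp [σ]
    · intro a c hac
      have := c.2
      have hac : (a : ℕ) < c := hac
      refine tri _ _ ?_ (by omega)
      have : (a : ℕ) ≠ j := by omega
      simpa [σ, this] using hac
  have hE : E.det = ∏ c ∈ range (j + 1), 1 / (gramDet ℓ c * gramDet ℓ (c + 1)) := by
    rw [Matrix.det_diagonal]
    exact Fin.prod_univ_eq_prod_range (fun c => 1 / (gramDet ℓ c * gramDet ℓ (c + 1))) (j + 1)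
  refine ⟨G.det, ?_⟩
  have hdet : ((G.det : ℤ) : ℚ) = A.det * E.det * B.det := by
    rw [← Matrix.det_transpose B, ← Matrix.det_mul, ← Matrix.det_mul, ← hmul]
    exact Int.cast_det G
  rw [hdet, hA, hE, hB]
  -- The shift of the index loses nothing because the zeroth Gram determinant is one.
  have h1 : ∏ c ∈ range (j + 1), gramDet ℓ c = ∏ c ∈ range j, gramDet ℓ (c + 1) := by
    rw [prod_range_succ']; simp
  have h2 : ∏ c ∈ range (j + 1), 1 / (gramDet ℓ c * gramDet ℓ (c + 1)) =
      1 / ((∏ c ∈ range j, gramDet ℓ (c + 1)) * ∏ c ∈ range (j + 1), gramDet ℓ (c + 1)) := by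
    rw [← h1, ← prod_mul_distrib, prod_div_distrib, prod_const_one]
  have h3 : ∏ c ∈ range j, gramDet ℓ (c + 1) ≠ 0 :=
    prod_ne_zero_iff.2 fun c hc => hne _ (by have := mem_range.1 hc; omega)
  have h4 : ∏ c ∈ range (j + 1), gramDet ℓ (c + 1) ≠ 0 :=
    prod_ne_zero_iff.2 fun c hc => hne _ (by have := mem_range.1 hc; omega)
  rw [h2]
  field_simp

/-- The entry of a matrix given as a list of rows. -/
def ent (M : List (List ℤ)) (i j : ℕ) : ℤ := (M.getD i []).getD j 0

/-- The matrix with `n` rows and `k` columns and given entries. -/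
def mat (n k : ℕ) (f : ℕ → ℕ → ℤ) : List (List ℤ) :=
  (List.range n).map fun i => (List.range k).map fun j => f i j

theorem getD_map_range {α : Type*} (n : ℕ) (f : ℕ → α) (i : ℕ) (d : α) :
    ((List.range n).map f).getD i d = if i < n then f i else d := by
  rw [List.getD_eq_getElem?_getD]
  split <;> rename_i h
  · simp [h]
  · simp [Nat.le_of_not_lt h]

theorem ent_mat (n k : ℕ) (f : ℕ → ℕ → ℤ) {i : ℕ} (j : ℕ) (hi : i < n) :
    ent (mat n k f) i j = if j < k then f i j else 0 := by
  rw [ent, mat, getD_map_range, if_pos hi, getD_map_range]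

namespace PT
variable {γ : Type*} [Enc γ]

@[fun_prop]
theorem ent {M : γ → List (List ℤ)} {i j : γ → ℕ} (hM : PT M) (hi : PT i) (hj : PT j) :
    PT fun g => ent (M g) (i g) (j g) := by
  unfold BitCost.ent; fun_prop

@[fun_prop]
theorem gramDet {M : γ → List (List ℤ)} {i : γ → ℕ} (hM : PT M) (hi : PT i) :
    PT fun g => gramDet (BitCost.ent (M g)) (i g) := by
  unfold BitCost.gramDet; fun_prop

theorem mat {n k : γ → Una} {f : γ → ℕ → ℕ → ℤ} (hn : PT n) (hk : PT k)
    (hf : PT fun x : (γ × ℕ) × ℕ => f x.1.1 x.1.2 x.2) :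
    PT fun g => mat (n g).n (k g).n (f g) := by
  unfold BitCost.mat
  exact PT.map (f := fun g i => (List.range (k g).n).map fun j => f g i j) (by fun_prop)
    (PT.map (γ := γ × ℕ) (f := fun x j => f x.1 x.2 j) (by fun_prop) hf)

@[fun_prop]
theorem una_mk_mul {n : γ → Una} (c : ℕ) (hn : PT n) : PT fun g => Una.mk (c * (n g).n) :=
  PT.of_enc_eq (f := fun g => c * (n g).n) (by fun_prop) (fun _ => rfl)
    (((PB.const c).mul hn.pb).add (PB.const 1) |>.mono fun a => by simp; nlinarith)

end PT
end BitCost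

/-! ### Lattice bases with integral Gram–Schmidt data: size reduction and exchange of rows. -/

namespace BitCost
open Finset

/-- The difference between the inner product of the vectors in the columns `n, …, 2 n - 1` of two
rows and its value computed from the Gram-Schmidt coefficients in the first `n` columns. -/
def gramForm (n : ℕ) (D : ℕ → ℤ) (v : ℕ → ℤ) : (ℕ → ℤ) →+ ℚ where
  toFun u := ∑ t ∈ range n, (u (n + t) * v (n + t) : ℚ) -
    ∑ c ∈ range n, (u c * v c / (D c * D (c + 1)) : ℚ)
  map_zero' := by simp
  map_add' u u' := by
    simp only [Pi.add_apply, Int.cast_add, add_mul, add_div, sum_add_distrib]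
    ring

theorem gramForm_comm (n : ℕ) (D u v : ℕ → ℤ) : gramForm n D v u = gramForm n D u v := by
  simp only [gramForm, AddMonoidHom.coe_mk, ZeroHom.coe_mk, mul_comm]

theorem gramForm_congr {n : ℕ} {D D' : ℕ → ℤ} (h : ∀ c ≤ n, D c = D' c) (v : ℕ → ℤ) :
    gramForm n D v = gramForm n D' v := by
  ext u
  simp only [gramForm, AddMonoidHom.coe_mk, ZeroHom.coe_mk]
  congr 1
  refine sum_congr rfl fun c hc => ?_
  have := mem_range.1 hc
  rw [h c (by omega), h (c + 1) (by omega)]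

/-- A matrix whose row `i` consists of the integral Gram-Schmidt coefficients of a vector `b i`
(with the Gram determinant on the diagonal), followed by the vector `b i` in the lattice `L`. -/
structure LatticeData (n : ℕ) (L : AddSubgroup (ℕ → ℤ)) (M : List (List ℤ)) : Prop where
  supp : ∀ i < n, ∀ j, 2 * n ≤ j → ent M i j = 0
  tri : ∀ i j, i < j → j < n → ent M i j = 0
  pos : ∀ i < n, 0 < ent M i i
  gram : ∀ i j, i < n → j < n → gramForm n (gramDet (ent M)) (ent M j) (ent M i) = 0
  mem : ∀ i < n, (fun t => ent M i (n + t)) ∈ L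

/-- One step of the size reduction of a row. -/
def reduceStep (n : ℕ) (M : List (List ℤ)) (row : List ℤ) (l : ℕ) : List ℤ :=
  (List.range (2 * n)).map fun j =>
    row.getD j 0 - (2 * row.getD l 0 + ent M l l) / (2 * ent M l l) * ent M l j

/-- Size reduction of row `k`. -/
def reduceRow (n : ℕ) (M : List (List ℤ)) (k : ℕ) : List ℤ :=
  (List.range n).reverse.foldl (fun row l => if l < k then reduceStep n M row l else row)
    (M.getD k [])

/-- Size reduction of all rows. -/
def sizeReduce (n : ℕ) (M : List (List ℤ)) : List (List ℤ) :=
  mat n (2 * n) fun i j => (reduceRow n M i).getD j 0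

/-- The exchange of the rows `k` and `k + 1`. -/
def swapRows (n : ℕ) (M : List (List ℤ)) (k : ℕ) : List (List ℤ) :=
  mat n (2 * n) fun i j =>
    let i' := if i = k then k + 1 else if i = k + 1 then k else i
    if j = k then
      (ent M i' k * ent M (k + 1) k + ent M i' (k + 1) * gramDet (ent M) k) / ent M k k
    else if j = k + 1 then
      (ent M (k + 1) (k + 1) * ent M i' k - ent M (k + 1) k * ent M i' (k + 1)) / ent M k k
    else ent M i' j

theorem reduceStep_getD {n : ℕ} {M : List (List ℤ)} {row : List ℤ} {l : ℕ}
    (hr : ∀ j, 2 * n ≤ j → row.getD j 0 = 0) (hM : ∀ j, 2 * n ≤ j → ent M l j = 0) (j : ℕ) :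
    (reduceStep n M row l).getD j 0 =
      row.getD j 0 - (2 * row.getD l 0 + ent M l l) / (2 * ent M l l) * ent M l j := by
  rw [reduceStep, getD_map_range]
  split
  · rfl
  · rename_i h
    rw [hr j (by omega), hM j (by omega)]; simp

/-- The quotient `(2 * x + D) / (2 * D)` is `x / D` rounded to a nearest integer. -/
theorem abs_sub_round_le {x D : ℤ} (hD : 0 < D) : 2 * |x - (2 * x + D) / (2 * D) * D| ≤ D := by
  have h1 := Int.emod_nonneg (2 * x + D) (show 2 * D ≠ 0 by omega)
  have h2 := Int.emod_lt_of_pos (2 * x + D) (show 0 < 2 * D by omega)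
  have h3 := Int.mul_ediv_add_emod (2 * x + D) (2 * D)
  rw [show (2 : ℤ) * |x - (2 * x + D) / (2 * D) * D| = |2 * (x - (2 * x + D) / (2 * D) * D)| by
    rw [abs_mul]; rfl, abs_le]
  constructor <;> linarith

/-- Membership in every subgroup that contains the old rows says that the new row is an integer
combination of them, in a form that can be applied to the lattice `L` and to kernels of `gramForm`.
The columns are treated from right to left: by triangularity, subtracting a multiple of row `l`
leaves the columns between `l` and `n` unchanged, so entries already reduced stay reduced. -/
theorem reduceRow_spec {n : ℕ} {L : AddSubgroup (ℕ → ℤ)} {M : List (List ℤ)}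
    (hM : LatticeData n L M) {k : ℕ} (hk : k < n) :
    (∀ K : AddSubgroup (ℕ → ℤ), (∀ i < n, ent M i ∈ K) →
      (fun j => (reduceRow n M k).getD j 0) ∈ K) ∧
    (∀ j, k ≤ j → j < n → (reduceRow n M k).getD j 0 = ent M k j) ∧
    (∀ l < k, 2 * |(reduceRow n M k).getD l 0| ≤ ent M l l) ∧
    (∀ j, 2 * n ≤ j → (reduceRow n M k).getD j 0 = 0) := by
  suffices h : ∀ m ≤ n, ∀ row : List ℤ,
      (∀ K : AddSubgroup (ℕ → ℤ), (∀ i < n, ent M i ∈ K) → (fun j => row.getD j 0) ∈ K) ∧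
      (∀ j, k ≤ j → j < n → row.getD j 0 = ent M k j) ∧
      (∀ l < k, m ≤ l → 2 * |row.getD l 0| ≤ ent M l l) ∧
      (∀ j, 2 * n ≤ j → row.getD j 0 = 0) →
      ∀ row', row' = (List.range m).reverse.foldl
        (fun row l => if l < k then reduceStep n M row l else row) row →
      (∀ K : AddSubgroup (ℕ → ℤ), (∀ i < n, ent M i ∈ K) → (fun j => row'.getD j 0) ∈ K) ∧
      (∀ j, k ≤ j → j < n → row'.getD j 0 = ent M k j) ∧
      (∀ l < k, 2 * |row'.getD l 0| ≤ ent M l l) ∧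
      (∀ j, 2 * n ≤ j → row'.getD j 0 = 0) by
    exact h n le_rfl (M.getD k []) ⟨fun K hK => hK k hk, fun j _ _ => rfl, fun l _ _ => by omega,
      hM.supp k hk⟩ _ rfl
  intro m
  induction m with
  | zero =>
    rintro - row ⟨h1, h2, h3, h4⟩ _ rfl
    exact ⟨h1, h2, fun l hl => h3 l hl (by omega), h4⟩
  | succ m ih =>
    rintro hm row ⟨h1, h2, h3, h4⟩ row' rfl
    refine ih (by omega) (if m < k then reduceStep n M row m else row) ?_ _ (by
      rw [List.range_succ, List.reverse_append]; rfl)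
    by_cases hmk : m < k
    · rw [if_pos hmk]
      have hs := reduceStep_getD h4 (hM.supp m (by omega))
      refine ⟨fun K hK => ?_, fun j hj hjn => ?_, fun l hl hlm => ?_, fun j hj => ?_⟩
      · have := K.sub_mem (h1 K hK) (K.zsmul_mem (hK m (by omega))
          ((2 * row.getD m 0 + ent M m m) / (2 * ent M m m)))
        refine cast (congrArg (· ∈ K) (funext fun j => ?_)) this
        rw [hs]; simp
      · rw [hs, hM.tri m j (by omega) hjn, h2 j hj hjn]; simp
      · rw [hs]
        rcases hlm.eq_or_lt with rfl | hlm
        · exact abs_sub_round_le (hM.pos m (by omega))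
        · rw [hM.tri m l hlm (by omega)]; simpa using h3 l hl hlm
      · rw [hs, hM.supp m (by omega) j hj, h4 j hj]; simp
    · rw [if_neg hmk]
      exact ⟨h1, h2, fun l hl hlm => by omega, h4⟩

theorem ent_sizeReduce {n : ℕ} {L : AddSubgroup (ℕ → ℤ)} {M : List (List ℤ)}
    (hM : LatticeData n L M) {i : ℕ} (hi : i < n) (j : ℕ) :
    ent (sizeReduce n M) i j = (reduceRow n M i).getD j 0 := by
  rw [sizeReduce, ent_mat _ _ _ _ hi]
  split
  · rfl
  · rw [(reduceRow_spec hM hi).2.2.2 j (by omega)]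

theorem LatticeData.sizeReduce {n : ℕ} {L : AddSubgroup (ℕ → ℤ)} {M : List (List ℤ)}
    (hM : LatticeData n L M) :
    LatticeData n L (sizeReduce n M) ∧
    (∀ i < n, ent (sizeReduce n M) i i = ent M i i) ∧
    ∀ i l, l < i → i < n → 2 * |ent (sizeReduce n M) i l| ≤ ent (sizeReduce n M) l l := by
  have hdiag : ∀ i < n, ent (BitCost.sizeReduce n M) i i = ent M i i := fun i hi => by
    rw [ent_sizeReduce hM hi, (reduceRow_spec hM hi).2.1 i le_rfl hi]
  have hD : ∀ c ≤ n, gramDet (ent (BitCost.sizeReduce n M)) c = gramDet (ent M) c := by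
    intro c hc
    cases c with
    | zero => rfl
    | succ c => exact hdiag c (by omega)
  have hmem : ∀ i < n, ∀ K : AddSubgroup (ℕ → ℤ), (∀ i < n, ent M i ∈ K) →
      ent (BitCost.sizeReduce n M) i ∈ K := by
    intro i hi K hK
    rw [show ent (BitCost.sizeReduce n M) i = fun j => (reduceRow n M i).getD j 0 from
      funext fun j => ent_sizeReduce hM hi j]
    exact (reduceRow_spec hM hi).1 K hK
  refine ⟨⟨fun i hi j hj => ?_, fun i j hij hj => ?_, fun i hi => ?_, fun i j hi hj => ?_,
    fun i hi => ?_⟩, hdiag, fun i l hl hi => ?_⟩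
  · rw [ent_sizeReduce hM hi]; exact (reduceRow_spec hM hi).2.2.2 j hj
  · rw [ent_sizeReduce hM (by omega), (reduceRow_spec hM (by omega)).2.1 j hij.le hj]
    exact hM.tri i j hij hj
  · rw [hdiag i hi]; exact hM.pos i hi
  -- The form vanishes on all pairs of old rows. The new rows lie in the span of the old ones, so it
  -- vanishes on the new pairs by additivity, used in one argument and then in the other.
  · rw [gramForm_congr hD]
    refine hmem i hi (gramForm n (gramDet (ent M)) (ent (BitCost.sizeReduce n M) j)).ker
      fun i hi => ?_
    rw [AddMonoidHom.mem_ker, gramForm_comm]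
    refine hmem j hj (gramForm n (gramDet (ent M)) (ent M i)).ker fun j hj => ?_
    exact hM.gram j i hj hi
  · exact hmem i hi (L.comap (AddMonoidHom.mk' (fun (u : ℕ → ℤ) t => u (n + t)) fun _ _ => rfl)) hM.mem
  · rw [hdiag l (by omega), ent_sizeReduce hM hi]
    exact (reduceRow_spec hM hi).2.2.1 l hl

theorem sum_eq_sum_of_pair {R : Type*} [AddCommGroup R] {n k : ℕ} (hk : k + 1 < n) {f g : ℕ → R}
    (h : ∀ c, c ≠ k → c ≠ k + 1 → f c = g c) (h2 : f k + f (k + 1) = g k + g (k + 1)) :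
    ∑ c ∈ range n, f c = ∑ c ∈ range n, g c := by
  rw [← sub_eq_zero, ← sum_sub_distrib]
  rw [← sum_subset (s₁ := {k, k + 1})
    (by intro c hc; simp only [mem_insert, mem_singleton] at hc; rw [mem_range]; omega)
    (fun c _ hc => by
      simp only [mem_insert, mem_singleton, not_or] at hc
      rw [h c hc.1 hc.2, sub_self])]
  rw [sum_pair (by omega), ← sub_eq_zero.2 h2]
  abel

/-- The result of `swapRows`, before it is known that the divisions are exact. -/
def swapCoeff (ℓ : ℕ → ℕ → ℤ) (k i j : ℕ) : ℚ :=
  let i' := if i = k then k + 1 else if i = k + 1 then k else i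
  if j = k then
    ((ℓ i' k * ℓ (k + 1) k + ℓ i' (k + 1) * gramDet ℓ k : ℤ) : ℚ) / (ℓ k k : ℤ)
  else if j = k + 1 then
    ((ℓ (k + 1) (k + 1) * ℓ i' k - ℓ (k + 1) k * ℓ i' (k + 1) : ℤ) : ℚ) / (ℓ k k : ℤ)
  else ℓ i' j

/-- With `E`, `D`, `F` the Gram determinants of orders `k`, `k + 1`, `k + 2` and `l` the coefficient
of row `k + 1` at column `k`, both sides are the inner product of the components of two vectors in
the plane spanned by two consecutive Gram–Schmidt vectors. On the left it is computed in the
orthogonal basis obtained after the exchange, on the right in the old one. -/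
theorem swapCoeff_aux {x x' y y' l E D F : ℚ} (hD : D ≠ 0) (hE : E ≠ 0) (hF : F ≠ 0)
    (h : l * l + F * E ≠ 0) :
    ((x * l + x' * E) / D) * ((y * l + y' * E) / D) / (E * ((l * l + F * E) / D)) +
      ((F * x - l * x') / D) * ((F * y - l * y') / D) / ((l * l + F * E) / D * F) =
    x * y / (E * D) + x' * y' / (D * F) := by
  have h' : l ^ 2 + E * F ≠ 0 := by rwa [sq, mul_comm E]
  field_simp
  ring

/-- The exchange formulas are first read over the rationals as `swapCoeff`, where triangularity and
the Gram identity can be checked. `exists_int_of_gram` then shows that the rational values are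
integers, so the integer divisions in `swapRows` are exact. Only the Gram determinant of order `k +
1` changes; the last clause gives its new value. -/
theorem LatticeData.swapRows {n : ℕ} {L : AddSubgroup (ℕ → ℤ)} {M : List (List ℤ)}
    (hM : LatticeData n L M) {k : ℕ} (hk : k + 1 < n) :
    LatticeData n L (swapRows n M k) ∧
    (∀ i < n, i ≠ k → ent (swapRows n M k) i i = ent M i i) ∧
    ent (swapRows n M k) k k * ent M k k =
      ent M (k + 1) k ^ 2 + ent M (k + 1) (k + 1) * gramDet (ent M) k := by
  set ℓ := ent M with hℓ
  have hDpos : ∀ c ≤ n, 0 < gramDet ℓ c := by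
    intro c hc
    cases c with
    | zero => simp
    | succ c => exact hM.pos c (by omega)
  have hkk : (ℓ k k : ℚ) ≠ 0 := by exact_mod_cast (hM.pos k (by omega)).ne'
  have tri : ∀ i j, i < j → j < n → ℓ i j = 0 := hM.tri
  have hkk1 : ℓ k (k + 1) = 0 := tri k (k + 1) (by omega) hk
  let s : ℕ → ℕ := fun i => if i = k then k + 1 else if i = k + 1 then k else i
  have hs : ∀ i < n, s i < n := by intro i hi; dsimp only [s]; split_ifs <;> omega
  have hc1 : ∀ i, swapCoeff ℓ k i k =
      ((ℓ (s i) k * ℓ (k + 1) k + ℓ (s i) (k + 1) * gramDet ℓ k : ℤ) : ℚ) / (ℓ k k : ℤ) := by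
    intro i; simp only [swapCoeff, if_true, s]
  have hc2 : ∀ i, swapCoeff ℓ k i (k + 1) =
      ((ℓ (k + 1) (k + 1) * ℓ (s i) k - ℓ (k + 1) k * ℓ (s i) (k + 1) : ℤ) : ℚ) / (ℓ k k : ℤ) := by
    intro i; simp [swapCoeff, s]
  have hc3 : ∀ i j, j ≠ k → j ≠ k + 1 → swapCoeff ℓ k i j = ℓ (s i) j := by
    intro i j h1 h2; simp [swapCoeff, s, h1, h2]
  have hdk : swapCoeff ℓ k k k =
      ((ℓ (k + 1) k * ℓ (k + 1) k + ℓ (k + 1) (k + 1) * gramDet ℓ k : ℤ) : ℚ) / (ℓ k k : ℤ) := by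
    rw [hc1]; simp [s]
  have hnum : 0 < ℓ (k + 1) k * ℓ (k + 1) k + ℓ (k + 1) (k + 1) * gramDet ℓ k := by
    have := mul_pos (hM.pos (k + 1) hk) (hDpos k (by omega))
    nlinarith [mul_self_nonneg (ℓ (k + 1) k)]
  have hdi : ∀ i < n, i ≠ k → swapCoeff ℓ k i i = ℓ i i := by
    intro i hi hik
    by_cases h : i = k + 1
    · subst h
      rw [hc2]
      simp only [s, if_neg hik, if_true, hkk1]
      push_cast
      field_simp
      ring
    · rw [hc3 i i hik h]
      simp [s, hik, h]
  have htri : ∀ i j, i < j → j < n → swapCoeff ℓ k i j = 0 := by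
    intro i j hij hj
    by_cases h1 : j = k
    · subst h1
      rw [hc1, show s i = i by dsimp only [s]; split_ifs <;> omega, tri i j hij hj,
        tri i (j + 1) (by omega) hk]
      simp
    by_cases h2 : j = k + 1
    · subst h2
      rw [hc2]
      by_cases h3 : i = k
      · subst h3
        simp only [s, if_true]
        rw [show ℓ (i + 1) (i + 1) * ℓ (i + 1) i - ℓ (i + 1) i * ℓ (i + 1) (i + 1) = 0 by ring]
        simp
      · rw [show s i = i by dsimp only [s]; split_ifs <;> omega, tri i k (by omega) (by omega),
          tri i (k + 1) (by omega) hk]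
        simp
    · rw [hc3 i j h1 h2, tri (s i) j (by dsimp only [s]; split_ifs <;> omega) hj]
      simp
  have hpos : ∀ i < n, 0 < swapCoeff ℓ k i i := by
    intro i hi
    by_cases h : i = k
    · rw [h, hdk]
      have := hM.pos k (by omega)
      exact div_pos (by exact_mod_cast hnum) (by exact_mod_cast this)
    · rw [hdi i hi h]; exact_mod_cast hM.pos i hi
  have hD : ∀ c ≤ n, c ≠ k + 1 → gramDet (swapCoeff ℓ k) c = gramDet ℓ c := by
    intro c hc hck
    cases c with
    | zero => simp
    | succ c => exact hdi c (by omega) (by omega)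
  have hsum : ∀ i j, ∑ c ∈ range n, swapCoeff ℓ k i c * swapCoeff ℓ k j c /
      (gramDet (swapCoeff ℓ k) c * gramDet (swapCoeff ℓ k) (c + 1)) =
      ∑ c ∈ range n, ((ℓ (s i) c * ℓ (s j) c / (gramDet ℓ c * gramDet ℓ (c + 1)) : ℚ)) := by
    -- Only the columns `k` and `k + 1` change, and their joint contribution is preserved by
    -- `swapCoeff_aux`.
    intro i j
    have h0 : ∀ c < n, c ≠ k → c ≠ k + 1 → swapCoeff ℓ k i c * swapCoeff ℓ k j c /
      (gramDet (swapCoeff ℓ k) c * gramDet (swapCoeff ℓ k) (c + 1)) =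
        ((ℓ (s i) c * ℓ (s j) c / (gramDet ℓ c * gramDet ℓ (c + 1)) : ℚ)) := by
      intro c hc h1 h2
      rw [hD c (by omega) h2, hD (c + 1) (by omega) (by omega), hc3 _ _ h1 h2, hc3 _ _ h1 h2]
    have := sum_eq_sum_of_pair hk
      (f := fun c => if c < n then swapCoeff ℓ k i c * swapCoeff ℓ k j c /
        (gramDet (swapCoeff ℓ k) c * gramDet (swapCoeff ℓ k) (c + 1)) else 0)
      (g := fun c => if c < n then
        ((ℓ (s i) c * ℓ (s j) c / (gramDet ℓ c * gramDet ℓ (c + 1)) : ℚ)) else 0)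
      (fun c h1 h2 => by
        split
        · exact h0 c ‹_› h1 h2
        · rfl) (by
        simp only [hk, show k < n by omega, if_true]
        rw [hD k (by omega) (by omega), hD (k + 1 + 1) (by omega) (by omega), gramDet_succ,
          gramDet_succ, gramDet_succ, hc1, hc1, hc2, hc2, hdk]
        push_cast
        have h1 : ((gramDet ℓ k : ℤ) : ℚ) ≠ 0 := by exact_mod_cast (hDpos k (by omega)).ne'
        have h2 : (ℓ (k + 1) (k + 1) : ℚ) ≠ 0 := by exact_mod_cast (hM.pos (k + 1) hk).ne'
        exact swapCoeff_aux hkk h1 h2 (by exact_mod_cast hnum.ne'))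
    refine (sum_congr rfl fun c hc => ?_).trans (this.trans (sum_congr rfl fun c hc => ?_))
    · rw [if_pos (mem_range.1 hc)]
    · rw [if_pos (mem_range.1 hc)]
  have hgram : ∀ i j, i < n → j < n →
      ((∑ t ∈ range n, ℓ (s i) (n + t) * ℓ (s j) (n + t) : ℤ) : ℚ) =
      ∑ c ∈ range n, swapCoeff ℓ k i c * swapCoeff ℓ k j c /
      (gramDet (swapCoeff ℓ k) c * gramDet (swapCoeff ℓ k) (c + 1)) := by
    intro i j hi hj
    rw [hsum]
    have := hM.gram (s i) (s j) (hs i hi) (hs j hj)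
    simp only [gramForm, AddMonoidHom.coe_mk, ZeroHom.coe_mk] at this
    push_cast
    exact sub_eq_zero.1 this
  have hent : ∀ i < n, ∀ j < n, (ent (BitCost.swapRows n M k) i j : ℚ) = swapCoeff ℓ k i j := by
    intro i hi j hj
    obtain ⟨z, hz⟩ := exists_int_of_gram htri (fun i hi => (hpos i hi).ne') hgram hi hj
    rw [BitCost.swapRows, ent_mat _ _ _ _ hi, if_pos (by omega), hz]
    by_cases h1 : j = k
    · subst h1
      simp only [if_true]
      rw [hc1, div_eq_iff hkk] at hz
      have hz' := Int.cast_injective (α := ℚ) (hz.trans (by push_cast; rfl : _ = ((z * ℓ j j : ℤ) : ℚ)))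
      dsimp only [s] at hz'
      rw [hz', Int.mul_ediv_cancel _ (hM.pos j (by omega)).ne']
    by_cases h2 : j = k + 1
    · subst h2
      simp only [if_true, if_neg h1]
      rw [hc2, div_eq_iff hkk] at hz
      have hz' := Int.cast_injective (α := ℚ) (hz.trans (by push_cast; rfl : _ = ((z * ℓ k k : ℤ) : ℚ)))
      dsimp only [s] at hz'
      rw [hz', Int.mul_ediv_cancel _ (hM.pos k (by omega)).ne']
    · rw [hc3 i j h1 h2] at hz
      simp only [if_neg h1, if_neg h2]
      exact hz
  have hent2 : ∀ i < n, ∀ j, n ≤ j → ent (BitCost.swapRows n M k) i j = ℓ (s i) j := by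
    intro i hi j hj
    rw [BitCost.swapRows, ent_mat _ _ _ _ hi]
    split
    · simp only [if_neg (show j ≠ k by omega), if_neg (show j ≠ k + 1 by omega)]; rfl
    · exact (hM.supp (s i) (hs i hi) j (by omega)).symm
  have hgd : ∀ c ≤ n, ((gramDet (ent (BitCost.swapRows n M k)) c : ℤ) : ℚ) = gramDet (swapCoeff ℓ k) c := by
    intro c hc
    cases c with
    | zero => simp
    | succ c => exact hent c (by omega) c (by omega)
  refine ⟨⟨fun i hi j hj => ?_, fun i j hij hj => ?_, fun i hi => ?_, fun i j hi hj => ?_,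
    fun i hi => ?_⟩, fun i hi hik => ?_, ?_⟩
  · rw [hent2 i hi j (by omega)]; exact hM.supp _ (hs i hi) j hj
  · have := hent i (by omega) j hj
    rw [htri i j hij hj] at this; exact_mod_cast this
  · have := hpos i hi
    rw [← hent i hi i hi] at this; exact_mod_cast this
  · simp only [gramForm, AddMonoidHom.coe_mk, ZeroHom.coe_mk]
    have := hgram i j hi hj
    rw [sub_eq_zero]
    push_cast at this
    convert this using 1
    · refine sum_congr rfl fun t _ => ?_
      rw [hent2 i hi _ (by omega), hent2 j hj _ (by omega)]
    · refine sum_congr rfl fun c hc => ?_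
      have := mem_range.1 hc
      rw [hent i hi c this, hent j hj c this, hgd c this.le, hgd (c + 1) this]
  · simp only [fun t => hent2 i hi (n + t) (by omega)]
    exact hM.mem _ (hs i hi)
  · have := hent i hi i hi
    rw [hdi i hi hik] at this; exact_mod_cast this
  · have := hent k (by omega) k (by omega)
    rw [hdk, eq_div_iff hkk] at this
    rw [sq]
    exact_mod_cast this

end BitCost

/-! ### Size bounds and the LLL algorithm. -/

namespace BitCost
open Finset Enc

theorem abs_getD_lt (row : List ℤ) (j : ℕ) : |row.getD j 0| < 2 ^ sz row := by
  rw [List.getD_eq_getElem?_getD]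
  rcases lt_or_ge j row.length with h | h
  · rw [List.getElem?_eq_getElem h]
    have h1 := sz_le_of_mem (List.getElem_mem h)
    exact (abs_lt_two_pow_sz _).trans (pow_lt_pow_right₀ (by norm_num) h1)
  · rw [List.getElem?_eq_none h]; simp

theorem sz_getD_le (M : List (List ℤ)) (i : ℕ) : sz (M.getD i []) ≤ sz M := by
  rw [List.getD_eq_getElem?_getD]
  rcases lt_or_ge i M.length with h | h
  · rw [List.getElem?_eq_getElem h]
    exact (sz_le_of_mem (List.getElem_mem h)).le
  · rw [List.getElem?_eq_none h]
    have := length_lt_sz M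
    simp; omega

theorem abs_ent_lt (M : List (List ℤ)) (i j : ℕ) : |ent M i j| < 2 ^ sz M :=
  (abs_getD_lt _ _).trans_le (pow_le_pow_right₀ (by norm_num) (sz_getD_le M i))

theorem sz_mat_le {n k B : ℕ} {f : ℕ → ℕ → ℤ} (h : ∀ i < n, ∀ j < k, |f i j| ≤ 2 ^ B) :
    sz (mat n k f) ≤ n * (k * (B + 3) + 2) + 1 := by
  refine sz_list_le (k := n) (B := k * (B + 3) + 1) (by simp [mat]) fun row hrow => ?_
  obtain ⟨i, hi, rfl⟩ := List.mem_map.1 hrow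
  refine sz_list_le (k := k) (B := B + 2) (by simp) fun x hx => ?_
  obtain ⟨j, hj, rfl⟩ := List.mem_map.1 hx
  exact sz_int_le (h i (List.mem_range.1 hi) j (List.mem_range.1 hj))

/-- If the entries of the row are at most `X` and those of `M` at most `W ≤ X`, one step yields
entries of size at most `X + (2 * X + W) * W ≤ 4 * X * W`. The bit length thus grows only linearly
in the number of steps. No lattice structure is needed, so size reduction is in `PT` for arbitrary
matrices. -/
theorem sz_reduce_foldl_le (n : ℕ) (M : List (List ℤ)) (k : ℕ) (l : List ℕ) :
    sz (l.foldl (fun row l => if l < k then reduceStep n M row l else row) (M.getD k [])) ≤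
      (2 * n + sz M) * ((sz M + 2) * (l.length + 1) + 3) + 1 := by
  set w := sz M
  have h : (l.foldl (fun row l => if l < k then reduceStep n M row l else row)
      (M.getD k [])).length ≤ 2 * n + w ∧
      ∀ x ∈ l.foldl (fun row l => if l < k then reduceStep n M row l else row) (M.getD k []),
        |x| ≤ 2 ^ ((w + 2) * (l.length + 1)) := by
    induction l using List.reverseRecOn with
    | nil =>
      refine ⟨((length_lt_sz _).le.trans (sz_getD_le M k)).trans (Nat.le_add_left _ _), ?_⟩
      intro x hx
      simp only [List.foldl_nil] at hx
      have h1 := (sz_le_of_mem hx).le.trans (sz_getD_le M k)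
      exact (abs_lt_two_pow_sz x).le.trans
        (pow_le_pow_right₀ (by norm_num) (by simp; omega))
    | append_singleton l a ih =>
      rw [List.foldl_append]
      generalize l.foldl (fun row l => if l < k then reduceStep n M row l else row)
        (M.getD k []) = row at ih
      simp only [List.foldl_cons, List.foldl_nil, List.length_append, List.length_singleton]
      set X : ℤ := 2 ^ ((w + 2) * (l.length + 1)) with hX
      have hXX : (2 : ℤ) ^ ((w + 2) * (l.length + 1 + 1)) = X * (4 * 2 ^ w) := by
        rw [hX, mul_add _ (l.length + 1) 1, pow_add]
        ring
      have hw : (1 : ℤ) ≤ 2 ^ w := one_le_pow₀ (by norm_num)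
      have hwX : (2 : ℤ) ^ w ≤ X := pow_le_pow_right₀ (by norm_num) (by nlinarith)
      have hget : ∀ j, |row.getD j 0| ≤ X := by
        intro j
        rw [List.getD_eq_getElem?_getD]
        rcases lt_or_ge j row.length with h | h
        · rw [List.getElem?_eq_getElem h]; exact ih.2 _ (List.getElem_mem h)
        · rw [List.getElem?_eq_none h]; simp; omega
      rw [hXX]
      split
      · refine ⟨by simp [reduceStep], fun x hx => ?_⟩
        obtain ⟨j, hj, rfl⟩ := List.mem_map.1 hx
        have h1 : |(2 * row.getD a 0 + ent M a a) / (2 * ent M a a)| ≤ 2 * X + 2 ^ w := by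
          have h2 := Int.natAbs_ediv_le_natAbs (2 * row.getD a 0 + ent M a a) (2 * ent M a a)
          have h3 : |(2 * row.getD a 0 + ent M a a) / (2 * ent M a a)| ≤
              |2 * row.getD a 0 + ent M a a| := by
            rw [Int.abs_eq_natAbs, Int.abs_eq_natAbs]; exact_mod_cast h2
          have h4 := abs_add_le (2 * row.getD a 0) (ent M a a)
          have h5 := hget a
          have h6 := abs_ent_lt M a a
          rw [abs_mul, abs_two] at h4
          linarith
        have h7 := abs_sub (row.getD j 0)
          ((2 * row.getD a 0 + ent M a a) / (2 * ent M a a) * ent M a j)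
        have h8 := hget j
        have h9 := (abs_ent_lt M a j).le
        rw [abs_mul] at h7
        have h10 := mul_le_mul h1 h9 (abs_nonneg _) (by positivity)
        nlinarith
      · exact ⟨ih.1, fun x hx => (ih.2 x hx).trans (le_mul_of_one_le_right (by positivity) (by linarith))⟩
  exact sz_list_le (B := (w + 2) * (l.length + 1) + 2) h.1 fun x hx => sz_int_le (h.2 x hx)

namespace PT
variable {γ : Type*} [Enc γ]

@[fun_prop]
theorem reduceRow {n : γ → Una} {M : γ → List (List ℤ)} {k : γ → ℕ} (hn : PT n) (hM : PT M)
    (hk : PT k) : PT fun g => reduceRow (n g).n (M g) (k g) := by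
  unfold BitCost.reduceRow
  refine PT.foldl (step := fun g row l =>
    if l < k g then BitCost.reduceStep (n g).n (M g) row l else row)
    (w := fun g => (2 * sz (n g) + sz (M g)) * ((sz (M g) + 2) * (sz (n g) + 1) + 3) + 1)
    (by fun_prop) (by fun_prop) ?_ ?_ ?_
  · unfold BitCost.reduceStep
    refine PT.ite (by fun_prop) (PT.map (f := fun (x : γ × List ℤ × ℕ) j =>
      x.2.1.getD j 0 - (2 * x.2.1.getD x.2.2 0 + BitCost.ent (M x.1) x.2.2 x.2.2) /
        (2 * BitCost.ent (M x.1) x.2.2 x.2.2) * BitCost.ent (M x.1) x.2.2 j) ?_ ?_) (by fun_prop)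
    · exact PT.range (n := fun x : γ × List ℤ × ℕ => Una.mk (2 * (n x.1).n)) (by fun_prop)
    · fun_prop
  · exact (((((PB.const 2).mul hn.pb).add hM.pb).mul (((hM.pb.add (PB.const 2)).mul
      (hn.pb.add (PB.const 1))).add (PB.const 3))).add (PB.const 1))
  · intro g l' hl'
    refine (sz_reduce_foldl_le _ _ _ _).trans ?_
    have h1 := hl'.length_le
    simp only [List.length_reverse, List.length_range] at h1
    have h2 : sz (n g) = (n g).n + 1 := rfl
    gcongr <;> omega

@[fun_prop]
theorem sizeReduce {n : γ → Una} {M : γ → List (List ℤ)} (hn : PT n) (hM : PT M) :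
    PT fun g => sizeReduce (n g).n (M g) := by
  unfold BitCost.sizeReduce
  exact PT.mat (k := fun g => Una.mk (2 * (n g).n))
    (f := fun g i j => (BitCost.reduceRow (n g).n (M g) i).getD j 0) hn (by fun_prop) (by fun_prop)

@[fun_prop]
theorem swapRows {n : γ → Una} {M : γ → List (List ℤ)} {k : γ → ℕ} (hn : PT n) (hM : PT M)
    (hk : PT k) : PT fun g => swapRows (n g).n (M g) (k g) := by
  unfold BitCost.swapRows
  dsimp only
  refine PT.mat (k := fun g => Una.mk (2 * (n g).n)) (f := fun g i j => _) hn (by fun_prop) ?_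
  fun_prop

end PT

/-- The indices at which the Lovász condition is violated. -/
def violations (n : ℕ) (M : List (List ℤ)) : List ℕ :=
  (List.range n).filter fun k => decide (k + 1 < n ∧
    4 * (ent M (k + 1) k * ent M (k + 1) k + ent M (k + 1) (k + 1) * gramDet (ent M) k) <
      3 * (ent M k k * ent M k k))

/-- The condition of the loop of the LLL algorithm. -/
def lllCond (s : Una × List (List ℤ)) : Bool := decide (¬ (violations s.1.n s.2).isEmpty = true)

/-- The body of the loop of the LLL algorithm. -/
def lllStep (s : Una × List (List ℤ)) : Una × List (List ℤ) :=
  (s.1, sizeReduce s.1.n (swapRows s.1.n s.2 ((violations s.1.n s.2).headD 0)))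

/-- The LLL algorithm. -/
noncomputable def lll (n : Una) (M : List (List ℤ)) : List (List ℤ) :=
  (whileLoop lllCond lllStep (n, sizeReduce n.n M)).2

/-- The invariant of the loop of the LLL algorithm. -/
structure LLLInv (n : Una) (L : AddSubgroup (ℕ → ℤ)) (D Dn : ℤ) (s : Una × List (List ℤ)) :
    Prop where
  dim : s.1 = n
  data : LatticeData n.n L s.2
  red : ∀ i l, l < i → i < n.n → 2 * |ent s.2 i l| ≤ ent s.2 l l
  le : ∀ i < n.n, ent s.2 i i ≤ D
  last : ∀ i, i + 1 = n.n → ent s.2 i i = Dn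
  isMat : ∃ f, s.2 = mat n.n (2 * n.n) f

theorem violations_headD {n : ℕ} {M : List (List ℤ)} (h : ¬ (violations n M).isEmpty = true) :
    ∃ k, (violations n M).headD 0 = k ∧ k + 1 < n ∧
    4 * (ent M (k + 1) k * ent M (k + 1) k + ent M (k + 1) (k + 1) * gramDet (ent M) k) <
      3 * (ent M k k * ent M k k) := by
  refine ⟨_, rfl, ?_⟩
  have : (violations n M).headD 0 ∈ violations n M := by
    cases h' : violations n M with
    | nil => simp [h'] at h
    | cons a l => simp
  simpa using (List.mem_filter.1 this).2

/-- The product of the Gram determinants. -/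
def lllPotential (n : ℕ) (M : List (List ℤ)) : ℕ := ∏ i ∈ range n, (ent M i i).toNat

theorem LLLInv.init {n : Una} {L : AddSubgroup (ℕ → ℤ)} {D Dn : ℤ} {M : List (List ℤ)}
    (hM : LatticeData n.n L M) (hD : ∀ i < n.n, ent M i i ≤ D)
    (hDn : ∀ i, i + 1 = n.n → ent M i i = Dn) : LLLInv n L D Dn (n, sizeReduce n.n M) := by
  obtain ⟨h1, h2, h3⟩ := hM.sizeReduce
  exact ⟨rfl, h1, h3, fun i hi => by rw [h2 i hi]; exact hD i hi,
    fun i hi => by rw [h2 i (by omega)]; exact hDn i hi, _, rfl⟩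

/-- A violated Lovász condition says that the exchange multiplies the Gram determinant of order `k +
1` by at most `3 / 4`. The exchange leaves the other determinants unchanged, and the size reduction
leaves all of them unchanged. In particular they never increase, and the last one is constant
because `k + 1 < n`. -/
theorem LLLInv.step {n : Una} {L : AddSubgroup (ℕ → ℤ)} {D Dn : ℤ} {s : Una × List (List ℤ)}
    (hs : LLLInv n L D Dn s) (hc : lllCond s = true) :
    LLLInv n L D Dn (lllStep s) ∧
      4 * lllPotential n.n (lllStep s).2 ≤ 3 * lllPotential n.n s.2 := by
  obtain ⟨n', M⟩ := s
  obtain ⟨rfl, hM, -, hle, hlast, -⟩ := hs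
  dsimp only at hM hle hlast
  obtain ⟨k, hk, hkn, hv⟩ := violations_headD (by simpa [lllCond] using hc)
  obtain ⟨h1, h2, h3⟩ := hM.swapRows hkn
  have hkpos := hM.pos k (by omega)
  have hkk : 4 * ent (swapRows n'.n M k) k k ≤ 3 * ent M k k := by
    nlinarith [hM.pos k (by omega)]
  obtain ⟨-, h4, -⟩ := h1.sizeReduce
  have hstep : lllStep (n', M) = (n', sizeReduce n'.n (swapRows n'.n M k)) := by
    rw [← hk]; rfl
  rw [hstep]
  refine ⟨LLLInv.init h1 (fun i hi => ?_) fun i hi => ?_, ?_⟩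
  · by_cases h : i = k
    · subst h; have := hle i hi; linarith
    · rw [h2 i hi h]; exact hle i hi
  · have hi' : i + 1 = n'.n := hi
    rw [h2 i (by omega) (by omega)]; exact hlast i hi
  · unfold lllPotential
    have hmem : k ∈ range n'.n := mem_range.2 (by omega)
    rw [← mul_prod_erase _ _ hmem, ← mul_prod_erase _ (fun i => (ent M i i).toNat) hmem,
      ← mul_assoc, ← mul_assoc]
    refine Nat.mul_le_mul ?_ (prod_le_prod' fun i hi => ?_)
    · dsimp only
      rw [h4 k (by omega)]; omega
    · dsimp only
      have hi' := mem_erase.1 hi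
      have := mem_range.1 hi'.2
      rw [h4 i this, h2 i this hi'.1]

theorem LatticeData.sum_sq {n : ℕ} {L : AddSubgroup (ℕ → ℤ)} {M : List (List ℤ)}
    (hM : LatticeData n L M) {i : ℕ} (hi : i < n) :
    ∑ t ∈ range n, (ent M i (n + t) : ℚ) ^ 2 =
      ∑ c ∈ range n, (ent M i c : ℚ) ^ 2 / (gramDet (ent M) c * gramDet (ent M) (c + 1) : ℤ) := by
  have := hM.gram i i hi hi
  simp only [gramForm, AddMonoidHom.coe_mk, ZeroHom.coe_mk] at this
  rw [sub_eq_zero] at this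
  push_cast
  simp only [sq]
  exact this

/-- Size reduction bounds the off-diagonal coefficients by the Gram determinants, hence by `2 ^ w`.
By the Gram identity the squared length of each vector is at most `n * 4 ^ w`, since the
denominators are positive integers, and this is at most the square of `2 ^ (n + w)`. -/
theorem LLLInv.sz_le {n : Una} {L : AddSubgroup (ℕ → ℤ)} {w : ℕ} {Dn : ℤ}
    {s : Una × List (List ℤ)} (hs : LLLInv n L (2 ^ w) Dn s) :
    sz s ≤ n.n + n.n * (2 * n.n * (n.n + w + 3) + 2) + 3 := by
  obtain ⟨n', M⟩ := s
  obtain ⟨rfl, hM, hred, hle, -, f, hf⟩ := hs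
  dsimp only at hM hle hred hf
  have hent : ∀ i < n'.n, ∀ j < 2 * n'.n, f i j = ent M i j := by
    intro i hi j hj
    rw [hf, ent_mat _ _ _ _ hi, if_pos hj]
  have hl : ∀ i < n'.n, ∀ j < n'.n, |ent M i j| ≤ 2 ^ w := by
    intro i hi j hj
    rcases lt_trichotomy i j with h | h | h
    · rw [hM.tri i j h hj]; simp
    · subst h
      rw [abs_of_pos (hM.pos i hi)]; exact hle i hi
    · have h1 := hred i j h hi
      have h2 := hle j hj
      have := abs_nonneg (ent M i j)
      linarith
  have hpos : ∀ c ≤ n'.n, 0 < gramDet (ent M) c := by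
    intro c hc
    cases c with
    | zero => simp
    | succ c => exact hM.pos c (by omega)
  have hb : ∀ i < n'.n, ∀ t < n'.n, |ent M i (n'.n + t)| ≤ 2 ^ (n'.n + w) := by
    intro i hi t ht
    have h1 := hM.sum_sq hi
    have h2 : (ent M i (n'.n + t) : ℚ) ^ 2 ≤ ∑ t ∈ range n'.n, (ent M i (n'.n + t) : ℚ) ^ 2 :=
      single_le_sum (f := fun t => (ent M i (n'.n + t) : ℚ) ^ 2) (fun _ _ => sq_nonneg _)
        (mem_range.2 ht)
    have h3 : ∑ c ∈ range n'.n,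
        (ent M i c : ℚ) ^ 2 / (gramDet (ent M) c * gramDet (ent M) (c + 1) : ℤ) ≤
        ∑ c ∈ range n'.n, ((2 : ℚ) ^ w) ^ 2 := by
      refine sum_le_sum fun c hc => ?_
      have hc := mem_range.1 hc
      have h4 : (1 : ℚ) ≤ (gramDet (ent M) c * gramDet (ent M) (c + 1) : ℤ) := by
        exact_mod_cast mul_pos (hpos c hc.le) (hpos (c + 1) hc)
      refine (div_le_self (sq_nonneg _) h4).trans ?_
      rw [sq_le_sq, abs_of_nonneg (show (0 : ℚ) ≤ 2 ^ w by positivity)]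
      exact_mod_cast hl i hi c hc
    rw [sum_const, card_range, nsmul_eq_mul] at h3
    have h5 : ((ent M i (n'.n + t) : ℤ) : ℚ) ^ 2 ≤ ((2 ^ (n'.n + w) : ℤ) : ℚ) ^ 2 := by
      refine h2.trans (h1.le.trans (h3.trans ?_))
      push_cast
      rw [pow_add, mul_pow]
      refine mul_le_mul_of_nonneg_right ?_ (by positivity)
      have h6 : ((n'.n : ℕ) : ℚ) ≤ 2 ^ n'.n := by exact_mod_cast Nat.lt_two_pow_self.le
      have h7 : (1 : ℚ) ≤ 2 ^ n'.n := one_le_pow₀ (by norm_num)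
      nlinarith
    have h8 : (ent M i (n'.n + t)) ^ 2 ≤ (2 ^ (n'.n + w) : ℤ) ^ 2 := by exact_mod_cast h5
    rw [sq_le_sq] at h8
    rwa [abs_of_nonneg (show (0 : ℤ) ≤ 2 ^ (n'.n + w) by positivity)] at h8
  have : sz M ≤ n'.n * (2 * n'.n * (n'.n + w + 3) + 2) + 1 := by
    rw [hf]
    refine sz_mat_le fun i hi j hj => ?_
    rw [hent i hi j hj]
    rcases lt_or_ge j n'.n with h | h
    · exact (hl i hi j h).trans (pow_le_pow_right₀ (by norm_num) (by omega))
    · obtain ⟨t, rfl⟩ := Nat.exists_eq_add_of_le h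
      exact hb i hi t (by omega)
  rw [sz_prod, sz_una]
  dsimp only
  omega

theorem lll_iterate {n : Una} {L : AddSubgroup (ℕ → ℤ)} {M : List (List ℤ)}
    (hM : LatticeData n.n L M) {Dn : ℤ} (hDn : ∀ i, i + 1 = n.n → ent M i i = Dn) :
    ∃ m ≤ 3 * (n.n * sz M) + 1, lllCond (lllStep^[m] (n, sizeReduce n.n M)) = false ∧
      ∀ i ≤ m, LLLInv n L (2 ^ sz M) Dn (lllStep^[i] (n, sizeReduce n.n M)) := by
  have hinit := LLLInv.init hM (fun i hi => (le_abs_self _).trans (abs_ent_lt M i i).le) hDn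
  -- The product of the determinants shrinks by a factor `3 / 4`, which is not enough to halve it.
  -- Its cube shrinks by `27 / 64 < 1 / 2`.
  refine exists_iterate_of_potential (LLLInv n L (2 ^ sz M) Dn)
    (fun s => lllPotential n.n s.2 ^ 3) hinit (fun s hs hc => (hs.step hc).1)
    (fun s hs hc => ?_) (fun s hs hc => ?_) ?_
  · refine pow_pos (prod_pos fun i hi => ?_) 3
    have := hs.data.pos i (mem_range.1 hi)
    omega
  · have h1 := Nat.pow_le_pow_left (hs.step hc).2 3
    rw [mul_pow, mul_pow] at h1
    generalize lllPotential n.n (lllStep s).2 ^ 3 = a at *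
    omega
  · have : lllPotential n.n (sizeReduce n.n M) ≤ ∏ i ∈ range n.n, 2 ^ sz M := by
      refine prod_le_prod' fun i hi => ?_
      have := hinit.le i (mem_range.1 hi)
      dsimp only at this
      exact Int.toNat_le.2 (by push_cast; exact this)
    rw [prod_const, card_range, ← pow_mul] at this
    refine (Nat.pow_le_pow_left this 3).trans_lt ?_
    rw [← pow_mul]
    exact Nat.pow_lt_pow_right (by norm_num) (by nlinarith)

theorem lll_spec {n : Una} {L : AddSubgroup (ℕ → ℤ)} {M : List (List ℤ)}
    (hM : LatticeData n.n L M) {Dn : ℤ} (hDn : ∀ i, i + 1 = n.n → ent M i i = Dn) :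
    LLLInv n L (2 ^ sz M) Dn (n, lll n M) ∧ (violations n.n (lll n M)).isEmpty = true := by
  obtain ⟨m, -, hc, hI⟩ := lll_iterate hM hDn
  have h := whileLoop_induction (LLLInv n L (2 ^ sz M) Dn) ⟨m, hc⟩ (hI 0 (by omega))
    (fun s hs hc => (hs.step hc).1)
  have h1 : (n, lll n M) = whileLoop lllCond lllStep (n, sizeReduce n.n M) := by
    refine Prod.ext ?_ rfl
    exact h.1.dim.symm
  rw [h1]
  refine ⟨h.1, ?_⟩
  have h2 := h.2
  rw [← h1] at h2
  simpa [lllCond] using h2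

/-- The first vector of an LLL-reduced basis is short. -/
theorem lll_short {n : Una} {L : AddSubgroup (ℕ → ℤ)} {M : List (List ℤ)}
    (hM : LatticeData n.n L M) {Dn : ℤ} (hDn : ∀ i, i + 1 = n.n → ent M i i = Dn)
    (hn : 0 < n.n) :
    (fun t => ent (lll n M) 0 (n.n + t)) ∈ L ∧
    0 < ∑ t ∈ range n.n, ent (lll n M) 0 (n.n + t) ^ 2 ∧
    (∑ t ∈ range n.n, ent (lll n M) 0 (n.n + t) ^ 2) ^ n.n ≤ 2 ^ (∑ i ∈ range n.n, i) * Dn := by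
  obtain ⟨⟨-, hR, hred, -, hlast, -⟩, hv⟩ := lll_spec hM hDn
  dsimp only at hR hred hlast
  set R := lll n M
  -- By triangularity the first row has only one coefficient, so its squared length is the first
  -- Gram determinant.
  have h0 : ∑ t ∈ range n.n, ent R 0 (n.n + t) ^ 2 = ent R 0 0 := by
    have h1 := hR.sum_sq hn
    rw [sum_eq_single (f := fun c => (ent R 0 c : ℚ) ^ 2 /
      (gramDet (ent R) c * gramDet (ent R) (c + 1) : ℤ)) 0 (fun c hc h0 => by
      rw [hR.tri 0 c (by omega) (mem_range.1 hc)]; simp) (fun h => absurd (mem_range.2 hn) h)] at h1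
    have h2 : ((ent R 0 0 : ℤ) : ℚ) ≠ 0 := by exact_mod_cast (hR.pos 0 hn).ne'
    rw [gramDet_zero, gramDet_succ, one_mul, sq, mul_div_assoc, div_self h2, mul_one] at h1
    exact_mod_cast h1
  rw [h0]
  have hpos : ∀ c ≤ n.n, 0 < gramDet (ent R) c := by
    intro c hc
    cases c with
    | zero => simp
    | succ c => exact hR.pos c (by omega)
  -- The Lovász condition with factor `3 / 4` and Gram–Schmidt coefficients of absolute value at
  -- most `1 / 2` leave `3 / 4 - 1 / 4 = 1 / 2`. Thus each squared Gram–Schmidt length is at most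
  -- twice the next one.
  have hlov : ∀ k, k + 1 < n.n → gramDet (ent R) (k + 1) * gramDet (ent R) (k + 1) ≤
      2 * (gramDet (ent R) k * gramDet (ent R) (k + 2)) := by
    intro k hk
    have h1 : k ∉ violations n.n R := by
      rw [List.isEmpty_iff.1 hv]; simp
    simp only [violations, List.mem_filter, List.mem_range, decide_eq_true_eq, not_and,
      not_lt] at h1
    have h2 := h1 (by omega) hk
    have h3 := hred (k + 1) k (by omega) hk
    have h4 : 4 * (ent R (k + 1) k * ent R (k + 1) k) ≤ ent R k k * ent R k k := by
      have := mul_self_le_mul_self (by positivity) h3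
      rw [← abs_mul_abs_self (ent R (k + 1) k)]
      linarith
    rw [gramDet_succ, gramDet_succ]
    linarith
  -- With denominators cleared: the first squared Gram–Schmidt length is at most `2 ^ c` times the
  -- one with index `c`. Multiplying these inequalities gives `h2`.
  have h1 : ∀ c, c < n.n → gramDet (ent R) 1 * gramDet (ent R) c ≤
      2 ^ c * gramDet (ent R) (c + 1) := by
    intro c
    induction c with
    | zero => intro _; simp
    | succ c ih =>
      intro hc
      have h2 := ih (by omega)
      have h3 := hlov c hc
      have h4 := hpos c (by omega)
      have h5 := hpos (c + 1) (by omega)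
      refine le_of_mul_le_mul_right ?_ h4
      rw [pow_succ]
      have h6 := mul_le_mul_of_nonneg_right h2 h5.le
      have h7 := mul_le_mul_of_nonneg_left h3 (show (0 : ℤ) ≤ 2 ^ c by positivity)
      linarith
  have h2 : ∀ c, c ≤ n.n → gramDet (ent R) 1 ^ c ≤
      2 ^ (∑ i ∈ range c, i) * gramDet (ent R) c := by
    intro c
    induction c with
    | zero => intro _; simp
    | succ c ih =>
      intro hc
      have h3 := ih (by omega)
      have h4 := h1 c (by omega)
      rw [pow_succ, sum_range_succ, pow_add]
      have h5 := mul_le_mul_of_nonneg_right h3 (hpos 1 (by omega)).le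
      have h6 := mul_le_mul_of_nonneg_left h4 (show (0 : ℤ) ≤ 2 ^ (∑ i ∈ range c, i) by positivity)
      linarith
  refine ⟨hR.mem 0 hn, hR.pos 0 hn, ?_⟩
  have h3 := h2 n.n le_rfl
  obtain ⟨i, hi⟩ : ∃ i, n.n = i + 1 := ⟨n.n - 1, by omega⟩
  rw [show gramDet (ent R) n.n = Dn by rw [hi, gramDet_succ]; exact hlast i hi.symm] at h3
  exact h3

namespace PT
variable {γ : Type*} [Enc γ]

@[fun_prop]
theorem violations {n : γ → Una} {M : γ → List (List ℤ)} (hn : PT n) (hM : PT M) :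
    PT fun g => violations (n g).n (M g) := by
  unfold BitCost.violations
  refine PT.filter (P := fun g k => _) (by fun_prop) ?_
  fun_prop

/-- The bounds for the number of rounds and for the sizes come from the loop invariant, so every
input must carry lattice data. The lattice itself plays no role in these bounds and may depend on
the input. -/
theorem lll {n : γ → Una} {M : γ → List (List ℤ)} (hn : PT n) (hM : PT M)
    (h : ∀ g, ∃ L, LatticeData (n g).n L (M g)) : PT fun g => lll (n g) (M g) := by
  unfold BitCost.lll
  refine PT.snd (PT.whileLoop (init := fun g => (n g, BitCost.sizeReduce (n g).n (M g)))
    (n := fun g => 3 * (sz (n g) * sz (M g)) + 1)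
    (w := fun g => sz (n g) + sz (n g) * (2 * sz (n g) * (sz (n g) + sz (M g) + 3) + 2) + 3)
    ?_ ?_ (by fun_prop) ?_ ?_ fun g => ?_)
  · unfold lllCond
    exact PT.not (P := fun s : Una × List (List ℤ) => (BitCost.violations s.1.n s.2).isEmpty = true)
      (by simp only [Bool.decide_eq_true]; fun_prop)
  · unfold lllStep
    fun_prop
  · exact ((PB.const 3).mul (hn.pb.mul hM.pb)).add (PB.const 1)
  · exact (hn.pb.add (hn.pb.mul ((((PB.const 2).mul hn.pb).mul ((hn.pb.add hM.pb).add
      (PB.const 3))).add (PB.const 2)))).add (PB.const 3)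
  · obtain ⟨L, hL⟩ := h g
    obtain ⟨m, hm, hc, hI⟩ := lll_iterate hL (Dn := BitCost.ent (M g) ((n g).n - 1) ((n g).n - 1))
      (fun i hi => by rw [← hi]; simp)
    have h2 : sz (n g) = (n g).n + 1 := rfl
    refine ⟨m, hm.trans ?_, hc, fun i hi => ((hI i hi).sz_le).trans ?_⟩
    · gcongr; omega
    · gcongr <;> omega

end PT
end BitCost

/-! ### Sums, powers, binomial coefficients, and the Gram–Schmidt data of a triangular basis. -/

namespace BitCost
open Enc

namespace PT
variable {γ : Type*} [Enc γ]

@[fun_prop]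
theorem listSum {l : γ → List ℤ} (hl : PT l) : PT fun g => (l g).sum := by
  refine cast (congrArg _ (funext fun g => ?_)) (foldl_of_le (β := ℤ) (init := fun _ => 0)
    (step := fun _ b a => b + a) hl (by fun_prop) (by fun_prop) hl.pb fun g b a ha =>
      (sz_add_le b a).trans (Nat.add_le_add_left (sz_le_of_mem ha).le _))
  exact List.sum_eq_foldl.symm

@[fun_prop]
theorem listProd {l : γ → List ℤ} (hl : PT l) : PT fun g => (l g).prod := by
  refine cast (congrArg _ (funext fun g => ?_)) (foldl_of_le (β := ℤ) (init := fun _ => 1)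
    (step := fun _ b a => b * a) hl (by fun_prop) (by fun_prop) hl.pb fun g b a ha =>
      (sz_mul_le b a).trans (Nat.add_le_add_left (sz_le_of_mem ha).le _))
  exact List.prod_eq_foldl.symm

end PT

theorem sum_map_range (n : ℕ) (f : ℕ → ℤ) :
    ((List.range n).map f).sum = ∑ i ∈ Finset.range n, f i := by
  induction n with
  | zero => simp
  | succ n ih => simp [List.range_succ, Finset.sum_range_succ, ih]

theorem prod_map_range (n : ℕ) (f : ℕ → ℤ) :
    ((List.range n).map f).prod = ∏ i ∈ Finset.range n, f i := by
  induction n with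
  | zero => simp
  | succ n ih => simp [List.range_succ, Finset.prod_range_succ, ih]

/-- The number of factors is governed by `n`, which is supplied in unary. A loop governed by a
binary number `e` could run exponentially long. -/
theorem prod_map_range_ite {n e : ℕ} (h : e ≤ n) (f : ℕ → ℤ) :
    ((List.range n).map fun i => if i < e then f i else 1).prod = ∏ i ∈ Finset.range e, f i := by
  rw [prod_map_range, ← Finset.prod_subset (Finset.range_subset_range.2 h) (fun i _ hi => by
    rw [if_neg (by simpa using hi)])]
  exact Finset.prod_congr rfl fun i hi => if_pos (Finset.mem_range.1 hi)

/-- The power `x ^ e`, computed with at most `n` multiplications. -/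
def powB (n : ℕ) (x : ℤ) (e : ℕ) : ℤ := ((List.range n).map fun i => if i < e then x else 1).prod

theorem powB_eq {n e : ℕ} (h : e ≤ n) (x : ℤ) : powB n x e = x ^ e := by
  rw [powB, prod_map_range_ite h]; simp

/-- The binomial coefficient, computed as a quotient of products with at most `n` factors. -/
def chooseB (n k t : ℕ) : ℤ :=
  ((List.range n).map fun i => if i < t then (k : ℤ) - i else 1).prod /
    ((List.range n).map fun i => if i < t then (i : ℤ) + 1 else 1).prod

theorem chooseB_eq {n t : ℕ} (h : t ≤ n) (k : ℕ) : chooseB n k t = k.choose t := by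
  rw [chooseB, prod_map_range_ite h, prod_map_range_ite h]
  have h1 : ∏ i ∈ Finset.range t, ((k : ℤ) - i) = (k.descFactorial t : ℕ) := by
    rcases le_or_gt t k with hk | hk
    · rw [Nat.descFactorial_eq_prod_range, Nat.cast_prod]
      refine Finset.prod_congr rfl fun i hi => ?_
      have := Finset.mem_range.1 hi
      omega
    · rw [Nat.descFactorial_of_lt hk, Finset.prod_eq_zero (Finset.mem_range.2 hk)] <;> simp
  have h2 : ∏ i ∈ Finset.range t, ((i : ℤ) + 1) = (t.factorial : ℕ) := by
    rw [← Finset.prod_range_add_one_eq_factorial]; push_cast; rfl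
  rw [h1, h2, Nat.choose_eq_descFactorial_div_factorial]
  norm_cast

/-- The value of the polynomial with coefficients `w` and degree less than `n`. -/
def evalB (n : ℕ) (w : List ℤ) (y : ℤ) : ℤ :=
  ((List.range n).map fun t => w.getD t 0 * powB n y t).sum

theorem evalB_eq (n : ℕ) (w : List ℤ) (y : ℤ) :
    evalB n w y = ∑ t ∈ Finset.range n, w.getD t 0 * y ^ t := by
  rw [evalB, sum_map_range]
  refine Finset.sum_congr rfl fun t ht => ?_
  rw [powB_eq (Finset.mem_range.1 ht).le]

/-- The product of the squares of the first `j` diagonal entries. -/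
def diagProd (n : ℕ) (B : List (List ℤ)) (j : ℕ) : ℤ :=
  ((List.range n).map fun c => if c < j then ent B c c * ent B c c else 1).prod

/-- The initial data of the LLL algorithm for a lower triangular basis. -/
def initLattice (n : ℕ) (B : List (List ℤ)) : List (List ℤ) :=
  mat n (2 * n) fun i j =>
    if j < n then diagProd n B j * ent B j j * ent B i j else ent B i (j - n)

-- The Gram–Schmidt vectors of a lower triangular basis are the multiples `B c c` of the unit
-- vectors. So the Gram determinants are products of squares of diagonal entries, and the
-- coefficient of row `i` at column `j` is the determinant of order `j` times `B j j * B i j`. No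
-- orthogonalization has to be computed.
open Finset in
theorem latticeData_initLattice {n : ℕ} {L : AddSubgroup (ℕ → ℤ)} {B : List (List ℤ)}
    (tri : ∀ i < n, ∀ j, i < j → ent B i j = 0) (pos : ∀ i < n, 0 < ent B i i)
    (mem : ∀ i < n, ent B i ∈ L) :
    LatticeData n L (initLattice n B) ∧
      ∀ i < n, ent (initLattice n B) i i = ∏ c ∈ range (i + 1), ent B c c ^ 2 := by
  have hprod : ∀ j ≤ n, diagProd n B j = ∏ c ∈ range j, ent B c c ^ 2 := by
    intro j hj
    rw [diagProd, prod_map_range_ite hj]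
    exact prod_congr rfl fun c _ => (sq _).symm
  have hl : ∀ i < n, ∀ j < n,
      ent (initLattice n B) i j = (∏ c ∈ range j, ent B c c ^ 2) * ent B j j * ent B i j := by
    intro i hi j hj
    rw [initLattice, ent_mat _ _ _ _ hi, if_pos (by omega), if_pos hj, hprod j hj.le]
  have hb : ∀ i < n, ∀ t, ent (initLattice n B) i (n + t) = ent B i t := by
    intro i hi t
    rw [initLattice, ent_mat _ _ _ _ hi]
    split
    · rw [if_neg (by omega), Nat.add_sub_cancel_left]
    · rw [tri i hi t (by omega)]
  have hdiag : ∀ i < n, ent (initLattice n B) i i = ∏ c ∈ range (i + 1), ent B c c ^ 2 := by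
    intro i hi
    rw [hl i hi i hi, prod_range_succ]; ring
  have hD : ∀ c ≤ n, gramDet (ent (initLattice n B)) c = ∏ c ∈ range c, ent B c c ^ 2 := by
    intro c hc
    cases c with
    | zero => simp
    | succ c => exact hdiag c (by omega)
  have hP : ∀ c ≤ n, 0 < ∏ c ∈ range c, ent B c c ^ 2 := fun c hc =>
    prod_pos fun i hi => pow_pos (pos i (by have := mem_range.1 hi; omega)) 2
  refine ⟨⟨fun i hi j hj => ?_, fun i j hij hj => ?_, fun i hi => ?_, fun i j hi hj => ?_,
    fun i hi => ?_⟩, hdiag⟩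
  · obtain ⟨t, rfl⟩ := Nat.exists_eq_add_of_le (show n ≤ j by omega)
    rw [hb i hi, tri i hi t (by omega)]
  · rw [hl i (by omega) j hj, tri i (by omega) j hij]; simp
  · rw [hdiag i hi]; exact hP _ hi
  · simp only [gramForm, AddMonoidHom.coe_mk, ZeroHom.coe_mk]
    rw [sub_eq_zero]
    refine sum_congr rfl fun c hc => ?_
    have hc := mem_range.1 hc
    rw [hb i hi, hb j hj, hl i hi c hc, hl j hj c hc, hD c hc.le, hD (c + 1) hc, prod_range_succ]
    have h1 : ((∏ c ∈ range c, ent B c c ^ 2 : ℤ) : ℚ) ≠ 0 := by exact_mod_cast (hP c hc.le).ne'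
    have h2 : ((ent B c c : ℤ) : ℚ) ≠ 0 := by exact_mod_cast (pos c hc).ne'
    generalize ∏ c ∈ range c, ent B c c ^ 2 = x at *
    push_cast
    field_simp
  · simp only [hb i hi]
    exact mem i hi

namespace PT
variable {γ : Type*} [Enc γ]

@[fun_prop]
theorem powB {n : γ → Una} {x : γ → ℤ} {e : γ → ℕ} (hn : PT n) (hx : PT x) (he : PT e) :
    PT fun g => powB (n g).n (x g) (e g) := by
  unfold BitCost.powB
  exact PT.listProd (PT.map (f := fun g i => if i < e g then x g else 1) (by fun_prop)
    (by fun_prop))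

@[fun_prop]
theorem chooseB {n : γ → Una} {k t : γ → ℕ} (hn : PT n) (hk : PT k) (ht : PT t) :
    PT fun g => chooseB (n g).n (k g) (t g) := by
  unfold BitCost.chooseB
  exact PT.div (PT.listProd (PT.map (f := fun g i => if i < t g then (k g : ℤ) - i else 1)
    (by fun_prop) (by fun_prop))) (PT.listProd (PT.map
      (f := fun g i => if i < t g then (i : ℤ) + 1 else 1) (by fun_prop) (by fun_prop)))

@[fun_prop]
theorem evalB {n : γ → Una} {w : γ → List ℤ} {y : γ → ℤ} (hn : PT n) (hw : PT w) (hy : PT y) :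
    PT fun g => evalB (n g).n (w g) (y g) := by
  unfold BitCost.evalB
  exact PT.listSum (PT.map (f := fun g t => (w g).getD t 0 * BitCost.powB (n g).n (y g) t)
    (by fun_prop) (by fun_prop))

@[fun_prop]
theorem diagProd {n : γ → Una} {B : γ → List (List ℤ)} {j : γ → ℕ} (hn : PT n) (hB : PT B)
    (hj : PT j) : PT fun g => diagProd (n g).n (B g) (j g) := by
  unfold BitCost.diagProd
  exact PT.listProd (PT.map (f := fun g c => if c < j g then
    BitCost.ent (B g) c c * BitCost.ent (B g) c c else 1) (by fun_prop) (by fun_prop))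

@[fun_prop]
theorem initLattice {n : γ → Una} {B : γ → List (List ℤ)} (hn : PT n) (hB : PT B) :
    PT fun g => initLattice (n g).n (B g) := by
  unfold BitCost.initLattice
  refine PT.mat (k := fun g => Una.mk (2 * (n g).n)) (f := fun g i j => _) hn (by fun_prop) ?_
  fun_prop

end PT
end BitCost

/-! ### Integer roots of a polynomial from sign changes of its iterated differences. -/

namespace BitCost
open Enc

/-- The `k`-th forward difference at `y` of `-g ^ 2`, where `g` is the polynomial with coefficients
`w` and degree less than `n`, for `k ≤ 2 * n`. -/
def negSqDiff (n : ℕ) (w : List ℤ) (k : ℕ) (y : ℤ) : ℤ :=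
  ((List.range (2 * n + 1)).map fun i =>
    (if (k + i) % 2 = 0 then 1 else -1) * chooseB (2 * n + 1) k i *
      -(evalB n w (y + i) * evalB n w (y + i))).sum

theorem negSqDiff_eq {n k : ℕ} (hk : k ≤ 2 * n) (w : List ℤ) (y : ℤ) :
    negSqDiff n w k y = (fwdDiff 1)^[k] (fun y => -(evalB n w y * evalB n w y)) y := by
  rw [fwdDiff_iter_eq_sum_shift, negSqDiff, sum_map_range]
  rw [← Finset.sum_subset (Finset.range_subset_range.2 (show k + 1 ≤ 2 * n + 1 by omega))]
  · refine Finset.sum_congr rfl fun i hi => ?_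
    have hi := Finset.mem_range.1 hi
    rw [chooseB_eq (by omega)]
    -- Here `i ≤ k`, so the subtraction is not truncated and `k - i` has the parity of `k + i`.
    have : (if (k + i) % 2 = 0 then 1 else -1 : ℤ) = (-1) ^ (k - i) := by
      rw [neg_one_pow_eq_ite]
      congr 1
      rw [Nat.even_iff]
      exact propext (by omega)
    rw [this]
    simp
  · intro i hi hik
    have h1 := Finset.mem_range.1 hi
    have h2 : k < i := by simpa using hik
    rw [chooseB_eq (by omega), Nat.choose_eq_zero_of_lt h2]
    simp

theorem negSqDiff_zero (n : ℕ) (w : List ℤ) (y : ℤ) :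
    negSqDiff n w 0 y = -(evalB n w y * evalB n w y) := by
  rw [negSqDiff_eq (by omega)]; rfl

theorem negSqDiff_succ {n k : ℕ} (hk : k < 2 * n) (w : List ℤ) (y : ℤ) :
    negSqDiff n w (k + 1) y = negSqDiff n w k (y + 1) - negSqDiff n w k y := by
  rw [negSqDiff_eq hk, negSqDiff_eq hk.le, negSqDiff_eq hk.le, Function.iterate_succ_apply']
  rfl

open Polynomial in
/-- The polynomial with coefficients `w` and degree less than `n`. -/
noncomputable def polyB (n : ℕ) (w : List ℤ) : ℤ[X] :=
  ∑ t ∈ Finset.range n, C (w.getD t 0) * X ^ t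

theorem eval_polyB (n : ℕ) (w : List ℤ) (y : ℤ) : (polyB n w).eval y = evalB n w y := by
  rw [evalB_eq, polyB, Polynomial.eval_finsetSum]
  simp

theorem natDegree_polyB_lt {n : ℕ} (hn : 0 < n) (w : List ℤ) : (polyB n w).natDegree < n := by
  obtain ⟨k, rfl⟩ : ∃ k, n = k + 1 := ⟨n - 1, by omega⟩
  refine Nat.lt_succ_of_le (Polynomial.natDegree_sum_le_of_forall_le _ _ fun t ht => ?_)
  exact (Polynomial.natDegree_C_mul_X_pow_le _ _).trans (by have := Finset.mem_range.1 ht; omega)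

/-- The square of a polynomial of degree less than `n` has degree less than `2 * n`. This gives a
level without sign changes, at which the descent can start. -/
theorem negSqDiff_last {n : ℕ} (hn : 0 < n) (w : List ℤ) (y : ℤ) :
    negSqDiff n w (2 * n) y = 0 := by
  rw [negSqDiff_eq le_rfl]
  have h : (-(polyB n w * polyB n w)).natDegree < 2 * n := by
    rw [Polynomial.natDegree_neg]
    have := natDegree_polyB_lt hn w
    exact Polynomial.natDegree_mul_le.trans_lt (by omega)
  have := congrFun (Polynomial.fwdDiff_iter_eq_zero_of_degree_lt h) y
  rw [show (-(polyB n w * polyB n w)).eval = fun y => -(evalB n w y * evalB n w y) by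
    funext y; simp [eval_polyB]] at this
  exact this

/-- `1` if the `k`-th difference is nonnegative at `y`, and `0` otherwise. -/
def diffSign (n : ℕ) (w : List ℤ) (k : ℕ) (y : ℤ) : ℤ := if 0 ≤ negSqDiff n w k y then 1 else 0

/-- One step of the bisection. -/
def bisectStep (s : (Una × List ℤ × ℕ) × ℤ × ℤ) : (Una × List ℤ × ℕ) × ℤ × ℤ :=
  if diffSign s.1.1.n s.1.2.1 s.1.2.2 ((s.2.1 + s.2.2) / 2) =
    diffSign s.1.1.n s.1.2.1 s.1.2.2 s.2.1 then (s.1, (s.2.1 + s.2.2) / 2, s.2.2)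
  else (s.1, s.2.1, (s.2.1 + s.2.2) / 2)

/-- A place between `lo` and `hi` where the sign of the `k`-th difference changes. -/
noncomputable def bisect (n : Una) (w : List ℤ) (k : ℕ) (lo hi : ℤ) : ℤ :=
  (whileLoop (fun s => decide (s.2.1 + 1 < s.2.2)) bisectStep ((n, w, k), lo, hi)).2.1

/-- The invariant is left arbitrary because it is used twice: with the sign condition at the ends
for correctness, and with bounds on the ends for the running time. -/
theorem bisect_iterate (n : Una) (w : List ℤ) (k : ℕ) (lo hi : ℤ)
    (I : (Una × List ℤ × ℕ) × ℤ × ℤ → Prop) (h0 : I ((n, w, k), lo, hi))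
    (hs : ∀ s, I s → s.2.1 + 1 < s.2.2 → I (bisectStep s)) :
    ∃ m ≤ sz hi + sz lo,
      decide ((bisectStep^[m] ((n, w, k), lo, hi)).2.1 + 1 <
        (bisectStep^[m] ((n, w, k), lo, hi)).2.2) = false ∧
      ∀ i ≤ m, I (bisectStep^[i] ((n, w, k), lo, hi)) := by
  -- The distance diminished by one is at least halved in spite of the rounded midpoint, and it
  -- vanishes when the ends are adjacent.
  refine exists_iterate_of_potential I (fun s => (s.2.2 - s.2.1 - 1).toNat)
    (c := fun s => decide (s.2.1 + 1 < s.2.2)) h0 (fun s h hc => hs s h (by simpa using hc))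
    (fun s h hc => ?_) (fun s h hc => ?_) ?_
  · have := of_decide_eq_true hc
    omega
  · have := of_decide_eq_true hc
    unfold bisectStep
    split <;> dsimp only <;> omega
  · have h1 := abs_lt_two_pow_sz (hi - lo)
    have h2 := pow_le_pow_right₀ (show (1 : ℤ) ≤ 2 by norm_num) (sz_sub_le hi lo)
    have h3 := le_abs_self (hi - lo)
    have h4 : (((hi - lo - 1).toNat : ℕ) : ℤ) < ((2 ^ (sz hi + sz lo) : ℕ) : ℤ) := by
      push_cast
      have : (0 : ℤ) < 2 ^ (sz hi + sz lo) := by positivity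
      omega
    exact_mod_cast h4

theorem bisect_spec {n : Una} {w : List ℤ} {k : ℕ} {lo hi : ℤ} (h : lo < hi)
    (hne : diffSign n.n w k lo ≠ diffSign n.n w k hi) :
    lo ≤ bisect n w k lo hi ∧ bisect n w k lo hi < hi ∧
      diffSign n.n w k (bisect n w k lo hi) ≠ diffSign n.n w k (bisect n w k lo hi + 1) := by
  let I : (Una × List ℤ × ℕ) × ℤ × ℤ → Prop := fun s => s.1 = (n, w, k) ∧ lo ≤ s.2.1 ∧
    s.2.1 < s.2.2 ∧ s.2.2 ≤ hi ∧ diffSign n.n w k s.2.1 ≠ diffSign n.n w k s.2.2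
  have h0 : I ((n, w, k), lo, hi) := ⟨rfl, le_rfl, h, le_rfl, hne⟩
  have hs : ∀ s, I s → s.2.1 + 1 < s.2.2 → I (bisectStep s) := by
    rintro ⟨c, a, b⟩ ⟨rfl, h1, h2, h3, h4⟩ h5
    dsimp only at *
    unfold bisectStep
    dsimp only
    split
    · exact ⟨rfl, by dsimp only; omega, by dsimp only; omega, by dsimp only; omega,
        by dsimp only; omega⟩
    · exact ⟨rfl, by dsimp only; omega, by dsimp only; omega, by dsimp only; omega,
        by dsimp only; omega⟩
  obtain ⟨m, -, hm, -⟩ := bisect_iterate n w k lo hi I h0 hs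
  obtain ⟨⟨h1, h2, h3, h4, h5⟩, h6⟩ := whileLoop_induction I
    (c := fun s : (Una × List ℤ × ℕ) × ℤ × ℤ => decide (s.2.1 + 1 < s.2.2)) ⟨m, hm⟩ h0
    (fun s h hc => hs s h (by simpa using hc))
  have h7 := of_decide_eq_false h6
  unfold bisect
  refine ⟨h2, by omega, ?_⟩
  rwa [show (whileLoop (fun s => decide (s.2.1 + 1 < s.2.2)) bisectStep ((n, w, k), lo, hi)).2.1 + 1
    = (whileLoop (fun s => decide (s.2.1 + 1 < s.2.2)) bisectStep ((n, w, k), lo, hi)).2.2 by omega]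

/-- The sign changes of the `k`-th difference between `A` and `B`, computed from a sorted list which
contains the sign changes of the next difference. -/
noncomputable def signChanges (n : Una) (w : List ℤ) (A B : ℤ) (k : ℕ) (S : List ℤ) : List ℤ :=
  ((List.range (S.length + 1)).map fun i =>
    if diffSign n.n w k (((A - 1) :: (S ++ [B - 1])).getD i 0 + 1) =
      diffSign n.n w k (((A - 1) :: (S ++ [B - 1])).getD (i + 1) 0 + 1) then []
    else [bisect n w k (((A - 1) :: (S ++ [B - 1])).getD i 0 + 1)
      (((A - 1) :: (S ++ [B - 1])).getD (i + 1) 0 + 1)]).flatten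

/-- Candidates for the integers between `-G` and `G` which are zeros of the polynomial with
coefficients `w` and degree less than `n`. -/
noncomputable def rootCandidates (n : Una) (w : List ℤ) (G : ℕ) : List ℤ :=
  (((List.range (2 * n.n)).reverse.foldl
    (fun S k => signChanges n w (-G) (G + n.n + 1) k S) []).map fun c =>
      (List.range n.n).map fun i : ℕ => c - (i : ℤ)).flatten

/-- Sorted lists of integers from `A` to `B - 1`. -/
def SortedIn (A B : ℤ) (S : List ℤ) : Prop := S.Pairwise (· ≤ ·) ∧ ∀ s ∈ S, A ≤ s ∧ s < B

/-- With `A - 1` and `B - 1` added at the ends, consecutive entries `u ≤ v` of the list stand for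
the intervals from `u + 1` to `v + 1`, which together cover the range from `A` to `B`. -/
theorem SortedIn.getD_mono {A B : ℤ} {S : List ℤ} (h : SortedIn A B S) (hAB : A ≤ B) {i j : ℕ}
    (hij : i ≤ j) (hj : j ≤ S.length + 1) :
    ((A - 1) :: (S ++ [B - 1])).getD i 0 ≤ ((A - 1) :: (S ++ [B - 1])).getD j 0 := by
  have hp : ((A - 1) :: (S ++ [B - 1])).Pairwise (· ≤ ·) := by
    rw [List.pairwise_cons, List.pairwise_append]
    refine ⟨fun x hx => ?_, h.1, by simp, fun x hx y hy => ?_⟩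
    · rcases List.mem_append.1 hx with hx | hx
      · have := (h.2 x hx).1; omega
      · obtain rfl : x = B - 1 := by simpa using hx
        omega
    · obtain rfl : y = B - 1 := by simpa using hy
      have := (h.2 x hx).2; omega
  have hlen : ((A - 1) :: (S ++ [B - 1])).length = S.length + 2 := by simp
  rw [List.getD_eq_getElem _ _ (by omega), List.getD_eq_getElem _ _ (by omega)]
  rcases hij.eq_or_lt with rfl | hij
  · exact le_rfl
  · exact List.pairwise_iff_getElem.1 hp i j (by omega) (by omega) hij

theorem getD_last (a b : ℤ) (S : List ℤ) : (a :: (S ++ [b])).getD (S.length + 1) 0 = b := by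
  simp

theorem SortedIn.mem_range {A B : ℤ} {S : List ℤ} (h : SortedIn A B S) (hAB : A ≤ B) {i : ℕ}
    (hi : i ≤ S.length + 1) : A - 1 ≤ ((A - 1) :: (S ++ [B - 1])).getD i 0 ∧
      ((A - 1) :: (S ++ [B - 1])).getD i 0 ≤ B - 1 := by
  have h1 := h.getD_mono hAB (Nat.zero_le i) hi
  have h2 := h.getD_mono hAB hi le_rfl
  rw [getD_last] at h2
  exact ⟨h1, h2⟩

/-- Bisection between entries `u` and `v` returns a place from `u + 1` to `v`. These ranges are
disjoint and ordered, so the output is sorted. One place at most per interval means that the list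
grows by at most one from level to level, which keeps the whole computation polynomial. -/
theorem SortedIn.signChanges {n : Una} {w : List ℤ} {A B : ℤ} {S : List ℤ} (h : SortedIn A B S)
    (hAB : A ≤ B) (k : ℕ) : SortedIn A B (signChanges n w A B k S) ∧
      (signChanges n w A B k S).length ≤ S.length + 1 := by
  set P := (A - 1) :: (S ++ [B - 1]) with hP
  let F : ℕ → List ℤ := fun i => if diffSign n.n w k (P.getD i 0 + 1) =
      diffSign n.n w k (P.getD (i + 1) 0 + 1) then []
    else [bisect n w k (P.getD i 0 + 1) (P.getD (i + 1) 0 + 1)]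
  have hF : ∀ i < S.length + 1, ∀ x ∈ F i, P.getD i 0 + 1 ≤ x ∧ x ≤ P.getD (i + 1) 0 := by
    intro i hi x hx
    dsimp only [F] at hx
    split at hx
    · simp at hx
    · rename_i hne
      obtain rfl := List.mem_singleton.1 hx
      have h1 := h.getD_mono hAB (show i ≤ i + 1 by omega) (by omega)
      rw [← hP] at h1
      have h2 : P.getD i 0 ≠ P.getD (i + 1) 0 := fun h => hne (by rw [h])
      obtain ⟨h3, h4, -⟩ := bisect_spec (lt_of_le_of_ne (by omega) (by omega)) hne
      omega
  have hlen : ∀ i, (F i).length ≤ 1 := by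
    intro i; dsimp only [F]; split <;> simp
  have hdef : BitCost.signChanges n w A B k S = ((List.range (S.length + 1)).map F).flatten := rfl
  rw [hdef]
  refine ⟨⟨?_, ?_⟩, ?_⟩
  · rw [List.pairwise_flatten]
    refine ⟨fun l hl => ?_, ?_⟩
    · obtain ⟨i, -, rfl⟩ := List.mem_map.1 hl
      dsimp only [F]; split <;> simp
    · rw [List.pairwise_map]
      refine List.pairwise_lt_range.imp_of_mem fun {i j} hi hj hij x hx y hy => ?_
      have hi := List.mem_range.1 hi
      have hj := List.mem_range.1 hj
      have h1 := hF i hi x hx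
      have h2 := hF j hj y hy
      have h3 := h.getD_mono hAB (show i + 1 ≤ j by omega) (by omega)
      rw [← hP] at h3
      omega
  · intro s hs
    obtain ⟨l, hl, hsl⟩ := List.mem_flatten.1 hs
    obtain ⟨i, hi, rfl⟩ := List.mem_map.1 hl
    have hi := List.mem_range.1 hi
    have h1 := hF i hi s hsl
    have h2 := (h.mem_range hAB (show i ≤ S.length + 1 by omega)).1
    have h3 := (h.mem_range hAB (show i + 1 ≤ S.length + 1 by omega)).2
    rw [← hP] at h2 h3
    omega
  · rw [List.length_flatten, List.map_map]
    have : ∀ m, ((List.range m).map (List.length ∘ F)).sum ≤ m := by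
      intro m
      induction m with
      | zero => simp
      | succ m ih =>
        rw [List.range_succ, List.map_append, List.sum_append]
        have := hlen m
        simp; omega
    exact this _

/-- A function with values `0` and `1` which is monotone or antitone has at most one jump. -/
theorem jump_unique {σ : ℤ → ℤ} {a b : ℤ} (h01 : ∀ x, σ x = 0 ∨ σ x = 1)
    (h : (∀ x y, a ≤ x → x ≤ y → y ≤ b → σ x ≤ σ y) ∨ (∀ x y, a ≤ x → x ≤ y → y ≤ b → σ y ≤ σ x))
    {x : ℤ} (hax : a ≤ x) (hxb : x < b) (hx : σ x ≠ σ (x + 1)) :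
    σ a ≠ σ b ∧ ∀ y, a ≤ y → y < b → σ y ≠ σ (y + 1) → x = y := by
  have hx0 := h01 x
  have hx1 := h01 (x + 1)
  have ha := h01 a
  have hb := h01 b
  refine ⟨?_, fun y hay hyb hy => ?_⟩
  · rcases h with h | h <;>
    · have h1 := h a x le_rfl hax hxb.le
      have h2 := h x (x + 1) hax (by omega) (by omega)
      have h3 := h (x + 1) b (by omega) (by omega) le_rfl
      omega
  · have hy0 := h01 y
    have hy1 := h01 (y + 1)
    by_contra hne
    rcases lt_or_gt_of_ne hne with hlt | hlt
    · rcases h with h | h <;>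
      · have h1 := h x (x + 1) hax (by omega) (by omega)
        have h2 := h (x + 1) y (by omega) (by omega) (by omega)
        have h3 := h y (y + 1) (by omega) (by omega) (by omega)
        omega
    · rcases h with h | h <;>
      · have h1 := h y (y + 1) hay (by omega) (by omega)
        have h2 := h (y + 1) x (by omega) (by omega) (by omega)
        have h3 := h x (x + 1) (by omega) (by omega) (by omega)
        omega

theorem diffSign_eq_or (n : ℕ) (w : List ℤ) (k : ℕ) (y : ℤ) :
    diffSign n w k y = 0 ∨ diffSign n w k y = 1 := by unfold diffSign; split <;> simp

/-- The next difference keeps its sign on the steps from `a` to `b`, so the `k`-th difference is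
increasing or decreasing there, and its sign inherits this. The strict bound `z + 1 < b` reflects
that the steps start at `a, …, b - 1`. -/
theorem diffSign_monotone {n : ℕ} {w : List ℤ} {k : ℕ} (hk : k < 2 * n) {a b : ℤ}
    (h : ∀ z, a ≤ z → z + 1 < b → diffSign n w (k + 1) z = diffSign n w (k + 1) (z + 1)) :
    (∀ x y, a ≤ x → x ≤ y → y ≤ b → diffSign n w k x ≤ diffSign n w k y) ∨
    (∀ x y, a ≤ x → x ≤ y → y ≤ b → diffSign n w k y ≤ diffSign n w k x) := by
  have hconst : ∀ z, a ≤ z → z < b → diffSign n w (k + 1) z = diffSign n w (k + 1) a := by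
    intro z hz
    induction z, hz using Int.leInduction with
    | base => intro _; rfl
    | succ z hz ih => intro hb; rw [← h z hz hb, ih (by omega)]
  rcases diffSign_eq_or n w (k + 1) a with h0 | h0
  · right
    intro x y hax hxy
    have hstep : ∀ z, a ≤ z → z < b → diffSign n w k (z + 1) ≤ diffSign n w k z := by
      intro z h1 h2
      have h3 := hconst z h1 h2
      rw [h0] at h3
      have h4 := negSqDiff_succ hk w z
      unfold diffSign at h3 ⊢
      split_ifs at h3 ⊢ <;> omega
    induction y, hxy using Int.leInduction with
    | base => intro _; exact le_rfl
    | succ y hy ih => intro hb; exact (hstep y (by omega) (by omega)).trans (ih (by omega))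
  · left
    intro x y hax hxy
    have hstep : ∀ z, a ≤ z → z < b → diffSign n w k z ≤ diffSign n w k (z + 1) := by
      intro z h1 h2
      have h3 := hconst z h1 h2
      rw [h0] at h3
      have h4 := negSqDiff_succ hk w z
      unfold diffSign at h3 ⊢
      split_ifs at h3 ⊢ <;> omega
    induction y, hxy using Int.leInduction with
    | base => intro _; exact le_rfl
    | succ y hy ih => intro hb; exact (ih (by omega)).trans (hstep y (by omega) (by omega))

/-- Choose the first padded entry that is at least `y`, so that `y` lies between it and its
predecessor. No sign change of the next difference lies strictly between these neighbours, so the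
`k`-th difference is monotone on the interval and `y` is its only sign change there. Bisection must
return it. -/
theorem mem_signChanges {n : Una} {w : List ℤ} {A B : ℤ} {S : List ℤ} (h : SortedIn A B S)
    (hAB : A ≤ B) {k : ℕ} (hk : k < 2 * n.n)
    (hS : ∀ y, A ≤ y → y < B → diffSign n.n w (k + 1) y ≠ diffSign n.n w (k + 1) (y + 1) → y ∈ S)
    {y : ℤ} (hA : A ≤ y) (hB : y < B) (hy : diffSign n.n w k y ≠ diffSign n.n w k (y + 1)) :
    y ∈ signChanges n w A B k S := by
  set P := (A - 1) :: (S ++ [B - 1]) with hP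
  have hex : ∃ j, y ≤ P.getD j 0 := ⟨S.length + 1, by rw [hP, getD_last]; omega⟩
  classical
  obtain ⟨hj1, hj2⟩ : y ≤ P.getD (Nat.find hex) 0 ∧ ∀ i < Nat.find hex, ¬ y ≤ P.getD i 0 :=
    ⟨Nat.find_spec hex, fun i hi => Nat.find_min hex hi⟩
  have hjle : Nat.find hex ≤ S.length + 1 := Nat.find_min' hex (by rw [hP, getD_last]; omega)
  generalize Nat.find hex = j at *
  cases j with
  | zero => simp [hP] at hj1; omega
  | succ i =>
    have hi := hj2 i (by omega)
    have hmono := diffSign_monotone hk (w := w) (a := P.getD i 0 + 1) (b := P.getD (i + 1) 0 + 1)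
      (fun z h1 h2 => by
        by_contra hne
        have hz1 := h.mem_range hAB (show i ≤ S.length + 1 by omega)
        have hz2 := h.mem_range hAB (show i + 1 ≤ S.length + 1 by omega)
        rw [← hP] at hz1 hz2
        have hmem := hS z (by omega) (by omega) hne
        obtain ⟨l, hl, rfl⟩ := List.getElem_of_mem hmem
        have hPl : P.getD (l + 1) 0 = S[l] := by
          rw [hP, List.getD_cons_succ, List.getD_append _ _ _ _ hl, List.getD_eq_getElem]
        rcases le_or_gt (l + 1) i with hli | hli
        · have := h.getD_mono hAB hli (by omega)
          rw [← hP] at this; omega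
        · have := h.getD_mono hAB (show i + 1 ≤ l + 1 by omega) (by omega)
          rw [← hP] at this; omega)
    obtain ⟨hne, huniq⟩ := jump_unique (diffSign_eq_or n.n w k) hmono (x := y) (by omega)
      (by omega) hy
    obtain ⟨h1, h2, h3⟩ := bisect_spec (by omega) hne
    have hyb := huniq _ h1 h2 h3
    refine List.mem_flatten.2 ⟨_, List.mem_map.2 ⟨i, List.mem_range.2 (by omega), rfl⟩, ?_⟩
    rw [← hP, if_neg hne, ← hyb]
    simp

theorem signChanges_foldl {n : Una} (w : List ℤ) {A B : ℤ} (hAB : A ≤ B) (l : List ℕ) :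
    SortedIn A B (l.foldl (fun S k => signChanges n w A B k S) []) ∧
      (l.foldl (fun S k => signChanges n w A B k S) []).length ≤ l.length := by
  induction l using List.reverseRecOn with
  | nil => exact ⟨⟨by simp, by simp⟩, by simp⟩
  | append_singleton l a ih =>
    rw [List.foldl_append]
    obtain ⟨h1, h2⟩ := ih.1.signChanges (n := n) (w := w) hAB a
    refine ⟨h1, h2.trans ?_⟩
    simpa using ih.2

/-- Descending induction on the level. At level `2 * n` the difference is identically zero, so the
empty list is complete. -/
theorem mem_signChanges_foldl {n : Una} (hn : 0 < n.n) (w : List ℤ) {A B : ℤ} (hAB : A ≤ B)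
    {y : ℤ} (hA : A ≤ y) (hB : y < B) (hy : diffSign n.n w 0 y ≠ diffSign n.n w 0 (y + 1)) :
    y ∈ (List.range (2 * n.n)).reverse.foldl (fun S k => signChanges n w A B k S) [] := by
  suffices h : ∀ m ≤ 2 * n.n, ∀ S, SortedIn A B S →
      (∀ y, A ≤ y → y < B → diffSign n.n w m y ≠ diffSign n.n w m (y + 1) → y ∈ S) →
      y ∈ (List.range m).reverse.foldl (fun S k => signChanges n w A B k S) S by
    refine h (2 * n.n) le_rfl [] ⟨by simp, by simp⟩ fun y _ _ hne => absurd ?_ hne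
    simp [diffSign, negSqDiff_last hn]
  intro m
  induction m with
  | zero => intro _ S _ hS; exact hS y hA hB hy
  | succ m ih =>
    intro hm S hS hc
    rw [List.range_succ, List.reverse_append]
    exact ih (by omega) _ (hS.signChanges hAB m).1
      fun y h1 h2 h3 => mem_signChanges hS hAB (by omega) hc h1 h2 h3

/-- The function `-g ^ 2` is nonnegative exactly at the roots of `g`, whatever their multiplicity. A
nonzero polynomial of degree less than `n` cannot vanish at all of `z, …, z + n`. So there is a `j <
n` with a root at `z + j` and none at `z + j + 1`; this is a sign change, and `z` is recovered as
the candidate shifted back by `j`. -/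
theorem mem_rootCandidates {n : Una} {w : List ℤ} (hw : ∃ t < n.n, w.getD t 0 ≠ 0) {G : ℕ} {z : ℤ}
    (hz : |z| ≤ G) (hroot : evalB n.n w z = 0) : z ∈ rootCandidates n w G := by
  obtain ⟨t, ht, hwt⟩ := hw
  have hn : 0 < n.n := by omega
  have hne : polyB n.n w ≠ 0 := by
    intro h
    have := congrArg (fun p => p.coeff t) h
    simp only [polyB, Polynomial.finsetSum_coeff, Polynomial.coeff_C_mul_X_pow,
      Polynomial.coeff_zero] at this
    rw [Finset.sum_ite_eq, if_pos (Finset.mem_range.2 ht)] at this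
    exact hwt this
  have hex : ∃ j, j ≤ n.n ∧ evalB n.n w (z + j) ≠ 0 := by
    by_contra! hall
    have h1 : ((Finset.range (n.n + 1)).image fun j : ℕ => z + (j : ℤ)).card = n.n + 1 := by
      rw [Finset.card_image_of_injective _ (fun a b h => by simpa using h), Finset.card_range]
    have h2 : ((Finset.range (n.n + 1)).image fun j : ℕ => z + (j : ℤ)) ⊆
        (polyB n.n w).roots.toFinset := by
      intro x hx
      obtain ⟨j, hj, rfl⟩ := Finset.mem_image.1 hx
      rw [Multiset.mem_toFinset, Polynomial.mem_roots hne, Polynomial.IsRoot, eval_polyB]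
      exact hall j (by have := Finset.mem_range.1 hj; omega)
    have h3 := Finset.card_le_card h2
    have h4 := Multiset.toFinset_card_le (polyB n.n w).roots
    have h5 := Polynomial.card_roots' (polyB n.n w)
    have h6 := natDegree_polyB_lt hn w
    omega
  classical
  obtain ⟨⟨hj1, hj2⟩, hj3⟩ : (Nat.find hex ≤ n.n ∧ evalB n.n w (z + Nat.find hex) ≠ 0) ∧
      ∀ i < Nat.find hex, ¬ (i ≤ n.n ∧ evalB n.n w (z + i) ≠ 0) :=
    ⟨Nat.find_spec hex, fun i hi => Nat.find_min hex hi⟩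
  generalize Nat.find hex = j at *
  cases j with
  | zero => simp [hroot] at hj2
  | succ j =>
    have hj4 : evalB n.n w (z + j) = 0 := by
      by_contra h
      exact hj3 j (by omega) ⟨by omega, h⟩
    have habs := abs_le.1 hz
    -- The upper end exceeds `G` by `n + 1` to leave room for the shift from `z` to the end of its
    -- run of roots.
    have hmem := mem_signChanges_foldl (n := n) (A := -G) (B := G + n.n + 1) (y := z + j) hn w
      (by omega) (by omega) (by omega)
    refine List.mem_flatten.2 ⟨_, List.mem_map.2 ⟨z + j, hmem ?_, rfl⟩,
      List.mem_map.2 ⟨j, List.mem_range.2 (by omega), by omega⟩⟩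
    unfold diffSign
    rw [negSqDiff_zero, negSqDiff_zero, hj4, if_pos (by simp), if_neg]
    · norm_num
    · push_cast at hj2
      rw [← add_assoc] at hj2
      have := mul_self_pos.2 hj2
      omega

namespace PT
variable {γ : Type*} [Enc γ]

@[fun_prop]
theorem una_mk_add {n : γ → Una} (c : ℕ) (hn : PT n) : PT fun g => Una.mk ((n g).n + c) :=
  PT.of_enc_eq (f := fun g => (n g).n + c) (by fun_prop) (fun _ => rfl)
    ((hn.pb.add (PB.const c)).mono fun a => by simp only [sz_una]; omega)

@[fun_prop]
theorem una_length {α : Type*} [Enc α] {l : γ → List α} (hl : PT l) :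
    PT fun g => Una.mk (l g).length :=
  PT.of_enc_eq (f := fun g => (l g).length) (by fun_prop) (fun _ => rfl)
    (hl.pb.mono fun a => length_lt_sz (l a))

@[fun_prop]
theorem nat_mod {f g : γ → ℕ} (hf : PT f) (hg : PT g) : PT fun a => f a % g a := by
  have : PT fun a => ((f a : ℤ) % (g a : ℤ)).toNat := by fun_prop
  refine cast (congrArg _ (funext fun a => ?_)) this
  norm_cast

@[fun_prop]
theorem negSqDiff {n : γ → Una} {w : γ → List ℤ} {k : γ → ℕ} {y : γ → ℤ} (hn : PT n) (hw : PT w)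
    (hk : PT k) (hy : PT y) : PT fun g => negSqDiff (n g).n (w g) (k g) (y g) := by
  unfold BitCost.negSqDiff
  have h2 : PT fun g => Una.mk (2 * (n g).n + 1) :=
    una_mk_add (n := fun g => Una.mk (2 * (n g).n)) 1 (by fun_prop)
  have h3 : PT fun x : γ × ℕ => BitCost.chooseB (2 * (n x.1).n + 1) (k x.1) x.2 :=
    PT.chooseB (n := fun x : γ × ℕ => Una.mk (2 * (n x.1).n + 1))
      (h2.comp (f := fun x : γ × ℕ => x.1) (by fun_prop)) (by fun_prop) (by fun_prop)
  exact PT.listSum (PT.map (f := fun g i => (if (k g + i) % 2 = 0 then 1 else -1) *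
    BitCost.chooseB (2 * (n g).n + 1) (k g) i * -(BitCost.evalB (n g).n (w g) (y g + i) *
      BitCost.evalB (n g).n (w g) (y g + i))) (PT.range h2)
      (PT.mul (PT.mul (by fun_prop) h3) (by fun_prop)))

@[fun_prop]
theorem diffSign {n : γ → Una} {w : γ → List ℤ} {k : γ → ℕ} {y : γ → ℤ} (hn : PT n) (hw : PT w)
    (hk : PT k) (hy : PT y) : PT fun g => diffSign (n g).n (w g) (k g) (y g) := by
  unfold BitCost.diffSign
  fun_prop

@[fun_prop]
theorem bisect {n : γ → Una} {w : γ → List ℤ} {k : γ → ℕ} {lo hi : γ → ℤ} (hn : PT n) (hw : PT w)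
    (hk : PT k) (hlo : PT lo) (hhi : PT hi) :
    PT fun g => bisect (n g) (w g) (k g) (lo g) (hi g) := by
  unfold BitCost.bisect
  refine PT.fst (PT.snd (PT.whileLoop (init := fun g => ((n g, w g, k g), lo g, hi g))
    (n := fun g => sz (hi g) + sz (lo g))
    (w := fun g => sz (n g, w g, k g) + 2 * (sz (lo g) + sz (hi g) + 2) + 2)
    (by fun_prop) ?_ (by fun_prop) (hhi.pb.add hlo.pb) ?_ fun g => ?_))
  · unfold bisectStep
    fun_prop
  · exact ((PT.pb (f := fun g => (n g, w g, k g)) (by fun_prop)).add ((PB.const 2).mul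
      ((hlo.pb.add hhi.pb).add (PB.const 2)))).add (PB.const 2)
  · let E : ℤ := 2 ^ (sz (lo g) + sz (hi g))
    have hE1 : |lo g| ≤ E := (abs_lt_two_pow_sz _).le.trans
      (pow_le_pow_right₀ (by norm_num) (by omega))
    have hE2 : |hi g| ≤ E := (abs_lt_two_pow_sz _).le.trans
      (pow_le_pow_right₀ (by norm_num) (by omega))
    obtain ⟨m, hm, hc, hI⟩ := bisect_iterate (n g) (w g) (k g) (lo g) (hi g)
      (fun s => s.1 = (n g, w g, k g) ∧ |s.2.1| ≤ E ∧ |s.2.2| ≤ E) ⟨rfl, hE1, hE2⟩ (by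
        rintro ⟨c, a, b⟩ ⟨rfl, h1, h2⟩ -
        dsimp only at h1 h2
        rw [abs_le] at h1 h2
        have h3 : |(a + b) / 2| ≤ E := by rw [abs_le]; omega
        unfold bisectStep
        dsimp only
        split
        · exact ⟨rfl, h3, abs_le.2 h2⟩
        · exact ⟨rfl, abs_le.2 h1, h3⟩)
    refine ⟨m, hm, hc, fun i hi => ?_⟩
    obtain ⟨h1, h2, h3⟩ := hI i hi
    have h4 := sz_int_le h2
    have h5 := sz_int_le h3
    rw [sz_prod, sz_prod (bisectStep^[i] _).2, h1]
    omega

@[fun_prop]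
theorem signChanges {n : γ → Una} {w : γ → List ℤ} {A B : γ → ℤ} {k : γ → ℕ} {S : γ → List ℤ}
    (hn : PT n) (hw : PT w) (hA : PT A) (hB : PT B) (hk : PT k) (hS : PT S) :
    PT fun g => signChanges (n g) (w g) (A g) (B g) (k g) (S g) := by
  unfold BitCost.signChanges
  refine PT.flatten (PT.map (f := fun g i => _) (PT.range (n := fun g => Una.mk ((S g).length + 1))
    (una_mk_add (n := fun g => Una.mk (S g).length) 1 (by fun_prop))) ?_)
  fun_prop

@[fun_prop]
theorem rootCandidates {n : γ → Una} {w : γ → List ℤ} {G : γ → ℕ} (hn : PT n) (hw : PT w)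
    (hG : PT G) : PT fun g => rootCandidates (n g) (w g) (G g) := by
  unfold BitCost.rootCandidates
  have h1 : PT fun g => (List.range (2 * (n g).n)).reverse :=
    (PT.range (n := fun g => Una.mk (2 * (n g).n)) (by fun_prop)).reverse
  have h2 : PT fun g => (List.range (2 * (n g).n)).reverse.foldl
      (fun S k => BitCost.signChanges (n g) (w g) (-G g) (G g + (n g).n + 1) k S) [] := by
    refine PT.foldl (step := fun g S k => BitCost.signChanges (n g) (w g) (-G g)
      (G g + (n g).n + 1) k S) (init := fun _ => [])
      (w := fun g => sz ((List.range (2 * (n g).n)).reverse) * (sz (G g) + sz (n g) + 6) + 1)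
      h1 (by fun_prop) (by fun_prop)
      ((h1.pb.mul ((hG.pb.add hn.pb).add (PB.const 6))).add (PB.const 1)) fun g l' hl' => ?_
    obtain ⟨h3, h4⟩ := signChanges_foldl (n := n g) (w g)
      (show (-G g : ℤ) ≤ G g + (n g).n + 1 by omega) l'
    refine sz_list_le (B := sz (G g) + sz (n g) + 5)
      (h4.trans (hl'.length_le.trans (length_lt_sz _).le)) fun a ha => ?_
    have h5 := h3.2 a ha
    have h6 : |a| ≤ 2 ^ (sz (G g) + sz (n g) + 3) := by
      have h7 : ((G g : ℕ) : ℤ) < 2 ^ sz (G g) := by exact_mod_cast nat_lt_two_pow_sz (G g)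
      have h8 : (((n g).n : ℕ) : ℤ) < 2 ^ sz (n g) := by
        have : (n g).n < 2 ^ (n g).n := Nat.lt_two_pow_self
        have h9 : 2 ^ (n g).n ≤ 2 ^ sz (n g) := Nat.pow_le_pow_right (by norm_num) (by simp)
        exact_mod_cast this.trans_le h9
      have h10 : (1 : ℤ) ≤ 2 ^ sz (G g) := one_le_pow₀ (by norm_num)
      have h11 : (1 : ℤ) ≤ 2 ^ sz (n g) := one_le_pow₀ (by norm_num)
      rw [pow_add, pow_add, abs_le]
      constructor <;> nlinarith
    exact sz_int_le h6
  exact PT.flatten (PT.map (f := fun g (c : ℤ) => (List.range (n g).n).map fun i : ℕ => c - (i : ℤ)) h2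
    (PT.map (f := fun (x : γ × ℤ) (i : ℕ) => x.2 - (i : ℤ))
      (PT.range (n := fun x : γ × ℤ => n x.1) (by fun_prop)) (by fun_prop)))

end PT
end BitCost

/-! ### Inverses modulo `N` by the Euclidean algorithm. -/

namespace BitCost
open Enc Finset

/-- One step of the extended Euclidean algorithm for the state `(N, r₀, r₁, t₀, t₁)`. -/
def euclidStep (x : ℤ × (ℤ × ℤ) × (ℤ × ℤ)) : ℤ × (ℤ × ℤ) × (ℤ × ℤ) :=
  (x.1, (x.2.1.2, x.2.1.1 % x.2.1.2),
    (x.2.2.2, (x.2.2.1 - x.2.1.1 / x.2.1.2 * x.2.2.2) % x.1))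

/-- The inverse of `s` modulo `N`. -/
noncomputable def invMod (s N : ℤ) : ℤ :=
  (whileLoop (fun x => decide (¬ x.2.1.2 = 0)) euclidStep (N, (N, s % N), (0, 1))).2.2.1

/-- The invariant of the extended Euclidean algorithm. -/
structure EuclidInv (s N : ℤ) (x : ℤ × (ℤ × ℤ) × (ℤ × ℤ)) : Prop where
  mod : x.1 = N
  nonneg : 0 ≤ x.2.1.2
  lt : x.2.1.2 < x.2.1.1
  le : x.2.1.1 ≤ N
  coprime : IsCoprime s N → IsCoprime x.2.1.1 x.2.1.2
  dvd₀ : N ∣ x.2.2.1 * s - x.2.1.1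
  dvd₁ : N ∣ x.2.2.2 * s - x.2.1.2
  abs₀ : |x.2.2.1| ≤ N
  abs₁ : |x.2.2.2| ≤ N

theorem EuclidInv.init {s N : ℤ} (hN : 0 < N) : EuclidInv s N (N, (N, s % N), (0, 1)) where
  mod := rfl
  nonneg := Int.emod_nonneg _ hN.ne'
  lt := Int.emod_lt_of_pos _ hN
  le := le_rfl
  coprime h := by
    dsimp only
    rw [Int.emod_def, sub_eq_add_neg, ← mul_neg]
    exact (h.symm).add_mul_left_right _
  dvd₀ := by simp
  dvd₁ := by
    dsimp only
    rw [Int.emod_def]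
    exact ⟨s / N, by ring⟩
  abs₀ := by simpa using hN.le
  abs₁ := by rw [abs_one]; omega

theorem EuclidInv.step {s N : ℤ} (hN : 0 < N) {x : ℤ × (ℤ × ℤ) × (ℤ × ℤ)} (h : EuclidInv s N x)
    (hx : ¬ x.2.1.2 = 0) : EuclidInv s N (euclidStep x) := by
  obtain ⟨N', ⟨r₀, r₁⟩, t₀, t₁⟩ := x
  obtain ⟨rfl, h1, h2, h3, h4, h5, h6, h7, h8⟩ := h
  dsimp only at *
  have hr : 0 < r₁ := lt_of_le_of_ne h1 (Ne.symm hx)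
  have ht1 := Int.emod_nonneg (t₀ - r₀ / r₁ * t₁) hN.ne'
  have ht2 := Int.emod_lt_of_pos (t₀ - r₀ / r₁ * t₁) hN
  refine ⟨rfl, Int.emod_nonneg _ hx, Int.emod_lt_of_pos _ hr, by dsimp only [euclidStep]; omega,
    fun h => ?_, h6, ?_, h8, ?_⟩
  · dsimp only [euclidStep]
    rw [Int.emod_def, sub_eq_add_neg, ← mul_neg]
    exact ((h4 h).symm).add_mul_left_right _
  · dsimp only [euclidStep]
    rw [Int.emod_def r₀ r₁, Int.emod_def]
    obtain ⟨u, hu⟩ := h5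
    obtain ⟨v, hv⟩ := h6
    exact ⟨u - r₀ / r₁ * v - (t₀ - r₀ / r₁ * t₁) / N' * s, by
      linear_combination hu - r₀ / r₁ * hv⟩
  · dsimp only [euclidStep]
    rw [abs_of_nonneg ht1]
    exact ht2.le

/-- The product of two consecutive remainders is at least halved: `r₁ < r₀` gives a positive
quotient, whence `r₀ % r₁ ≤ r₀ / 2`. Reducing the cofactors modulo `N` keeps them as short as `N`.
-/
theorem euclid_iterate {s N : ℤ} (hN : 0 < N) :
    ∃ m ≤ 2 * sz N, decide (¬ (euclidStep^[m] (N, (N, s % N), (0, 1))).2.1.2 = 0) = false ∧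
      ∀ i ≤ m, EuclidInv s N (euclidStep^[i] (N, (N, s % N), (0, 1))) := by
  refine exists_iterate_of_potential (EuclidInv s N) (fun x => (x.2.1.1 * x.2.1.2).toNat)
    (c := fun x => decide (¬ x.2.1.2 = 0)) (EuclidInv.init hN)
    (fun x h hc => h.step hN (of_decide_eq_true hc)) (fun x h hc => ?_) (fun x h hc => ?_) ?_
  · have h1 := h.nonneg
    have h2 := h.lt
    have h3 := of_decide_eq_true hc
    have h4 : 0 < x.2.1.2 := by omega
    have := mul_pos (h4.trans h2) h4
    omega
  · have h1 := h.nonneg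
    have h2 := h.lt
    have h3 := of_decide_eq_true hc
    have h4 : 0 < x.2.1.2 := by omega
    have h5 := Int.emod_nonneg x.2.1.1 h3
    have h6 := Int.emod_lt_of_pos x.2.1.1 h4
    have h7 := Int.mul_ediv_add_emod x.2.1.1 x.2.1.2
    have h8 : 1 ≤ x.2.1.1 / x.2.1.2 := by
      rw [Int.le_ediv_iff_mul_le h4]; omega
    have h9 : 2 * (x.2.1.1 % x.2.1.2) ≤ x.2.1.1 := by nlinarith
    have h10 := mul_nonneg h4.le h5
    have h11 : 2 * (x.2.1.2 * (x.2.1.1 % x.2.1.2)) ≤ x.2.1.1 * x.2.1.2 := by nlinarith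
    dsimp only [euclidStep]
    omega
  · dsimp only
    have h1 := abs_lt_two_pow_sz N
    rw [abs_of_pos hN] at h1
    have h2 := Int.emod_nonneg s hN.ne'
    have h3 := Int.emod_lt_of_pos s hN
    have h4 : N * (s % N) < 2 ^ sz N * 2 ^ sz N := by nlinarith
    have h5 : (((N * (s % N)).toNat : ℕ) : ℤ) < ((2 ^ (2 * sz N) : ℕ) : ℤ) := by
      rw [Int.toNat_of_nonneg (by positivity), two_mul, pow_add]
      push_cast
      exact h4
    exact_mod_cast h5

theorem dvd_invMod_mul_sub {s N : ℤ} (hN : 0 < N) (h : IsCoprime s N) :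
    N ∣ invMod s N * s - 1 := by
  obtain ⟨m, -, hm, -⟩ := euclid_iterate (s := s) hN
  obtain ⟨h1, h2⟩ := whileLoop_induction (EuclidInv s N)
    (c := fun x : ℤ × (ℤ × ℤ) × (ℤ × ℤ) => decide (¬ x.2.1.2 = 0)) ⟨m, hm⟩ (EuclidInv.init hN)
    (fun x h hc => h.step hN (of_decide_eq_true hc))
  have h3 := h1.dvd₀
  have h4 := h1.coprime h
  have h5 := h1.lt
  have h6 := h1.nonneg
  have h7 : (whileLoop (fun x : ℤ × (ℤ × ℤ) × (ℤ × ℤ) => decide (¬ x.2.1.2 = 0)) euclidStep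
    (N, (N, s % N), (0, 1))).2.1.2 = 0 := by simpa using h2
  rw [h7] at h4 h5
  rw [isCoprime_zero_right, Int.isUnit_iff] at h4
  rw [h4.resolve_right (by omega)] at h3
  exact h3

/-! ### The lattice of polynomials with a root modulo a power of the divisor, and the list of
divisors. -/

/-- The bound for the distance from the middle of the interval. -/
def halfWidth (s H : ℕ) : ℕ := (H + s - 1) / s + 1

/-- The residue `a` such that `p ∣ y + a` if `p = 1 + s * ((P - 1) / s + y)` divides `N`. -/
noncomputable def shift (N s P : ℕ) : ℤ := (((P - 1) / s : ℕ) + invMod s N) % N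

/-- The basis of the lattice, consisting of the polynomials
`N ^ (m - k / r) * (G * X + a) ^ k`. -/
def basisMat (N r n m : ℕ) (a : ℤ) (G : ℕ) : List (List ℤ) :=
  mat n n fun k t => if t ≤ k then
    powB n N (m - k / r) * (chooseB n k t * powB n a (k - t)) * powB n G t else 0

/-- The coefficients of a polynomial with small values. -/
noncomputable def smallPoly (n : Una) (B : List (List ℤ)) (G : ℕ) : List ℤ :=
  (List.range n.n).map fun t => ent (lll n (initLattice n.n B)) 0 (n.n + t) / powB n.n G t

/-- The list of all integers `p` in the interval from `P - H` to `P + H` such that `p ^ r ∣ N` and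
`p ≡ 1` modulo `s`. -/
noncomputable def divisorList (N s : ℕ) (r n m : Una) (P H : ℕ) : List ℤ :=
  ((rootCandidates n (smallPoly n (basisMat N r.n n.n m.n (shift N s P) (halfWidth s H))
    (halfWidth s H)) (halfWidth s H)).map fun y : ℤ => 1 + (s : ℤ) * ((((P - 1) / s : ℕ) : ℤ) + y)).filter fun p =>
      decide ((P : ℤ) - H ≤ p ∧ p ≤ P + H ∧ N % powB r.n p r.n = 0)

theorem powB_pos {n : ℕ} {x : ℤ} (hx : 0 < x) (e : ℕ) : 0 < powB n x e := by
  rw [powB, prod_map_range]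
  exact prod_pos fun i _ => by split <;> simp [hx]

theorem ent_basisMat {N r n m : ℕ} {a : ℤ} {G k : ℕ} (hk : k < n) (t : ℕ) :
    ent (basisMat N r n m a G) k t = if t ≤ k then
      powB n N (m - k / r) * (k.choose t * powB n a (k - t)) * G ^ t else 0 := by
  rw [basisMat, ent_mat _ _ _ _ hk]
  by_cases ht : t ≤ k
  · rw [if_pos (by omega), if_pos ht, if_pos ht, chooseB_eq (by omega), powB_eq (e := t) (by omega)]
  · rw [if_neg ht, if_neg ht]; simp

theorem ent_basisMat_self {N r n m : ℕ} {a : ℤ} {G k : ℕ} (hk : k < n) :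
    ent (basisMat N r n m a G) k k = powB n N (m - k / r) * G ^ k := by
  rw [ent_basisMat hk, if_pos le_rfl, Nat.sub_self, powB_eq (n := n) (e := 0) (by omega)]
  simp

/-- The vectors `v` with `v t = w t * G ^ t` for which the value at `y` of the polynomial with
coefficients `w` is divisible by `Q`. -/
def rootLattice (n : ℕ) (G Q y : ℤ) : AddSubgroup (ℕ → ℤ) where
  carrier := {v | ∃ w : ℕ → ℤ, (∀ t < n, v t = w t * G ^ t) ∧ Q ∣ ∑ t ∈ range n, w t * y ^ t}
  zero_mem' := ⟨0, by simp⟩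
  add_mem' := by
    rintro v v' ⟨w, h1, h2⟩ ⟨w', h1', h2'⟩
    refine ⟨w + w', fun t ht => ?_, ?_⟩
    · simp only [Pi.add_apply, h1 t ht, h1' t ht]; ring
    · simp only [Pi.add_apply, add_mul, sum_add_distrib]
      exact dvd_add h2 h2'
  neg_mem' := by
    rintro v ⟨w, h1, h2⟩
    refine ⟨-w, fun t ht => ?_, ?_⟩
    · simp only [Pi.neg_apply, h1 t ht]; ring
    · simp only [Pi.neg_apply, neg_mul, sum_neg_distrib]
      exact (dvd_neg).2 h2

/-- The value of the `k`-th polynomial at `y` is `N ^ (m - k / r) * (y + a) ^ k`. It is divisible by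
`p` to the power `r * (m - k / r) + k`, and this exponent is at least `r * m` because `r * (k / r) ≤
k`. -/
theorem basisMat_mem {N r n m : ℕ} {a : ℤ} {G k : ℕ} (hk : k < n) (hm : m ≤ n)
    {p y : ℤ} (hp : p ^ r ∣ N) (hy : p ∣ y + a) :
    ent (basisMat N r n m a G) k ∈ rootLattice n G (p ^ (r * m)) y := by
  refine ⟨fun t => if t ≤ k then (N : ℤ) ^ (m - k / r) * (k.choose t * a ^ (k - t)) else 0,
    fun t _ => ?_, ?_⟩
  · rw [ent_basisMat hk]
    dsimp only
    by_cases ht : t ≤ k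
    · rw [if_pos ht, if_pos ht, powB_eq (n := n) (e := m - k / r) ((Nat.sub_le _ _).trans hm),
        powB_eq (n := n) (e := k - t) (by omega)]
    · rw [if_neg ht, if_neg ht]; simp
  · have h1 : ∑ t ∈ range n, (if t ≤ k then (N : ℤ) ^ (m - k / r) * (k.choose t * a ^ (k - t))
        else 0) * y ^ t = (N : ℤ) ^ (m - k / r) * (y + a) ^ k := by
      rw [← sum_subset (range_subset_range.2 (show k + 1 ≤ n by omega)) (fun t _ ht => by
        rw [if_neg (by simpa using ht), zero_mul]), add_pow, mul_sum]
      refine sum_congr rfl fun t ht => ?_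
      rw [if_pos (by have := mem_range.1 ht; omega)]
      ring
    rw [h1]
    have h2 : r * m ≤ r * (m - k / r) + k := by
      have h3 := Nat.mul_div_le k r
      have h4 : m ≤ (m - k / r) + k / r := by omega
      have := Nat.mul_le_mul_left r h4
      rw [mul_add] at this
      omega
    refine (pow_dvd_pow p h2).trans ?_
    rw [pow_add, pow_mul]
    exact mul_dvd_mul (pow_dvd_pow_of_dvd hp _) (pow_dvd_pow_of_dvd hy _)

/-- The lattice is a parameter: `rootLattice` gives correctness, and the full group gives the
running time on inputs to which the hypotheses of the theorem need not apply. For the same reason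
`powB` is left unevaluated; it is positive even when it truncates. -/
theorem latticeData_basisMat {N r n m : ℕ} {a : ℤ} {G : ℕ} (hN : 0 < N) (hG : 0 < G)
    {L : AddSubgroup (ℕ → ℤ)} (hL : ∀ k < n, ent (basisMat N r n m a G) k ∈ L) :
    LatticeData n L (initLattice n (basisMat N r n m a G)) ∧
      ∀ i < n, ent (initLattice n (basisMat N r n m a G)) i i =
        ∏ c ∈ range (i + 1), (powB n N (m - c / r) * G ^ c) ^ 2 := by
  have h := latticeData_initLattice (n := n) (B := basisMat N r n m a G) (L := L)
    (fun i hi j hij => by rw [ent_basisMat hi, if_neg (by omega)])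
    (fun i hi => by
      rw [ent_basisMat_self hi]
      exact mul_pos (powB_pos (by exact_mod_cast hN) _) (pow_pos (by exact_mod_cast hG) _)) hL
  refine ⟨h.1, fun i hi => ?_⟩
  rw [h.2 i hi]
  refine prod_congr rfl fun c hc => ?_
  rw [ent_basisMat_self (by have := mem_range.1 hc; omega)]

/-- The exponents of `N` in the determinant of the lattice. -/
theorem sum_sub_div {r m n : ℕ} (hr : 0 < r) (h : r * m ≤ n) :
    2 * ∑ c ∈ range n, (m - c / r) = r * m * (m + 1) := by
  have h1 : ∑ c ∈ range n, (m - c / r) = ∑ c ∈ range (r * m), (m - c / r) := by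
    refine (sum_subset (range_subset_range.2 h) fun c _ hc => ?_).symm
    have h2 : r * m ≤ c := by simpa using hc
    have : m ≤ c / r := by rw [Nat.le_div_iff_mul_le hr]; linarith
    omega
  rw [h1]
  clear h h1
  induction m with
  | zero => simp
  | succ m ih =>
    -- The first `r` terms are all `m + 1`, and the remaining ones form the sum for `m`.
    rw [mul_add, mul_one, add_comm (r * m) r, sum_range_add]
    have h2 : ∑ x ∈ range r, (m + 1 - x / r) = r * (m + 1) := by
      rw [sum_congr rfl fun x hx => by rw [Nat.div_eq_of_lt (mem_range.1 hx), Nat.sub_zero]]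
      simp
    have h3 : ∑ x ∈ range (r * m), (m + 1 - (r + x) / r) = ∑ x ∈ range (r * m), (m - x / r) := by
      refine sum_congr rfl fun x _ => ?_
      rw [Nat.add_div_left _ hr]; omega
    rw [h2, h3, mul_add, ih]
    ring

/-- The size condition, with all exponents cleared. -/
theorem size_condition {N r d m P H G : ℕ} (hN : 0 < N) (hd : 0 < d)
    (h : (G : ℝ) ^ (((d : ℝ) - 1) / 2) <
          1 / ((d : ℝ) ^ ((1 : ℝ) / 2) * (2 : ℝ) ^ (((d : ℝ) - 1) / 4)) *
            (((P : ℝ) - (H : ℝ)) ^ (r * m) /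
              (N : ℝ) ^ ((r : ℝ) * (m : ℝ) * ((m : ℝ) + 1) / (2 * (d : ℝ))))) :
    (d : ℤ) ^ d * (2 ^ (∑ i ∈ range d, i) * (N ^ (r * m * (m + 1)) * G ^ (2 * ∑ i ∈ range d, i))) <
      (((P : ℤ) - H) ^ (r * m)) ^ (2 * d) := by
  have hd' : (0 : ℝ) < d := by exact_mod_cast hd
  have hN' : (0 : ℝ) < N := by exact_mod_cast hN
  have hsum : ((∑ i ∈ range d, i : ℕ) : ℝ) = d * (d - 1) / 2 := by
    have := sum_range_id_mul_two d
    have h2 : ((∑ i ∈ range d, i : ℕ) : ℝ) * 2 = d * (d - 1) := by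
      rw [← Nat.cast_pred hd]; exact_mod_cast this
    linarith
  have hA : (0 : ℝ) < (d : ℝ) ^ ((1 : ℝ) / 2) := by positivity
  have hB : (0 : ℝ) < (2 : ℝ) ^ (((d : ℝ) - 1) / 4) := by positivity
  have hC : (0 : ℝ) < (N : ℝ) ^ ((r : ℝ) * (m : ℝ) * ((m : ℝ) + 1) / (2 * (d : ℝ))) := by positivity
  have hG : (0 : ℝ) ≤ (G : ℝ) ^ (((d : ℝ) - 1) / 2) := by positivity
  have h1 : (G : ℝ) ^ (((d : ℝ) - 1) / 2) * ((d : ℝ) ^ ((1 : ℝ) / 2) *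
      (2 : ℝ) ^ (((d : ℝ) - 1) / 4)) *
      (N : ℝ) ^ ((r : ℝ) * (m : ℝ) * ((m : ℝ) + 1) / (2 * (d : ℝ))) <
      ((P : ℝ) - (H : ℝ)) ^ (r * m) := by
    rw [one_div_mul_eq_div, lt_div_iff₀ (by positivity), lt_div_iff₀ hC] at h
    exact h
  -- The power `2 * d` clears all fractional exponents at once.
  have h2 := pow_lt_pow_left₀ h1 (by positivity) (show 2 * d ≠ 0 by omega)
  have hpow : ∀ {x e : ℝ}, 0 ≤ x → ∀ k : ℕ, e * (2 * d) = k → (x ^ e) ^ (2 * d) = x ^ k := by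
    intro x e hx k hk
    rw [← Real.rpow_natCast (x ^ e), ← Real.rpow_mul hx, ← Real.rpow_natCast]
    congr 1
    push_cast
    exact hk
  rw [mul_pow, mul_pow, mul_pow,
    hpow (Nat.cast_nonneg G) (2 * ∑ i ∈ range d, i) (by push_cast at hsum ⊢; rw [hsum]; ring),
    hpow hd'.le d (by ring),
    hpow zero_le_two (∑ i ∈ range d, i) (by rw [hsum]; ring),
    hpow hN'.le (r * m * (m + 1)) (by push_cast; field_simp)] at h2
  have h3 : (((d : ℤ) ^ d * (2 ^ (∑ i ∈ range d, i) * (N ^ (r * m * (m + 1)) *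
      G ^ (2 * ∑ i ∈ range d, i))) : ℤ) : ℝ) < (((((P : ℤ) - H) ^ (r * m)) ^ (2 * d) : ℤ) : ℝ) := by
    push_cast at h2 ⊢
    refine lt_of_eq_of_lt ?_ h2
    ring
  exact_mod_cast h3

theorem getD_smallPoly {n : Una} {B : List (List ℤ)} {G t : ℕ} (ht : t < n.n) :
    (smallPoly n B G).getD t 0 = ent (lll n (initLattice n.n B)) 0 (n.n + t) / G ^ t := by
  rw [smallPoly, getD_map_range, if_pos ht, powB_eq ht.le]

/-- The lattice `rootLattice` depends on the unknown `p` and `y`, but the basis and hence the output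
of LLL do not. The same short vector therefore lies in the lattice of every admissible `p`. Its
polynomial has at `y` a value divisible by `p ^ (r * m)` and smaller in absolute value, hence zero.
-/
theorem smallPoly_spec {N r m : ℕ} {n : Una} {a : ℤ} {G : ℕ} (hN : 0 < N) (hG : 0 < G)
    (hn : 0 < n.n) (hr : 0 < r) (hrm : r * m ≤ n.n) {q : ℤ} (hq : 0 < q)
    (hsize : (n.n : ℤ) ^ n.n * (2 ^ (∑ i ∈ range n.n, i) *
      (N ^ (r * m * (m + 1)) * G ^ (2 * ∑ i ∈ range n.n, i))) < (q ^ (r * m)) ^ (2 * n.n))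
    {p y : ℤ} (hqp : q ≤ p) (hp : p ^ r ∣ N) (hy : p ∣ y + a) (hyG : |y| ≤ G) :
    (∃ t < n.n, (smallPoly n (basisMat N r n.n m a G) G).getD t 0 ≠ 0) ∧
      evalB n.n (smallPoly n (basisMat N r n.n m a G) G) y = 0 := by
  have hmn : m ≤ n.n := (Nat.le_mul_of_pos_left m hr).trans hrm
  have hG' : (0 : ℤ) < G := by exact_mod_cast hG
  obtain ⟨hdata, hdiag⟩ := latticeData_basisMat (a := a) (r := r) (m := m) hN hG
    (fun k hk => basisMat_mem (G := G) hk hmn hp hy)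
  set B := basisMat N r n.n m a G with hB
  obtain ⟨⟨w, hw, hdvd⟩, hpos, hle⟩ := lll_short hdata
    (Dn := ent (initLattice n.n B) (n.n - 1) (n.n - 1)) (fun i hi => by rw [← hi]; simp) hn
  set v : ℕ → ℤ := fun t => ent (lll n (initLattice n.n B)) 0 (n.n + t) with hv
  have hget : ∀ t < n.n, (smallPoly n B G).getD t 0 = w t := by
    intro t ht
    rw [getD_smallPoly ht]
    rw [show ent (lll n (initLattice n.n B)) 0 (n.n + t) = w t * G ^ t from hw t ht]
    exact Int.mul_ediv_cancel _ (pow_pos hG' t).ne'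
  have hDn : ent (initLattice n.n B) (n.n - 1) (n.n - 1) =
      N ^ (r * m * (m + 1)) * G ^ (2 * ∑ i ∈ range n.n, i) := by
    rw [hdiag (n.n - 1) (by omega), Nat.sub_add_cancel hn, ← sum_sub_div hr hrm, prod_pow,
      prod_mul_distrib, mul_pow, prod_pow_eq_pow_sum, pow_mul', pow_mul',
      prod_congr rfl fun c _ => powB_eq (n := n.n) (e := m - c / r) ((Nat.sub_le _ _).trans hmn) _,
      prod_pow_eq_pow_sum]
  rw [hDn] at hle
  have hcs : (∑ t ∈ range n.n, |v t|) ^ 2 ≤ n.n * ∑ t ∈ range n.n, v t ^ 2 := by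
    have := sq_sum_le_card_mul_sum_sq (s := range n.n) (f := fun t => |v t|)
    simpa using this
  -- Cauchy–Schwarz contributes the factor `n ^ n` after raising to the power `2 * n`; the LLL bound
  -- supplies the rest of the left side of `hsize`.
  have hlt : ∑ t ∈ range n.n, |v t| < q ^ (r * m) := by
    refine lt_of_pow_lt_pow_left₀ (2 * n.n) (by positivity) ?_
    rw [pow_mul]
    refine (pow_le_pow_left₀ (sq_nonneg _) hcs n.n).trans_lt ?_
    rw [mul_pow]
    exact (mul_le_mul_of_nonneg_left hle (by positivity)).trans_lt hsize
  constructor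
  · by_contra! hall
    refine hpos.ne' (sum_eq_zero fun t ht => ?_)
    have ht := mem_range.1 ht
    have h1 := hall t ht
    rw [hget t ht] at h1
    have := hw t ht
    rw [show ent (lll n (initLattice n.n B)) 0 (n.n + t) = w t * G ^ t from this, h1]; simp
  · have heval : evalB n.n (smallPoly n B G) y = ∑ t ∈ range n.n, w t * y ^ t := by
      rw [evalB_eq]
      exact sum_congr rfl fun t ht => by rw [hget t (mem_range.1 ht)]
    rw [heval]
    -- As `|y| ≤ G`, the scaling by `G ^ t` makes the sum of the `|v t|` a bound for the value at
    -- `y`.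
    refine Int.eq_zero_of_abs_lt_dvd hdvd ?_
    calc |∑ t ∈ range n.n, w t * y ^ t| ≤ ∑ t ∈ range n.n, |w t * y ^ t| := abs_sum_le_sum_abs _ _
      _ ≤ ∑ t ∈ range n.n, |v t| := by
        refine sum_le_sum fun t ht => ?_
        rw [show v t = _ from hw t (mem_range.1 ht), abs_mul, abs_mul, abs_pow, abs_pow, abs_of_pos hG']
        exact mul_le_mul_of_nonneg_left (pow_le_pow_left₀ (abs_nonneg _) hyG t) (abs_nonneg _)
      _ < q ^ (r * m) := hlt
      _ ≤ p ^ (r * m) := pow_le_pow_left₀ hq.le hqp _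

/-- The final filter removes every false candidate, so only completeness needs the lattice: the
offset `y` of a true divisor is shown to be a small root of the polynomial found by LLL. -/
theorem mem_divisorList {N s r d m P H : ℕ} (hN : 0 < N) (hs : 0 < s) (hNs : Nat.gcd N s = 1)
    (hr : 0 < r) (hd : 0 < d) (hrm : r * m ≤ d) (hHP : H < P)
    (hsize : (d : ℤ) ^ d * (2 ^ (∑ i ∈ range d, i) * (N ^ (r * m * (m + 1)) *
      (halfWidth s H) ^ (2 * ∑ i ∈ range d, i))) < (((P : ℤ) - H) ^ (r * m)) ^ (2 * d)) (p : ℤ) :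
    p ∈ divisorList N s ⟨r⟩ ⟨d⟩ ⟨m⟩ P H ↔ (P : ℤ) - (H : ℤ) ≤ p ∧ p ≤ (P : ℤ) + (H : ℤ) ∧
      p ^ r ∣ (N : ℤ) ∧ p ≡ 1 [ZMOD (s : ℤ)] := by
  rw [divisorList, List.mem_filter, decide_eq_true_eq, List.mem_map]
  dsimp only
  rw [powB_eq le_rfl, ← Int.dvd_iff_emod_eq_zero]
  constructor
  · rintro ⟨⟨y, -, rfl⟩, h1, h2, h3⟩
    refine ⟨h1, h2, h3, ?_⟩
    exact Int.ModEq.symm ((Int.modEq_iff_dvd).2 ⟨_, add_sub_cancel_left _ _⟩)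
  · rintro ⟨h1, h2, h3, h4⟩
    refine ⟨?_, h1, h2, h3⟩
    obtain ⟨x, hx⟩ := (Int.modEq_iff_dvd).1 h4.symm
    set x₀ := (P - 1) / s with hx₀
    have hs' : (0 : ℤ) < s := by exact_mod_cast hs
    refine ⟨x - x₀, ?_, by rw [show (s : ℤ) * (x₀ + (x - x₀)) = s * x by ring, ← hx]; ring⟩
    have hpN : p ∣ N := (dvd_pow_self p hr.ne').trans h3
    have hcop : IsCoprime (s : ℤ) N := by
      rw [Int.isCoprime_iff_gcd_eq_one, Int.gcd_natCast_natCast, Nat.gcd_comm]; exact hNs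
    have hdvd : p ∣ (x - x₀) + shift N s P := by
      have h5 : p ∣ s * ((x - x₀) + shift N s P) := by
        have h6 := dvd_invMod_mul_sub (by exact_mod_cast hN) hcop
        -- Modulo `N` the shift is `x₀ + s⁻¹`, so the product is `s * x + 1 = p`. The last term
        -- accounts for the reduction modulo `N`.
        have h7 : (s : ℤ) * ((x - x₀) + shift N s P) =
            p + (invMod s N * s - 1) - N * (s * ((x₀ + invMod s N) / N)) := by
          rw [shift, Int.emod_def, ← hx₀]
          linear_combination -hx
        rw [h7]
        exact dvd_sub (dvd_add dvd_rfl (hpN.trans h6)) (hpN.mul_right _)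
      refine IsCoprime.dvd_of_dvd_mul_left ?_ h5
      -- The equation `p = 1 + s * x` is itself a Bézout relation for `p` and `s`.
      exact ⟨1, -x, by linear_combination hx⟩
    -- Here `s * x₀` lies within less than `s` below or at `P - 1`, so `s * (x - x₀)` is at least
    -- `-H` and less than `H + s`. Both bounds place `x - x₀` between `-c` and `c`, where `c` is `H
    -- / s` rounded up.
    have hyG : |x - x₀| ≤ (halfWidth s H : ℕ) := by
      have e1 := Nat.div_add_mod (P - 1) s
      have e2 := Nat.mod_lt (P - 1) hs
      rw [← hx₀] at e1
      have e3 := Nat.div_add_mod (H + s - 1) s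
      have e4 := Nat.mod_lt (H + s - 1) hs
      set c := (H + s - 1) / s with hc
      have e5 : (s : ℤ) * x₀ ≤ P - 1 ∧ (P : ℤ) - 1 < s * x₀ + s := by
        constructor
        · have : s * x₀ + 1 ≤ P := by omega
          have : ((s * x₀ + 1 : ℕ) : ℤ) ≤ P := by exact_mod_cast this
          push_cast at this; linarith
        · have : P < s * x₀ + s + 1 := by omega
          have : (P : ℤ) < ((s * x₀ + s + 1 : ℕ) : ℤ) := by exact_mod_cast this
          push_cast at this; linarith
      have e6 : (H : ℤ) ≤ s * c ∧ (H : ℤ) + s - 1 < s * c + s := by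
        constructor
        · have : H ≤ s * c := by omega
          exact_mod_cast this
        · have : H + s < s * c + s + 1 := by omega
          have : ((H + s : ℕ) : ℤ) < ((s * c + s + 1 : ℕ) : ℤ) := by exact_mod_cast this
          push_cast at this; linarith
      have e7 : x - x₀ ≤ c := by
        by_contra! hlt
        nlinarith
      have e8 : -(c : ℤ) ≤ x - x₀ := by
        by_contra! hlt
        nlinarith
      rw [halfWidth, ← hc, abs_le]
      push_cast
      omega
    obtain ⟨hw, hroot⟩ := smallPoly_spec (n := ⟨d⟩) (a := shift N s P) (G := halfWidth s H) hN
      (Nat.succ_pos _) hd hr hrm (q := (P : ℤ) - H) (by omega) hsize h1 h3 hdvd hyG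
    exact mem_rootCandidates (n := ⟨d⟩) hw hyG hroot

namespace PT
variable {γ : Type*} [Enc γ]

theorem invMod {s N : γ → ℤ} (hs : PT s) (hN : PT N) (h : ∀ g, 0 < N g) :
    PT fun g => invMod (s g) (N g) := by
  unfold BitCost.invMod
  refine PT.fst (PT.snd (PT.snd (PT.whileLoop
    (init := fun g => (N g, (N g, s g % N g), ((0 : ℤ), (1 : ℤ)))) (n := fun g => 2 * sz (N g))
    (w := fun g => 5 * sz (N g) + 4) (by fun_prop) (by unfold euclidStep; fun_prop) (by fun_prop)
    ((PB.const 2).mul hN.pb) (((PB.const 5).mul hN.pb).add (PB.const 4)) fun g => ?_)))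
  obtain ⟨m, hm, hc, hI⟩ := euclid_iterate (s := s g) (h g)
  refine ⟨m, hm, hc, fun i hi => ?_⟩
  obtain ⟨h1, h2, h3, h4, -, -, -, h5, h6⟩ := hI i hi
  have h0 : ∀ {y : ℤ}, |y| ≤ N g → sz y ≤ sz (N g) := fun hy =>
    sz_int_mono (by rwa [abs_of_pos (h g)])
  have h7 := h0 h5
  have h8 := h0 h6
  have h9 := h0 (y := (euclidStep^[i] (N g, (N g, s g % N g), (0, 1))).2.1.1)
    (by rw [abs_of_nonneg (by omega)]; exact h4)
  have h10 := h0 (y := (euclidStep^[i] (N g, (N g, s g % N g), (0, 1))).2.1.2)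
    (by rw [abs_of_nonneg h2]; omega)
  rw [sz_prod, sz_prod (euclidStep^[i] _).2, sz_prod (euclidStep^[i] _).2.1,
    sz_prod (euclidStep^[i] _).2.2, h1]
  omega

@[fun_prop]
theorem halfWidth {s H : γ → ℕ} (hs : PT s) (hH : PT H) : PT fun g => halfWidth (s g) (H g) := by
  unfold BitCost.halfWidth; fun_prop

theorem shift {N s P : γ → ℕ} (hN : PT N) (hs : PT s) (hP : PT P) (h : ∀ g, 0 < N g) :
    PT fun g => shift (N g) (s g) (P g) := by
  unfold BitCost.shift
  have := PT.invMod (s := fun g => (s g : ℤ)) (N := fun g => (N g : ℤ)) (by fun_prop)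
    (by fun_prop) (fun g => by exact_mod_cast h g)
  fun_prop

@[fun_prop]
theorem basisMat {N G : γ → ℕ} {r n m : γ → Una} {a : γ → ℤ} (hN : PT N) (hr : PT r) (hn : PT n)
    (hm : PT m) (ha : PT a) (hG : PT G) :
    PT fun g => basisMat (N g) (r g).n (n g).n (m g).n (a g) (G g) := by
  unfold BitCost.basisMat
  refine PT.mat (f := fun g k t => if t ≤ k then
    BitCost.powB (n g).n (N g) ((m g).n - k / (r g).n) * (BitCost.chooseB (n g).n k t *
      BitCost.powB (n g).n (a g) (k - t)) * BitCost.powB (n g).n (G g) t else 0) hn hn ?_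
  fun_prop

theorem smallPoly {n : γ → Una} {B : γ → List (List ℤ)} {G : γ → ℕ} (hn : PT n) (hB : PT B)
    (hG : PT G) (h : ∀ g, ∃ L, LatticeData (n g).n L (BitCost.initLattice (n g).n (B g))) :
    PT fun g => smallPoly (n g) (B g) (G g) := by
  have hl : PT fun g => BitCost.lll (n g) (BitCost.initLattice (n g).n (B g)) :=
    PT.lll hn (by fun_prop) h
  have hl' : PT fun x : γ × ℕ => BitCost.lll (n x.1) (BitCost.initLattice (n x.1).n (B x.1)) :=
    hl.comp (f := fun x : γ × ℕ => x.1) (by fun_prop)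
  unfold BitCost.smallPoly
  refine PT.map (f := fun g t => BitCost.ent (BitCost.lll (n g) (BitCost.initLattice (n g).n (B g)))
    0 ((n g).n + t) / BitCost.powB (n g).n (G g) t) (by fun_prop) ?_
  fun_prop

theorem divisorList {N s P H : γ → ℕ} {r n m : γ → Una} (hN : PT N) (hs : PT s) (hr : PT r)
    (hn : PT n) (hm : PT m) (hP : PT P) (hH : PT H) (h : ∀ g, 0 < N g) :
    PT fun g => divisorList (N g) (s g) (r g) (n g) (m g) (P g) (H g) := by
  have ha := PT.shift hN hs hP h
  have hw := PT.smallPoly (B := fun g => BitCost.basisMat (N g) (r g).n (n g).n (m g).n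
      (BitCost.shift (N g) (s g) (P g)) (BitCost.halfWidth (s g) (H g)))
    (G := fun g => BitCost.halfWidth (s g) (H g)) hn (by fun_prop) (by fun_prop)
    fun g => ⟨⊤, (latticeData_basisMat (h g) (Nat.succ_pos _) fun _ _ => AddSubgroup.mem_top _).1⟩
  unfold BitCost.divisorList
  refine PT.filter (P := fun g p => decide ((P g : ℤ) - H g ≤ p ∧ p ≤ P g + H g ∧
      N g % BitCost.powB (r g).n p (r g).n = 0))
    (PT.map (f := fun g y => 1 + (s g : ℤ) * ((((P g - 1) / s g : ℕ) : ℤ) + y))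
      (PT.rootCandidates hn hw (by fun_prop)) ?_) ?_ <;> fun_prop

end PT

open Polynomial in
theorem eval_le_mul_pow (b : ℕ[X]) {x : ℕ} (hx : 1 ≤ x) :
    b.eval x ≤ b.eval 1 * x ^ b.natDegree := by
  rw [eval_eq_sum_range, eval_eq_sum_range, sum_mul]
  refine sum_le_sum fun i hi => ?_
  rw [one_pow, mul_one]
  exact Nat.mul_le_mul_left _ (Nat.pow_le_pow_right hx (by have := mem_range.1 hi; omega))

theorem bitLen_le_logb {n N : ℕ} (hn : n ≤ N) :
    (bitLen n : ℝ) ≤ Real.logb 2 N + 2 := by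
  have h1 : bitLen n ≤ Nat.log 2 N + 2 := by
    rw [show Nat.log 2 N + 2 = (Nat.log 2 N + 1) + 1 from rfl, bitLen_le_iff]
    simpa using hn.trans_lt (Nat.lt_pow_succ_log_self (by norm_num) N)
  have h2 : (Nat.log 2 N : ℝ) ≤ Real.logb 2 N := by
    have := Real.natLog_le_logb N 2
    exact_mod_cast this
  have h3 : (bitLen n : ℝ) ≤ ((Nat.log 2 N + 2 : ℕ) : ℝ) := by exact_mod_cast h1
  push_cast at h3
  linarith

end BitCost

/-! ### The final program, its running time in `d` and `log N`, and the theorem. -/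

namespace BitCost
open Enc

theorem ceil_div_add_one_eq_halfWidth {s : ℕ} (hs : 0 < s) (H : ℕ) :
    ⌈(H : ℝ) / (s : ℝ)⌉₊ + 1 = halfWidth s H := by
  have hs' : (0 : ℝ) < s := by exact_mod_cast hs
  rw [halfWidth, Nat.add_right_cancel_iff]
  refine eq_of_forall_ge_iff fun c => ?_
  rw [Nat.ceil_le, div_le_iff₀ hs', ← Nat.lt_add_one_iff, Nat.div_lt_iff_lt_mul hs, add_mul]
  constructor
  · intro h
    have : H ≤ c * s := by exact_mod_cast h
    omega
  · intro h
    have : H ≤ c * s := by omega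
    exact_mod_cast this

/-- The program which answers directly if `N < s` and calls `main` otherwise. -/
def topProg (main : Prog) : Prog :=
  .cond (.op .lt (.var 0) (.var 1))
    (.cond (.op .lt (.const 1) (.op .sub (.var 5) (.var 6)))
      (.const 0) (.pair (.const 1) (.const 0)))
    (.call main (.pair (.var 0) (.pair (.var 1) (.pair (.var 2) (.pair (.var 3) (.pair (.var 4)
      (.pair (.var 5) (.var 6))))))))

/-- The number `s` may be far longer than `N`. A comparison costs only the length of the shorter
number, so this branch takes time independent of `s`. The only candidate is `1`, and it lies in the
interval unless `1 < P - H`. -/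
theorem topProg_eval_of_lt (main : Prog) {N s : ℕ} (r d m P H : ℕ) (h : N < s) :
    ∃ t ≤ bitLen N + bitLen P + bitLen H + 20,
      (topProg main).Eval ([N, s, r, d, m, P, H].map fun n : ℕ => Val.int (n : ℤ))
        (Val.ofList (if (1 : ℤ) < P - H then [] else [1])) t := by
  have h1 : Op.apply .lt (N : ℤ) s ≠ 0 := by simp [Op.apply, h]
  have h2 : Op.cost .lt (N : ℤ) s ≤ bitLen N := min_le_left _ _
  have h3 : Op.cost .lt 1 (Op.apply .sub (P : ℤ) H) ≤ 2 := (min_le_left _ _).trans (by simp [bitLen])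
  have h4 : Op.cost .sub (P : ℤ) H = bitLen P + bitLen H := rfl
  by_cases hPH : (1 : ℤ) < P - H
  · rw [if_pos hPH]
    refine ⟨_, ?_, .cond_true (.op (.var rfl) (.var rfl)) h1 (.cond_true
      (.op .const (.op (.var rfl) (.var rfl))) (ne_of_eq_of_ne (if_pos hPH) one_ne_zero)
      .const)⟩
    omega
  · rw [if_neg hPH]
    have h5 : Op.apply .lt 1 (Op.apply .sub (P : ℤ) H) = 0 := if_neg hPH
    have h6 : (Prog.op .lt (.const 1) (.op .sub (.var 5) (.var 6))).Eval
        ([N, s, r, d, m, P, H].map fun n : ℕ => Val.int (n : ℤ)) (.int 0)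
        (1 + (1 + 1 + Op.cost .sub (P : ℤ) H + 1) + Op.cost .lt 1 (Op.apply .sub (P : ℤ) H) + 1) := by
      rw [← h5]
      exact .op .const (.op (.var rfl) (.var rfl))
    refine ⟨_, ?_, .cond_true (.op (.var rfl) (.var rfl)) h1 (.cond_false h6 (.pair .const .const))⟩
    omega

theorem topProg_eval_of_le {main : Prog} {N s r d m P H t : ℕ} {v : Val} (h : s ≤ N)
    (hmain : main.Eval [enc (N, s, Una.mk r, Una.mk d, Una.mk m, P, H)] v t) :
    ∃ t' ≤ t + bitLen N + 20,
      (topProg main).Eval ([N, s, r, d, m, P, H].map fun n : ℕ => Val.int (n : ℤ)) v t' := by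
  have h1 : Op.apply .lt (N : ℤ) s = 0 := by simp [Op.apply, h]
  have h2 : Op.cost .lt (N : ℤ) s ≤ bitLen N := min_le_left _ _
  have h3 : (Prog.op .lt (.var 0) (.var 1)).Eval
      ([N, s, r, d, m, P, H].map fun n : ℕ => Val.int (n : ℤ)) (.int 0)
      (1 + 1 + Op.cost .lt (N : ℤ) s + 1) := by
    rw [← h1]
    exact .op (.var rfl) (.var rfl)
  refine ⟨_, ?_, .cond_false h3 (.call (.pair (.var rfl) (.pair (.var rfl) (.pair (.var rfl)
    (.pair (.var rfl) (.pair (.var rfl) (.pair (.var rfl) (.var rfl))))))) hmain)⟩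
  omega

theorem eq_one_of_dvd_of_lt {N s r : ℕ} {p : ℤ} (hN : 0 < N) (hr : 0 < r) (h : N < s) (hp : 0 < p)
    (h1 : p ^ r ∣ N) (h2 : p ≡ 1 [ZMOD s]) : p = 1 := by
  have h3 : p ≤ N := Int.le_of_dvd (by exact_mod_cast hN) ((dvd_pow_self p hr.ne').trans h1)
  have h4 : (N : ℤ) < s := by exact_mod_cast h
  have h5 := Int.eq_zero_of_abs_lt_dvd h2.symm.dvd (by rw [abs_of_nonneg (by omega)]; omega)
  omega

theorem mem_ite_iff {N s r P H : ℕ} (hN : 0 < N) (hr : 0 < r) (h : N < s) (hHP : H < P) (p : ℤ) :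
    p ∈ (if (1 : ℤ) < P - H then [] else [1] : List ℤ) ↔
      (P : ℤ) - H ≤ p ∧ p ≤ P + H ∧ p ^ r ∣ (N : ℤ) ∧ p ≡ 1 [ZMOD s] := by
  constructor
  · split_ifs with hPH
    · simp
    · intro hp
      rw [List.mem_singleton] at hp
      subst hp
      exact ⟨by omega, by omega, by simp, rfl⟩
  · rintro ⟨h1, -, h2, h3⟩
    have := eq_one_of_dvd_of_lt hN hr h (by omega) h2 h3
    rw [if_neg (by omega), this, List.mem_singleton]

/-- The four binary numbers contribute at most `4 * x + 8`, the three unary ones at most `x + 2 * d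
+ 3`, and the six pairs `6`. The total `5 * x + 2 * d + 17` is at most `24 * d * x` since `d` and
`x` are at least one. -/
theorem sz_input_le {N s r d m P H : ℕ} {x : ℝ} (hx : x = Real.logb 2 N) (h1 : 1 ≤ x) (hs : s ≤ N)
    (hr : (r : ℝ) ≤ x) (hd : 0 < d) (hm : m ≤ d) (hP : P ≤ N) (hH : H ≤ N) :
    (sz (N, s, Una.mk r, Una.mk d, Una.mk m, P, H) : ℝ) ≤ 24 * d * x := by
  have e1 := bitLen_le_logb le_rfl (n := N)
  have e2 := bitLen_le_logb hs
  have e3 := bitLen_le_logb hP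
  have e4 := bitLen_le_logb hH
  have hd' : (1 : ℝ) ≤ d := by exact_mod_cast hd
  have hm' : (m : ℝ) ≤ d := by exact_mod_cast hm
  simp only [sz_prod, sz_nat, sz_una]
  push_cast
  nlinarith

theorem time_le {b : Polynomial ℕ} {w d t e : ℕ} {x : ℝ} (h1 : 1 ≤ x) (hw : 1 ≤ w) (hd : 0 < d)
    (hwd : (w : ℝ) ≤ 24 * d * x) (he : (e : ℝ) ≤ 30 * x) (ht : t ≤ b.eval w + e) :
    (t : ℝ) ≤ ((b.eval 1 * 24 ^ b.natDegree + 30 : ℕ) : ℝ) * (d : ℝ) ^ (b.natDegree + 1) *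
      x ^ (b.natDegree + 1) := by
  have hd' : (1 : ℝ) ≤ d := by exact_mod_cast hd
  have h2 : (t : ℝ) ≤ b.eval 1 * (24 * d * x) ^ b.natDegree + 30 * x := by
    have h3 : (t : ℝ) ≤ b.eval 1 * (w : ℝ) ^ b.natDegree + e := by
      exact_mod_cast ht.trans (Nat.add_le_add_right (eval_le_mul_pow b hw) e)
    have h4 : (w : ℝ) ^ b.natDegree ≤ (24 * d * x) ^ b.natDegree :=
      pow_le_pow_left₀ (Nat.cast_nonneg _) hwd _
    have := mul_le_mul_of_nonneg_left h4 (Nat.cast_nonneg (α := ℝ) (b.eval 1))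
    linarith
  have h5 : (1 : ℝ) ≤ d * x := one_le_mul_of_one_le_of_one_le hd' h1
  have h6 : ((d : ℝ) * x) ^ b.natDegree ≤ (d * x) ^ (b.natDegree + 1) :=
    pow_le_pow_right₀ h5 (Nat.le_succ _)
  have h7 : x ≤ (d * x) ^ (b.natDegree + 1) :=
    (le_mul_of_one_le_left (by linarith) hd').trans (le_self_pow₀ h5 (Nat.succ_ne_zero _))
  have h8 : (0 : ℝ) ≤ b.eval 1 * 24 ^ b.natDegree := by positivity
  calc (t : ℝ) ≤ b.eval 1 * (24 * d * x) ^ b.natDegree + 30 * x := h2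
    _ = b.eval 1 * 24 ^ b.natDegree * (d * x) ^ b.natDegree + 30 * x := by
      rw [mul_assoc, mul_pow]; ring
    _ ≤ b.eval 1 * 24 ^ b.natDegree * (d * x) ^ (b.natDegree + 1) +
        30 * (d * x) ^ (b.natDegree + 1) := by
      have := mul_le_mul_of_nonneg_left h6 h8
      linarith
    _ = _ := by push_cast; rw [mul_pow]; ring

theorem cast_le_of_le_rpow_one_div {N r P : ℕ} (hN : 1 ≤ N) (hr : 0 < r)
    (h : (P : ℝ) ≤ (N : ℝ) ^ (1 / (r : ℝ))) : P ≤ N := by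
  have h1 : (N : ℝ) ^ (1 / (r : ℝ)) ≤ (N : ℝ) ^ (1 : ℝ) := by
    refine Real.rpow_le_rpow_of_exponent_le (by exact_mod_cast hN) ?_
    rw [div_le_one (by exact_mod_cast hr)]
    exact_mod_cast hr
  rw [Real.rpow_one] at h1
  exact_mod_cast h.trans h1

end BitCost

theorem mainTheorem5 :
    ∃ (A : BitCost.Prog) (C : ℝ) (c k : ℕ),
      ∀ (N s r d m P H G : ℕ),
        (∃ α : ℝ, 0 < α ∧ α < 1 / 2 ∧ (N : ℝ) ^ α ≤ (s : ℝ)) →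
        Nat.gcd N s = 1 →
        0 < r → (r : ℝ) ≤ Real.logb 2 (N : ℝ) →
        0 < d → (m : ℝ) ≤ (d : ℝ) / (r : ℝ) →
        H < P → (P : ℝ) ≤ (N : ℝ) ^ (1 / (r : ℝ)) →
        G = ⌈(H : ℝ) / (s : ℝ)⌉₊ + 1 →
        (G : ℝ) ^ (((d : ℝ) - 1) / 2) <
          1 / ((d : ℝ) ^ ((1 : ℝ) / 2) * (2 : ℝ) ^ (((d : ℝ) - 1) / 4)) *
            (((P : ℝ) - (H : ℝ)) ^ (r * m) /
              (N : ℝ) ^ ((r : ℝ) * (m : ℝ) * ((m : ℝ) + 1) / (2 * (d : ℝ)))) →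
        ∃ (L : List ℤ) (t : ℕ),
          A.Eval ([N, s, r, d, m, P, H].map fun n : ℕ => BitCost.Val.int (n : ℤ))
            (BitCost.Val.ofList L) t ∧
          (∀ p : ℤ, p ∈ L ↔
            (P : ℤ) - (H : ℤ) ≤ p ∧ p ≤ (P : ℤ) + (H : ℤ) ∧ p ^ r ∣ (N : ℤ) ∧
              p ≡ 1 [ZMOD (s : ℤ)]) ∧
          (t : ℝ) ≤ C * (d : ℝ) ^ c * (Real.logb 2 (N : ℝ)) ^ k := by
  -- Inputs are restricted to positive `N`, because membership in `PT` requires the loops to end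
  -- with bounded states on every element of the input type.
  obtain ⟨main, T, hmain, ⟨b, hb⟩, -⟩ := BitCost.PT.divisorList
    (γ := {x : ℕ × ℕ × BitCost.Una × BitCost.Una × BitCost.Una × ℕ × ℕ // 0 < x.1})
    (N := fun x => x.1.1) (s := fun x => x.1.2.1) (r := fun x => x.1.2.2.1)
    (n := fun x => x.1.2.2.2.1) (m := fun x => x.1.2.2.2.2.1) (P := fun x => x.1.2.2.2.2.2.1)
    (H := fun x => x.1.2.2.2.2.2.2) (by fun_prop) (by fun_prop) (by fun_prop) (by fun_prop)
    (by fun_prop) (by fun_prop) (by fun_prop) (fun x => x.2)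
  refine ⟨BitCost.topProg main, ((b.eval 1 * 24 ^ b.natDegree + 30 : ℕ) : ℝ), b.natDegree + 1,
    b.natDegree + 1, fun N s r d m P H G hα hgcd hr hrN hd hm hHP hP hG hsize => ?_⟩
  have hr' : (1 : ℝ) ≤ r := by exact_mod_cast hr
  have hlog : 1 ≤ Real.logb 2 (N : ℝ) := hr'.trans hrN
  have hN : 0 < N := by
    rcases Nat.eq_zero_or_pos N with rfl | h
    · norm_num at hlog
    · exact h
  have hs : 0 < s := by
    obtain ⟨α, -, -, h⟩ := hα
    have : (0 : ℝ) < s := lt_of_lt_of_le (Real.rpow_pos_of_pos (by exact_mod_cast hN) α) h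
    exact_mod_cast this
  have hPN := BitCost.cast_le_of_le_rpow_one_div hN hr hP
  have hHN : H ≤ N := by omega
  have e1 := BitCost.bitLen_le_logb le_rfl (n := N)
  have e2 := BitCost.bitLen_le_logb hPN
  have e3 := BitCost.bitLen_le_logb hHN
  have hrm : r * m ≤ d := by
    rw [le_div_iff₀ (by linarith)] at hm
    rw [mul_comm]
    exact_mod_cast hm
  rcases lt_or_ge N s with h | h
  · obtain ⟨t, ht, hev⟩ := BitCost.topProg_eval_of_lt main r d m P H h
    refine ⟨_, t, hev, BitCost.mem_ite_iff hN hr h hHP, ?_⟩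
    -- The main program is not called here: the size argument is taken to be `1` and the whole time
    -- is accounted for by `e`.
    refine BitCost.time_le (e := BitCost.bitLen N + BitCost.bitLen P + BitCost.bitLen H + 20)
      hlog le_rfl hd ?_ ?_ (ht.trans (Nat.le_add_left _ _))
    · have : (1 : ℝ) ≤ d := by exact_mod_cast hd
      push_cast
      nlinarith
    · push_cast
      linarith
  · rw [hG, BitCost.ceil_div_add_one_eq_halfWidth hs] at hsize
    obtain ⟨t, ht, hev⟩ := hmain ⟨(N, s, ⟨r⟩, ⟨d⟩, ⟨m⟩, P, H), hN⟩
    rw [BitCost.enc_list_int] at hev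
    obtain ⟨t', ht', hev'⟩ := BitCost.topProg_eval_of_le h hev
    refine ⟨_, t', hev', BitCost.mem_divisorList hN hs hgcd hr hd hrm hHP
      (BitCost.size_condition hN hd hsize), ?_⟩
    refine BitCost.time_le (w := BitCost.Enc.sz (N, s, BitCost.Una.mk r, BitCost.Una.mk d,
      BitCost.Una.mk m, P, H)) (e := BitCost.bitLen N + 20) hlog ?_ hd
      (BitCost.sz_input_le rfl hlog h hrN hd ((Nat.le_mul_of_pos_left m hr).trans hrm) hPN hHN) ?_ ?_
    · rw [BitCost.sz_prod]; omega
    · push_cast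
      linarith
    · have := hb ⟨(N, s, ⟨r⟩, ⟨d⟩, ⟨m⟩, P, H), hN⟩
      rw [BitCost.sz_subtype] at this
      dsimp only at this
      omega
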